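/- Let $m>0$. For $u\in L^2(\mathbb R^3;\mathbb R)$ let $\hat u(\xi)=\int_{\mathbb R^3}e^{-2\pi i\xi\cdot x}u(x)\,dx$ be its ($L^2$) Fourier transform, and let $$H^{1/2}(\mathbb R^3)=\Big\{u\in L^2(\mathbb R^3;\mathbb R):\int_{\mathbb R^3}(1+2\pi|\xi|)|\hat u(\xi)|^2\,d\xi<\infty\Big\}.$$ For $\mu\ge 0$ and $u\in H^{1/2}(\mathbb R^3)$ put $T_\mu(u)=\int_{\mathbb R^3}\sqrt{|2\pi\xi|^2+\mu^2}\,|\hat u(\xi)|^2\,d\xi$ (the quadratic form of $\sqrt{-\Delta+\mu^2}$), and for $u,v\in H^{1/2}(\mathbb R^3)$ put $$D(u,v)=\iint_{\mathbb R^3\times\mathbb R^3}\frac{u(x)^2v(y)^2}{|x-y|}\,dx\,dy .$$ Let $Q\in H^{1/2}(\mathbb R^3)$ be a positive, radially symmetric ground state solution of $$\sqrt{-\Delta}\,u+u=\big(|x|^{-1}*u^2\big)u\quad\text{in }\mathbb R^3,\qquad u\in H^{1/2}(\mathbb R^3),$$ that is, a nonzero weak solution (tested against all functions in $H^{1/2}(\mathbb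 R^3)$) whose action $\frac12T_0(u)+\frac12\|u\|_2^2-\frac14D(u,u)$ is least among all nonzero weak solutions. Put $a^*=\|Q\|_2^2$. Let $V_1,V_2:\mathbb R^3\to\mathbb R$ satisfy, for $i=1,2$, $$V_i\in L^\infty_{\rm loc}(\mathbb R^3),\qquad \lim_{|x|\to\infty}V_i(x)=\infty,\qquad \inf_{x\in\mathbb R^3}V_i(x)=0.$$ Let $\mathcal M$ be the set of pairs $(u_1,u_2)$ with $u_i\in H^{1/2}(\mathbb R^3)$, $\int_{\mathbb R^3} V_iu_i^2\,dx<\infty$ and $\int_{\mathbb R^3} u_i^2\,dx=1$ for $i=1,2$. For $a_1,a_2,\beta\in\mathbb R$ and $(u_1,u_2)\in\mathcal M$ let $$E_{a_1,a_2,\beta}(u_1,u_2)=\sum_{i=1}^2\Big(T_m(u_i)+\int_{\mathbb R^3}V_iu_i^2\,dx-\frac{a_i}{2}D(u_i,u_i)\Big)-\beta D(u_1,u_2),$$ $$\hat e(a_1,a_2,\beta)=\inf_{(u_1,u_2)\in\mathcal M}E_{a_1,a_2,\beta}(u_1,u_2)\in[-\infty,\infty).$$ A minimizer for $\hat e(a_1,a_2,\beta)$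 is a pair $(u_1,u_2)\in\mathcal M$ with $E_{a_1,a_2,\beta}(u_1,u_2)=\hat e(a_1,a_2,\beta)$. Then: (i) If $a_1,a_2\in(0,a^*)$ and $\beta<\beta_*:=\sqrt{(a^*-a_1)(a^*-a_2)}$ (negative $\beta$ being allowed), then $\hat e(a_1,a_2,\beta)$ has a minimizer. (ii) If $a_1>a^*$, or $a_2>a^*$, or $\beta>\beta^*:=\frac{a^*-a_1}{2}+\frac{a^*-a_2}{2}$, then $\hat e(a_1,a_2,\beta)$ has no minimizer. -/

import Mathlib

open MeasureTheory FourierTransform Filter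
open scoped ENNReal

noncomputable section

namespace Hartree

/-- Three-dimensional Euclidean space. -/
abbrev R3 : Type := EuclideanSpace ℝ (Fin 3)

/-- The real space `L²(ℝ³; ℝ)`. -/
abbrev L2 : Type := Lp ℝ 2 (volume : Measure R3)

/-- The `L²` Fourier transform `û(ξ) = ∫ e^{-2πi ξ·x} u(x) dx` of a real-valued `u ∈ L²`,
extended from Schwartz functions by Plancherel. -/
def fourierL2 (u : L2) : Lp ℂ 2 (volume : Measure R3) :=
  𝓕 (Complex.ofRealCLM.compLp u)

/-- `H^{1/2}(ℝ³)`: real-valued `u ∈ L²` with `∫ (1 + 2π|ξ|) |û(ξ)|² dξ < ∞`. -/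
def HHalf : Set L2 :=
  {u | Integrable (fun ξ : R3 => (1 + 2 * Real.pi * ‖ξ‖) * ‖fourierL2 u ξ‖ ^ 2) volume}

/-- The quadratic form `(√(-Δ + m²) u, u) = ∫ √(|2πξ|² + m²) |û(ξ)|² dξ`. For `m = 0` it is
`‖(-Δ)^{1/4} u‖₂²`. -/
def kinetic (m : ℝ) (u : L2) : ℝ :=
  ∫ ξ : R3, Real.sqrt ((2 * Real.pi * ‖ξ‖) ^ 2 + m ^ 2) * ‖fourierL2 u ξ‖ ^ 2

/-- The pairing `(√(-Δ) u, φ) = ∫ 2π|ξ| û(ξ) conj(φ̂(ξ)) dξ`. For real-valued `u` and `φ` it is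
real, so its real part is taken under the integral. -/
def sqrtLaplacianPairing (u φ : L2) : ℝ :=
  ∫ ξ : R3, 2 * Real.pi * ‖ξ‖ *
    (fourierL2 u ξ * (starRingEnd ℂ) (fourierL2 φ ξ)).re

/-- The Hartree potential `(|x|⁻¹ ∗ u²)(x) = ∫ u(y)² / |x - y| dy`. -/
def hartreePotential (u : L2) (x : R3) : ℝ :=
  ∫ y : R3, u y ^ 2 / ‖x - y‖

/-- The double integral `∬ u(x)² v(y)² / |x - y| dx dy`. -/
def hartreeEnergy (u v : L2) : ℝ :=
  ∫ p : R3 × R3, u p.1 ^ 2 * v p.2 ^ 2 / ‖p.1 - p.2‖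

/-! ### Ground states of `√(-Δ) u + u = (|x|⁻¹ ∗ u²) u` -/

/-- `u ∈ H^{1/2}(ℝ³)` is a weak solution of `√(-Δ) u + u = (|x|⁻¹ ∗ u²) u`. -/
def IsWeakSolution (u : L2) : Prop :=
  u ∈ HHalf ∧ ∀ φ ∈ HHalf,
    sqrtLaplacianPairing u φ + ∫ x : R3, u x * φ x =
      ∫ x : R3, hartreePotential u x * u x * φ x

/-- The action functional whose critical points are the solutions of
`√(-Δ) u + u = (|x|⁻¹ ∗ u²) u`. -/
def action (u : L2) : ℝ :=
  (1 / 2) * kinetic 0 u + (1 / 2) * (∫ x : R3, u x ^ 2) - (1 / 4) * hartreeEnergy u u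

/-- A ground state solution: a nontrivial solution of least action among all nontrivial
solutions. -/
def IsGroundState (Q : L2) : Prop :=
  IsWeakSolution Q ∧ Q ≠ 0 ∧ ∀ w : L2, IsWeakSolution w → w ≠ 0 → action Q ≤ action w

/-- Radial symmetry of (the almost-everywhere class of) `Q`. -/
def IsRadial (Q : L2) : Prop :=
  ∃ f : ℝ → ℝ, ∀ᵐ x : R3, Q x = f ‖x‖

/-- Positivity of (the almost-everywhere class of) `Q`. -/
def IsPositive (Q : L2) : Prop :=
  ∀ᵐ x : R3, 0 < Q x

/-! ### The constrained minimization problem -/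

/-- The assumption on a trapping potential: `V ∈ L^∞_loc(ℝ³)`, `V(x) → ∞` as `|x| → ∞`, and
`inf V = 0`. -/
structure IsTrapping (V : R3 → ℝ) : Prop where
  locBdd : ∀ K : Set R3, IsCompact K → MemLp V ∞ (volume.restrict K)
  tendsto : Tendsto V (cocompact R3) atTop
  inf_eq : IsGLB (Set.range V) 0

/-- `u ∈ H^{1/2}(ℝ³)` with `∫ V u² < ∞`. -/
def trapSpace (V : R3 → ℝ) : Set L2 :=
  {u | u ∈ HHalf ∧ Integrable (fun x : R3 => V x * u x ^ 2) volume}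

/-- The constraint set of pairs with `∫ u₁² = ∫ u₂² = 1`. -/
def constraintSet (V₁ V₂ : R3 → ℝ) : Set (L2 × L2) :=
  {u | u.1 ∈ trapSpace V₁ ∧ u.2 ∈ trapSpace V₂ ∧
    ∫ x : R3, u.1 x ^ 2 = 1 ∧ ∫ x : R3, u.2 x ^ 2 = 1}

/-- The energy functional `E_{a₁,a₂,β}(u₁,u₂)`. -/
def energy (m : ℝ) (V₁ V₂ : R3 → ℝ) (a₁ a₂ β : ℝ) (u : L2 × L2) : ℝ :=
  (kinetic m u.1 + ∫ x : R3, V₁ x * u.1 x ^ 2) +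
  (kinetic m u.2 + ∫ x : R3, V₂ x * u.2 x ^ 2) -
  a₁ / 2 * hartreeEnergy u.1 u.1 - a₂ / 2 * hartreeEnergy u.2 u.2 -
  β * hartreeEnergy u.1 u.2

/-- The infimum `ê(a₁,a₂,β)` of the energy over the constraint set, possibly `-∞`. -/
def minEnergy (m : ℝ) (V₁ V₂ : R3 → ℝ) (a₁ a₂ β : ℝ) : EReal :=
  ⨅ u ∈ constraintSet V₁ V₂, (energy m V₁ V₂ a₁ a₂ β u : EReal)

/-- `u` is a minimizer of the constrained problem: it is admissible and attains the infimum. -/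
def IsMinimizer (m : ℝ) (V₁ V₂ : R3 → ℝ) (a₁ a₂ β : ℝ) (u : L2 × L2) : Prop :=
  u ∈ constraintSet V₁ V₂ ∧
    (energy m V₁ V₂ a₁ a₂ β u : EReal) = minEnergy m V₁ V₂ a₁ a₂ β

end Hartree

end

/-! Write `T` for `kinetic 0`, `D` for `hartreeEnergy`, `A = ‖Q‖²` and `N(u) = T(u) + ‖u‖²`.
Everything rests on the sharp inequality `A D(u,u) ≤ 2 T(u) ‖u‖²`, with equality at `Q`
(`IsGroundState.sharp`): under dilations `T` and `D` both scale linearly, so the problem is mass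
critical and `A` is the critical coupling.

The inequality comes from maximizing `D/N²`. A maximizing sequence keeps mass in some ball
(`exists_ballAverage_gt`), so after translations it has a nonzero weak limit. Along it `N` splits
exactly and `D` splits up to a vanishing error (`WeaklyNull.exists_error`), and `s² + (1-s)² < 1`
for `0 < s < 1` forces all of `N` into the limit. The maximizer, rescaled, solves the equation;
comparing its action with that of `Q` shows that `Q` is itself a maximizer. Balancing `T` and `‖u‖²`
by a dilation turns the bound by `N²` into the product form, and equality at `Q` gives `T(Q) =
‖Q‖²`.

For existence, the Coulomb kernel is a superposition of products of Gaussians, hence positive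
definite, so `2√(pq) D(u,v) ≤ p D(u,u) + q D(v,v)`. With the sharp inequality this makes the energy
coercive when `β` is below `√((A-a₁)(A-a₂))` (`IsGroundState.exists_coercive`). The trapping
potentials upgrade weak to strong `L²` convergence, `D` is `L²`-continuous on sets of bounded
kinetic energy, and the remaining terms are lower semicontinuous.

For nonexistence, truncations of `Q` are almost optimal; dilating them in one component, or in both
at once, sends the energy to `-∞` linearly in the dilation parameter, since the potential energy of
functions with shrinking support stays bounded.

Analytically, the Fourier form `T` is rewritten as a Gagliardo double integral, in which cutoffs,
dilations and ball averages are elementary. A Hardy inequality (`hardy_centered`) bounds the Coulomb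
potential of `f²` uniformly by the Gagliardo seminorm, and all estimates on `D` reduce to it. -/

noncomputable section

namespace Hartree

/-! ### The `L²` Fourier transform of a translate -/

/-- The translate `x ↦ f (x + h)` of an `L²` function. -/
def translate {E : Type*} [NormedAddCommGroup E] (h : R3) (f : Lp E 2 (volume : Measure R3)) :
    Lp E 2 (volume : Measure R3) :=
  Lp.compMeasurePreserving (fun x => x + h) (measurePreserving_add_right volume h) f

theorem coeFn_translate {E : Type*} [NormedAddCommGroup E] (h : R3)
    (f : Lp E 2 (volume : Measure R3)) :
    ∀ᵐ x, translate h f x = f (x + h) :=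
  Lp.coeFn_compMeasurePreserving f (measurePreserving_add_right volume h)

theorem continuous_translate {E : Type*} [NormedAddCommGroup E] (h : R3) :
    Continuous (translate (E := E) h) :=
  (Lp.isometry_compMeasurePreserving (measurePreserving_add_right volume h)).continuous

/-- The phase `e^{2πi h·ξ}` of a translation. -/
def phase (h ξ : R3) : ℂ := (Real.fourierChar (inner ℝ h ξ) : ℂ)

theorem norm_phase (h ξ : R3) : ‖phase h ξ‖ = 1 := Circle.norm_coe _

theorem continuous_phase : Continuous fun p : R3 × R3 => phase p.1 p.2 := by
  unfold phase
  have := Real.continuous_fourierChar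
  fun_prop

theorem fourier_translate_schwartz (h : R3) (f : SchwartzMap R3 ℂ) :
    ∀ᵐ ξ, (𝓕 (translate h (f.toLp 2 volume)) : Lp ℂ 2 (volume : Measure R3)) ξ =
      phase h ξ * (𝓕 (f.toLp 2 volume) : Lp ℂ 2 (volume : Measure R3)) ξ := by
  set g : SchwartzMap R3 ℂ := SchwartzMap.compSubConstCLM ℂ (-h) f with hg
  have h1 : translate h (f.toLp 2 volume) = g.toLp 2 volume := by
    refine Lp.ext ?_
    filter_upwards [coeFn_translate h (f.toLp 2 volume), g.coeFn_toLp 2 volume,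
      (measurePreserving_add_right volume h).quasiMeasurePreserving.ae (f.coeFn_toLp 2 volume)]
      with x hx1 hx2 hx3
    rw [hx1, hx2, hx3, hg, SchwartzMap.compSubConstCLM_apply, sub_neg_eq_add]
  rw [h1, SchwartzMap.toLp_fourier_eq, SchwartzMap.toLp_fourier_eq]
  filter_upwards [(𝓕 g).coeFn_toLp 2 volume, (𝓕 f).coeFn_toLp 2 volume] with ξ hx1 hx2
  rw [hx1, hx2, SchwartzMap.fourier_coe, SchwartzMap.fourier_coe]
  have hgf : (g : R3 → ℂ) = (f : R3 → ℂ) ∘ fun x => x + h := by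
    ext x
    simp [hg, SchwartzMap.compSubConstCLM_apply]
  have := VectorFourier.fourierIntegral_comp_add_right Real.fourierChar (volume : Measure R3)
    (innerₗ R3) (f : R3 → ℂ) h
  rw [hgf]
  have h2 := congrFun this ξ
  rw [Circle.smul_def, smul_eq_mul] at h2
  exact h2

/-- Schwartz functions are dense and the property is closed: `L²` limits of both sides become almost
everywhere limits along a subsequence. -/
theorem fourier_translate (h : R3) (f : Lp ℂ 2 (volume : Measure R3)) :
    ∀ᵐ ξ, 𝓕 (translate h f) ξ = phase h ξ * 𝓕 f ξ := by
  refine DenseRange.induction_on (p := fun f : Lp ℂ 2 (volume : Measure R3) =>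
    ∀ᵐ ξ, 𝓕 (translate h f) ξ = phase h ξ * 𝓕 f ξ)
    (SchwartzMap.denseRange_toLpCLM (E := R3) (F := ℂ) (p := 2) (μ := volume)
      ENNReal.ofNat_ne_top) f ?_
    (fun f => fourier_translate_schwartz h f)
  refine isClosed_of_closure_subset fun f hf => ?_
  obtain ⟨s, hs, hlim⟩ := mem_closure_iff_seq_limit.1 hf
  have hF : Continuous (𝓕 : Lp ℂ 2 (volume : Measure R3) → Lp ℂ 2 (volume : Measure R3)) :=
    (Lp.fourierTransformₗᵢ R3 ℂ).continuous
  have c1 : Tendsto (fun n => 𝓕 (translate h (s n))) atTop (nhds (𝓕 (translate h f))) :=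
    ((hF.comp (continuous_translate h)).tendsto f).comp hlim
  have c2 : Tendsto (fun n => 𝓕 (s n)) atTop (nhds (𝓕 f)) := (hF.tendsto f).comp hlim
  -- The second subsequence is taken inside the first, so that both transforms converge almost
  -- everywhere along the same indices.
  obtain ⟨φ, hφ, hφa⟩ := (tendstoInMeasure_of_tendsto_Lp c1).exists_seq_tendsto_ae
  obtain ⟨ψ, hψ, hψa⟩ := (tendstoInMeasure_of_tendsto_Lp
    (c2.comp hφ.tendsto_atTop)).exists_seq_tendsto_ae
  filter_upwards [hφa, hψa, ae_all_iff.2 hs] with ξ h1 h2 h3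
  refine tendsto_nhds_unique (h1.comp hψ.tendsto_atTop) ?_
  have := h2.const_mul (phase h ξ)
  refine this.congr fun n => ?_
  simp [h3]

/-- Plancherel in the form `∫ ‖f‖² = ∫ ‖𝓕 f‖²`. -/
theorem lintegral_fourier_sq (f : Lp ℂ 2 (volume : Measure R3)) :
    ∫⁻ ξ, ‖𝓕 f ξ‖ₑ ^ 2 = ∫⁻ x, ‖f x‖ₑ ^ 2 := by
  have h1 : ∀ g : Lp ℂ 2 (volume : Measure R3), ∫⁻ x, ‖g x‖ₑ ^ 2 = ‖g‖ₑ ^ 2 := by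
    intro g
    rw [Lp.enorm_def, eLpNorm_eq_lintegral_rpow_enorm_toReal (by simp) (by simp),
      ← ENNReal.rpow_natCast, ← ENNReal.rpow_mul]
    simp
  rw [h1, h1, ← ofReal_norm, ← ofReal_norm, Lp.norm_fourier_eq]

theorem lintegral_translate_sub_sq (h : R3) (f : Lp ℂ 2 (volume : Measure R3)) :
    ∫⁻ x, ‖f (x + h) - f x‖ₑ ^ 2 = ∫⁻ ξ, ‖phase h ξ - 1‖ₑ ^ 2 * ‖𝓕 f ξ‖ₑ ^ 2 := by
  have h1 : ∫⁻ x, ‖f (x + h) - f x‖ₑ ^ 2 = ∫⁻ x, ‖(translate h f - f) x‖ₑ ^ 2 := by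
    refine lintegral_congr_ae ?_
    filter_upwards [coeFn_translate h f, Lp.coeFn_sub (translate h f) f] with x h1 h2
    rw [h2, Pi.sub_apply, h1]
  rw [h1, ← lintegral_fourier_sq]
  refine lintegral_congr_ae ?_
  have h2 : 𝓕 (translate h f - f) = 𝓕 (translate h f) - 𝓕 f :=
    (Lp.fourierTransformₗᵢ R3 ℂ).map_sub _ _
  rw [h2]
  filter_upwards [fourier_translate h f, Lp.coeFn_sub (𝓕 (translate h f)) (𝓕 f)] with ξ h3 h4
  rw [h4, Pi.sub_apply, h3, ← mul_pow, ← enorm_mul, sub_mul, one_mul]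

/-! ### The Gagliardo seminorm -/

/-- The squared Gagliardo seminorm `∬ |f(x+h) - f(x)|² / |h|⁴ dx dh` of order `1/2`. -/
def gagliardo (f : R3 → ℝ) : ℝ≥0∞ :=
  ∫⁻ h : R3, ENNReal.ofReal (‖h‖ ^ 4)⁻¹ * ∫⁻ x : R3, ‖f (x + h) - f x‖ₑ ^ 2

/-- The symbol `∫ |e^{2πi h·ξ} - 1|² / |h|⁴ dh`. -/
def gagliardoSymbol (ξ : R3) : ℝ≥0∞ :=
  ∫⁻ h : R3, ENNReal.ofReal (‖h‖ ^ 4)⁻¹ * ‖phase h ξ - 1‖ₑ ^ 2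

theorem phase_map (e : R3 ≃ₗᵢ[ℝ] R3) (h ξ : R3) : phase (e h) (e ξ) = phase h ξ := by
  simp [phase]

theorem gagliardoSymbol_map (e : R3 ≃ₗᵢ[ℝ] R3) (ξ : R3) :
    gagliardoSymbol (e ξ) = gagliardoSymbol ξ := by
  unfold gagliardoSymbol
  rw [← (e.measurePreserving).lintegral_comp_emb e.toMeasurableEquiv.measurableEmbedding]
  simp only [phase_map, LinearIsometryEquiv.norm_map]

theorem lintegral_comp_smul (c : ℝ) (hc : 0 < c) (f : R3 → ℝ≥0∞) :
    ∫⁻ x, f (c • x) = ENNReal.ofReal (c ^ 3)⁻¹ * ∫⁻ x, f x := by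
  have h1 : Measure.map (fun x : R3 => c • x) volume = ENNReal.ofReal (c ^ 3)⁻¹ • volume := by
    have := Measure.map_addHaar_smul (volume : Measure R3) hc.ne'
    simpa [abs_of_pos (inv_pos.2 (pow_pos hc 3))] using this
  have h2 : MeasurableEmbedding (fun x : R3 => c • x) :=
    (Homeomorph.smulOfNeZero c hc.ne').measurableEmbedding
  rw [← h2.lintegral_map, h1, lintegral_smul_measure, smul_eq_mul]

theorem gagliardoSymbol_smul (c : ℝ) (hc : 0 < c) (ξ : R3) :
    gagliardoSymbol (c • ξ) = ENNReal.ofReal c * gagliardoSymbol ξ := by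
  unfold gagliardoSymbol
  have h1 := lintegral_comp_smul c hc
    (fun h => ENNReal.ofReal (c ^ 4) * (ENNReal.ofReal (‖h‖ ^ 4)⁻¹ * ‖phase h ξ - 1‖ₑ ^ 2))
  have h2 : ∀ h : R3, phase (c • h) ξ = phase h (c • ξ) := by
    intro h; simp [phase, inner_smul_left, inner_smul_right]
  have h3 : ∀ h : R3, ENNReal.ofReal (c ^ 4) * (ENNReal.ofReal (‖c • h‖ ^ 4)⁻¹ *
      ‖phase (c • h) ξ - 1‖ₑ ^ 2) = ENNReal.ofReal (‖h‖ ^ 4)⁻¹ * ‖phase h (c • ξ) - 1‖ₑ ^ 2 := by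
    intro h
    rw [h2, ← mul_assoc, ← ENNReal.ofReal_mul (by positivity), norm_smul, Real.norm_of_nonneg hc.le]
    congr 3
    field_simp
  simp only [h3] at h1
  rw [h1, lintegral_const_mul' _ _ ENNReal.ofReal_ne_top, ← mul_assoc,
    ← ENNReal.ofReal_mul (by positivity)]
  congr 2
  field_simp

/-- A unit vector. -/
def unitVec : R3 := EuclideanSpace.single 0 1

theorem norm_unitVec : ‖unitVec‖ = 1 := by simp [unitVec]

/-- The symbol is invariant under linear isometries and homogeneous of degree one; a reflection
exchanges `‖ξ‖ • unitVec` and `ξ`. -/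
theorem gagliardoSymbol_eq (ξ : R3) :
    gagliardoSymbol ξ = ENNReal.ofReal ‖ξ‖ * gagliardoSymbol unitVec := by
  rcases eq_or_ne ξ 0 with rfl | hξ
  · simp [gagliardoSymbol, phase]
  · have hpos : 0 < ‖ξ‖ := norm_pos_iff.2 hξ
    have h1 : ‖‖ξ‖ • unitVec‖ = ‖ξ‖ := by rw [norm_smul, norm_unitVec]; simp
    have h2 := Submodule.reflection_sub h1
    rw [← gagliardoSymbol_smul _ hpos, ← h2, gagliardoSymbol_map, h2]

/-- In polar coordinates the radial integrand is `min(1, r⁻²)`, which is at most `2 / (1 + r²)`. -/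
theorem integrable_inv_pow_mul_min :
    Integrable (fun h : R3 => (‖h‖ ^ 4)⁻¹ * min (‖h‖ ^ 2) 1) volume := by
  have := (integrable_fun_norm_addHaar (volume : Measure R3)
    (f := fun r : ℝ => (r ^ 4)⁻¹ * min (r ^ 2) 1)).2
  refine this ?_
  have h1 : IntegrableOn (fun y : ℝ => 2 * (1 + y ^ 2)⁻¹) (Set.Ioi 0) :=
    (integrable_inv_one_add_sq.const_mul 2).integrableOn
  refine Integrable.mono' h1 (Measurable.aestronglyMeasurable (by fun_prop)) ?_
  refine (ae_restrict_iff' measurableSet_Ioi).2 (Eventually.of_forall fun y hy => ?_)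
  have hy : (0 : ℝ) < y := hy
  have hfin : Module.finrank ℝ R3 - 1 = 2 := by simp
  rw [hfin, smul_eq_mul, Real.norm_of_nonneg (by positivity)]
  have e : y ^ 2 * ((y ^ 4)⁻¹ * min (y ^ 2) 1) = min (y ^ 2) 1 / y ^ 2 := by field_simp
  rw [e, ← div_eq_mul_inv, div_le_div_iff₀ (by positivity) (by positivity)]
  rcases le_total (y ^ 2) 1 with h | h
  · rw [min_eq_left h]; nlinarith [sq_nonneg y]
  · rw [min_eq_right h]; nlinarith

/-- The constant `∫ min(|h|², 1) / |h|⁴ dh`. -/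
def cutoffConst : ℝ≥0∞ := ∫⁻ h : R3, ENNReal.ofReal ((‖h‖ ^ 4)⁻¹ * min (‖h‖ ^ 2) 1)

theorem cutoffConst_lt_top : cutoffConst < ∞ :=
  integrable_inv_pow_mul_min.lintegral_lt_top

theorem norm_phase_sub_one_sq_le (h ξ : R3) :
    ‖phase h ξ - 1‖ ^ 2 ≤ (40 * (1 + ‖ξ‖ ^ 2)) * min (‖h‖ ^ 2) 1 := by
  have h1 : ‖phase h ξ - 1‖ ≤ 2 := by
    calc ‖phase h ξ - 1‖ ≤ ‖phase h ξ‖ + ‖(1 : ℂ)‖ := norm_sub_le _ _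
      _ = 2 := by rw [norm_phase]; norm_num
  have h2 : ‖phase h ξ - 1‖ ≤ 2 * Real.pi * (‖h‖ * ‖ξ‖) := by
    have e : phase h ξ = Complex.exp (Complex.I * ((2 * Real.pi * inner ℝ h ξ : ℝ) : ℂ)) := by
      rw [phase, Real.fourierChar_apply, mul_comm]
    rw [e]
    refine Real.norm_exp_I_mul_ofReal_sub_one_le.trans ?_
    rw [norm_mul, Real.norm_of_nonneg (by positivity)]
    exact mul_le_mul_of_nonneg_left (norm_inner_le_norm h ξ) (by positivity)
  have h0 := norm_nonneg (phase h ξ - 1)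
  -- The constant 40 is a bound for `4π²`; it also exceeds the trivial bound `2² = 4` used for `‖h‖
  -- ≥ 1`.
  have hpi : Real.pi ^ 2 ≤ 10 := by nlinarith [Real.pi_lt_d2, Real.pi_pos]
  rcases le_total (‖h‖ ^ 2) 1 with h | h
  · rw [min_eq_left h]
    calc ‖phase _ ξ - 1‖ ^ 2 ≤ (2 * Real.pi * (‖_‖ * ‖ξ‖)) ^ 2 := pow_le_pow_left₀ h0 h2 2
      _ = 4 * Real.pi ^ 2 * (‖_‖ ^ 2 * ‖ξ‖ ^ 2) := by ring
      _ ≤ 40 * (‖_‖ ^ 2 * ‖ξ‖ ^ 2) := by gcongr; linarith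
      _ ≤ _ := by nlinarith [sq_nonneg ‖ξ‖, sq_nonneg ‖‹R3›‖]
  · rw [min_eq_right h]
    nlinarith [sq_nonneg ‖ξ‖]

theorem gagliardoSymbol_lt_top (ξ : R3) : gagliardoSymbol ξ < ∞ := by
  have : gagliardoSymbol ξ ≤ ENNReal.ofReal (40 * (1 + ‖ξ‖ ^ 2)) * cutoffConst := by
    unfold gagliardoSymbol cutoffConst
    rw [← lintegral_const_mul' _ _ ENNReal.ofReal_ne_top]
    refine lintegral_mono fun h => ?_
    have e : ‖phase h ξ - 1‖ₑ ^ 2 = ENNReal.ofReal (‖phase h ξ - 1‖ ^ 2) := by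
      rw [ENNReal.ofReal_pow (norm_nonneg _), ofReal_norm]
    simp only [e]
    rw [← ENNReal.ofReal_mul (by positivity), ← ENNReal.ofReal_mul (by positivity)]
    refine ENNReal.ofReal_le_ofReal ?_
    calc _ ≤ (‖h‖ ^ 4)⁻¹ * ((40 * (1 + ‖ξ‖ ^ 2)) * min (‖h‖ ^ 2) 1) := by
          gcongr; exact norm_phase_sub_one_sq_le h ξ
      _ = _ := by ring
  exact this.trans_lt (ENNReal.mul_lt_top ENNReal.ofReal_lt_top cutoffConst_lt_top)

theorem measurable_gagliardoSymbol_integrand :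
    Measurable fun p : R3 × R3 => ENNReal.ofReal (‖p.1‖ ^ 4)⁻¹ * ‖phase p.1 p.2 - 1‖ₑ ^ 2 := by
  have := continuous_phase.measurable
  fun_prop

/-- If the integral vanished, the phase would be 1 almost everywhere and, by continuity, everywhere;
at half the unit vector it equals `e^{πi} = -1`. -/
theorem gagliardoSymbol_unitVec_pos : 0 < gagliardoSymbol unitVec := by
  unfold gagliardoSymbol
  rw [pos_iff_ne_zero]
  intro h0
  have hm := measurable_gagliardoSymbol_integrand.comp
    (measurable_id.prodMk (measurable_const (a := unitVec)))
  have h1 := (lintegral_eq_zero_iff hm).1 h0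
  have h2 : ∀ᵐ h : R3, phase h unitVec = 1 := by
    filter_upwards [h1, Measure.ae_ne (volume : Measure R3) 0] with h hh hne
    have : 0 < ‖h‖ := norm_pos_iff.2 hne
    have h3 : ENNReal.ofReal (‖h‖ ^ 4)⁻¹ ≠ 0 := by
      rw [ne_eq, ENNReal.ofReal_eq_zero, not_le]; positivity
    have h4 : ENNReal.ofReal (‖h‖ ^ 4)⁻¹ * ‖phase h unitVec - 1‖ₑ ^ 2 = 0 := hh
    simpa [h3, sub_eq_zero] using h4
  have hc : Continuous fun h : R3 => phase h unitVec := by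
    have := continuous_phase
    fun_prop
  have h3 : (fun h : R3 => phase h unitVec) = fun _ => 1 :=
    (Continuous.ae_eq_iff_eq volume hc continuous_const).1 h2
  have h4 := congrFun h3 ((1 / 2 : ℝ) • unitVec)
  simp only [phase, inner_smul_left, real_inner_self_eq_norm_sq, norm_unitVec] at h4
  rw [Real.fourierChar_apply] at h4
  have e : ((2 * Real.pi * ((starRingEnd ℝ) (1 / 2) * 1 ^ 2) : ℝ) : ℂ) * Complex.I
      = Real.pi * Complex.I := by
    simp; ring
  rw [e, Complex.exp_pi_mul_I] at h4
  norm_num at h4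

/-! ### The kinetic energy through the Gagliardo seminorm -/

theorem coeFn_complexify (u : L2) : ∀ᵐ x, (Complex.ofRealCLM.compLp u : R3 → ℂ) x = (u x : ℂ) :=
  ContinuousLinearMap.coeFn_compLp _ u

theorem enorm_complex_ofReal (r : ℝ) : ‖(r : ℂ)‖ₑ = ‖r‖ₑ := by
  rw [← ofReal_norm, ← ofReal_norm, Complex.norm_real]

theorem lintegral_fourierL2_sq (u : L2) :
    ∫⁻ ξ, ‖fourierL2 u ξ‖ₑ ^ 2 = ∫⁻ x, ‖u x‖ₑ ^ 2 := by
  unfold fourierL2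
  rw [lintegral_fourier_sq]
  refine lintegral_congr_ae ?_
  filter_upwards [coeFn_complexify u] with x hx
  rw [hx, enorm_complex_ofReal]

theorem measurable_coeFn (u : L2) : Measurable u := (Lp.stronglyMeasurable u).measurable

theorem measurable_fourierL2 (u : L2) : Measurable (fourierL2 u) :=
  (Lp.stronglyMeasurable _).measurable

/-- Plancherel is applied to the increment for each fixed `h`, and Tonelli then exchanges `h` and
`ξ`. -/
theorem gagliardo_eq_symbol (u : L2) :
    gagliardo u = ∫⁻ ξ, gagliardoSymbol ξ * ‖fourierL2 u ξ‖ₑ ^ 2 := by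
  have h1 : ∀ h : R3, ∫⁻ x, ‖u (x + h) - u x‖ₑ ^ 2 =
      ∫⁻ ξ, ‖phase h ξ - 1‖ₑ ^ 2 * ‖fourierL2 u ξ‖ₑ ^ 2 := by
    intro h
    rw [fourierL2, ← lintegral_translate_sub_sq]
    refine lintegral_congr_ae ?_
    filter_upwards [coeFn_complexify u, (measurePreserving_add_right volume
      h).quasiMeasurePreserving.ae (coeFn_complexify u)] with x h2 h3
    rw [h2, h3, ← Complex.ofReal_sub, enorm_complex_ofReal]
  unfold gagliardo gagliardoSymbol
  simp only [h1]
  have hF := measurable_fourierL2 u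
  have hP := continuous_phase.measurable
  have h2 : ∀ h : R3, ENNReal.ofReal (‖h‖ ^ 4)⁻¹ *
      ∫⁻ ξ, ‖phase h ξ - 1‖ₑ ^ 2 * ‖fourierL2 u ξ‖ₑ ^ 2 =
      ∫⁻ ξ, ENNReal.ofReal (‖h‖ ^ 4)⁻¹ * ‖phase h ξ - 1‖ₑ ^ 2 * ‖fourierL2 u ξ‖ₑ ^ 2 := by
    intro h
    rw [← lintegral_const_mul' _ _ ENNReal.ofReal_ne_top]
    simp only [mul_assoc]
  simp only [h2]
  rw [lintegral_lintegral_swap]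
  · refine lintegral_congr fun ξ => ?_
    rw [lintegral_mul_const' _ _ (by finiteness)]
  · exact (measurable_gagliardoSymbol_integrand.mul (by fun_prop)).aemeasurable

/-- The constant in `(√(-Δ) u, u) = c ∬ |u(x+h) - u(x)|² / |h|⁴`. -/
def kineticConst : ℝ := 2 * Real.pi / (gagliardoSymbol unitVec).toReal

theorem symbol_toReal_pos : 0 < (gagliardoSymbol unitVec).toReal :=
  ENNReal.toReal_pos gagliardoSymbol_unitVec_pos.ne' (gagliardoSymbol_lt_top _).ne

theorem kineticConst_pos : 0 < kineticConst := by
  have := symbol_toReal_pos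
  unfold kineticConst; positivity

theorem lintegral_norm_mul_fourierL2_sq (u : L2) :
    ∫⁻ ξ, ENNReal.ofReal (2 * Real.pi * ‖ξ‖) * ‖fourierL2 u ξ‖ₑ ^ 2 =
      ENNReal.ofReal kineticConst * gagliardo u := by
  rw [gagliardo_eq_symbol, ← lintegral_const_mul' _ _ ENNReal.ofReal_ne_top]
  refine lintegral_congr fun ξ => ?_
  rw [gagliardoSymbol_eq, ← mul_assoc, ← ENNReal.ofReal_toReal (gagliardoSymbol_lt_top unitVec).ne,
    ← ENNReal.ofReal_mul (by positivity), ← ENNReal.ofReal_mul kineticConst_pos.le, kineticConst]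
  have := symbol_toReal_pos.ne'
  congr 2
  field_simp

theorem ofReal_mul_norm_sq {c : ℝ} (hc : 0 ≤ c) (z : ℂ) :
    ENNReal.ofReal (c * ‖z‖ ^ 2) = ENNReal.ofReal c * ‖z‖ₑ ^ 2 := by
  rw [ENNReal.ofReal_mul hc, ENNReal.ofReal_pow (norm_nonneg _), ofReal_norm]

/-- No membership in `HHalf` is needed: if the form diverges, the Bochner integral and the `toReal`
are both 0. -/
theorem kinetic_zero_eq (u : L2) : kinetic 0 u = kineticConst * (gagliardo u).toReal := by
  have hF := measurable_fourierL2 u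
  unfold kinetic
  rw [integral_eq_lintegral_of_nonneg_ae]
  · have : ∀ ξ : R3, ENNReal.ofReal (Real.sqrt ((2 * Real.pi * ‖ξ‖) ^ 2 + 0 ^ 2) *
        ‖fourierL2 u ξ‖ ^ 2) = ENNReal.ofReal (2 * Real.pi * ‖ξ‖) * ‖fourierL2 u ξ‖ₑ ^ 2 := by
      intro ξ
      rw [ofReal_mul_norm_sq (by positivity)]
      congr 2
      rw [zero_pow two_ne_zero, add_zero, Real.sqrt_sq (by positivity)]
    simp only [this]
    rw [lintegral_norm_mul_fourierL2_sq, ENNReal.toReal_mul,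
      ENNReal.toReal_ofReal kineticConst_pos.le]
  · exact Eventually.of_forall fun ξ => by positivity
  · exact Measurable.aestronglyMeasurable (by fun_prop)

theorem lintegral_sq_eq (u : L2) : ∫⁻ x, ‖u x‖ₑ ^ 2 = ENNReal.ofReal (‖u‖ ^ 2) := by
  rw [ENNReal.ofReal_pow (norm_nonneg _), ofReal_norm, Lp.enorm_def,
    eLpNorm_eq_lintegral_rpow_enorm_toReal (by simp) (by simp),
      ← ENNReal.rpow_natCast, ← ENNReal.rpow_mul]
  simp

theorem integral_sq_eq (u : L2) : ∫ x, u x ^ 2 = ‖u‖ ^ 2 := by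
  have hF := measurable_coeFn u
  rw [integral_eq_lintegral_of_nonneg_ae (Eventually.of_forall fun x => sq_nonneg (u x))
    (Measurable.aestronglyMeasurable (by fun_prop))]
  have : ∀ x, ENNReal.ofReal (u x ^ 2) = ‖u x‖ₑ ^ 2 := by
    intro x
    rw [← sq_abs, ENNReal.ofReal_pow (abs_nonneg _), ← Real.norm_eq_abs, ofReal_norm]
  simp only [this]
  rw [lintegral_sq_eq, ENNReal.toReal_ofReal (by positivity)]

/-- This moves membership from Fourier space to position space, where products with cutoffs,
dilations and translations are easily controlled. -/
theorem mem_HHalf_iff (u : L2) : u ∈ HHalf ↔ gagliardo u < ∞ := by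
  have hF := measurable_fourierL2 u
  have h1 : ∫⁻ ξ : R3, ENNReal.ofReal ((1 + 2 * Real.pi * ‖ξ‖) * ‖fourierL2 u ξ‖ ^ 2) =
      ENNReal.ofReal (‖u‖ ^ 2) + ENNReal.ofReal kineticConst * gagliardo u := by
    rw [← lintegral_norm_mul_fourierL2_sq, ← lintegral_sq_eq, ← lintegral_fourierL2_sq,
      ← lintegral_add_left (by fun_prop)]
    refine lintegral_congr fun ξ => ?_
    rw [ofReal_mul_norm_sq (by positivity), ENNReal.ofReal_add (by positivity) (by positivity),
      add_mul, ENNReal.ofReal_one, one_mul]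
  have h2 : u ∈ HHalf ↔
      ∫⁻ ξ : R3, ENNReal.ofReal ((1 + 2 * Real.pi * ‖ξ‖) * ‖fourierL2 u ξ‖ ^ 2) < ∞ := by
    rw [HHalf, Set.mem_ofPred_eq, Integrable, hasFiniteIntegral_iff_ofReal
      (Eventually.of_forall fun ξ => by positivity)]
    exact and_iff_right (Measurable.aestronglyMeasurable (by fun_prop))
  rw [h2, h1]
  have := kineticConst_pos
  constructor
  · intro h
    by_contra hc
    rw [not_lt_top_iff] at hc
    rw [hc, ENNReal.mul_top (by simpa using this)] at h
    simp at h
  · intro h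
    finiteness

/-! ### A Hardy inequality -/

theorem gagliardo_eq_double {f : R3 → ℝ} (hf : Measurable f) :
    gagliardo f = ∫⁻ x, ∫⁻ y, ENNReal.ofReal (‖y - x‖ ^ 4)⁻¹ * ‖f y - f x‖ₑ ^ 2 := by
  unfold gagliardo
  have h1 : ∀ h : R3, ENNReal.ofReal (‖h‖ ^ 4)⁻¹ * ∫⁻ x, ‖f (x + h) - f x‖ₑ ^ 2 =
      ∫⁻ x, ENNReal.ofReal (‖h‖ ^ 4)⁻¹ * ‖f (x + h) - f x‖ₑ ^ 2 := by
    intro h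
    rw [lintegral_const_mul' _ _ ENNReal.ofReal_ne_top]
  simp only [h1]
  rw [lintegral_lintegral_swap (Measurable.aemeasurable (by fun_prop))]
  refine lintegral_congr fun x => ?_
  rw [← lintegral_add_left_eq_self
    (fun y => ENNReal.ofReal (‖y - x‖ ^ 4)⁻¹ * ‖f y - f x‖ₑ ^ 2) x]
  simp

theorem gagliardo_comp_add (f : R3 → ℝ) (a : R3) :
    gagliardo (fun x => f (x + a)) = gagliardo f := by
  unfold gagliardo
  refine lintegral_congr fun h => ?_
  congr 1
  rw [← lintegral_add_right_eq_self (fun x => ‖f (x + h) - f x‖ₑ ^ 2) a]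
  refine lintegral_congr fun x => ?_
  rw [add_right_comm]

/-- The volume of the unit ball. -/
def ballVol : ℝ := (volume (Metric.ball (0 : R3) 1)).toReal

theorem ballVol_pos : 0 < ballVol :=
  ENNReal.toReal_pos (Metric.measure_ball_pos _ _ one_pos).ne' measure_ball_lt_top.ne

theorem volume_ball_eq (x : R3) {r : ℝ} (hr : 0 ≤ r) :
    volume (Metric.ball x r) = ENNReal.ofReal (r ^ 3 * ballVol) := by
  rw [Measure.addHaar_ball _ _ hr, ENNReal.ofReal_mul (by positivity), ballVol,
    ENNReal.ofReal_toReal measure_ball_lt_top.ne]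
  simp

theorem volume_closedBall_eq (x : R3) {r : ℝ} (hr : 0 ≤ r) :
    volume (Metric.closedBall x r) = ENNReal.ofReal (r ^ 3 * ballVol) := by
  rw [Measure.addHaar_closedBall _ _ hr, ENNReal.ofReal_mul (by positivity), ballVol,
    ENNReal.ofReal_toReal measure_ball_lt_top.ne]
  simp

/-- The pairs `(x, y)` with `δ < |x|` and `4|x| < |y| < 8|x|`. -/
def hardySet (δ : ℝ) : Set (R3 × R3) := {p | δ < ‖p.1‖ ∧ 4 * ‖p.1‖ < ‖p.2‖ ∧ ‖p.2‖ < 8 * ‖p.1‖}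

theorem measurableSet_hardySet (δ : ℝ) : MeasurableSet (hardySet δ) := by
  unfold hardySet
  exact (measurableSet_lt measurable_const measurable_fst.norm).inter
    ((measurableSet_lt (measurable_fst.norm.const_mul 4) measurable_snd.norm).inter
    (measurableSet_lt measurable_snd.norm (measurable_fst.norm.const_mul 8)))

/-- The indicator function of `hardySet`. -/
def hardyInd (δ : ℝ) (x y : R3) : ℝ≥0∞ := (hardySet δ).indicator 1 (x, y)

theorem measurable_hardyInd (δ : ℝ) : Measurable fun p : R3 × R3 => hardyInd δ p.1 p.2 :=
  measurable_one.indicator (measurableSet_hardySet δ)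

/-- The section in `y` is a spherical shell, and `448 = 8³ - 4³`. -/
theorem lintegral_hardyInd_right {δ : ℝ} (hδ : 0 < δ) {x : R3} (hx : δ < ‖x‖) :
    ∫⁻ y, hardyInd δ x y = ENNReal.ofReal (448 * ‖x‖ ^ 3 * ballVol) := by
  have h1 : ∀ y, hardyInd δ x y =
      (Metric.ball (0 : R3) (8 * ‖x‖) \ Metric.closedBall 0 (4 * ‖x‖)).indicator 1 y := by
    intro y
    unfold hardyInd
    by_cases h : 4 * ‖x‖ < ‖y‖ ∧ ‖y‖ < 8 * ‖x‖
    · rw [Set.indicator_of_mem, Set.indicator_of_mem]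
      · rfl
      · simpa using h.symm
      · exact ⟨hx, h⟩
    · rw [Set.indicator_of_notMem, Set.indicator_of_notMem]
      · simp only [Set.mem_sdiff, Metric.mem_ball, dist_zero_right, Metric.mem_closedBall, not_le]
        tauto
      · rintro ⟨-, h'⟩
        exact h h'
  have hx0 : 0 < ‖x‖ := hδ.trans hx
  simp only [h1]
  rw [lintegral_indicator_one (measurableSet_ball.diff measurableSet_closedBall), measure_sdiff
    (Metric.closedBall_subset_ball (by linarith)) measurableSet_closedBall.nullMeasurableSet
    measure_closedBall_lt_top.ne, volume_ball_eq _ (by positivity),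
    volume_closedBall_eq _ (by positivity), ← ENNReal.ofReal_sub _ (by
      have := ballVol_pos; positivity)]
  congr 1
  ring

/-- `{x | δ < |x|}`. -/
def outside (δ : ℝ) : Set R3 := {x : R3 | δ < ‖x‖}

/-- On the section `‖y‖/8 < ‖x‖ < ‖y‖/4`, so the weight is at most `8⁴ ‖y‖⁻⁴` on a ball of volume
`ballVol ‖y‖³ / 64`; this gives `4096 / 64 = 64`. The section is empty when `‖y‖ ≤ δ`. -/
theorem lintegral_hardyInd_left_le {δ : ℝ} (hδ : 0 < δ) (y : R3) :
    ∫⁻ x, hardyInd δ x y * ENNReal.ofReal (‖x‖ ^ 4)⁻¹ ≤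
      (outside δ).indicator (fun y => ENNReal.ofReal (64 * ballVol * ‖y‖⁻¹)) y := by
  by_cases hy : δ < ‖y‖
  · have hy0 : 0 < ‖y‖ := hδ.trans hy
    rw [Set.indicator_of_mem (show y ∈ outside δ from hy)]
    calc ∫⁻ x, hardyInd δ x y * ENNReal.ofReal (‖x‖ ^ 4)⁻¹
        ≤ ∫⁻ x, (Metric.ball (0 : R3) (‖y‖ / 4)).indicator
            (fun _ => ENNReal.ofReal (4096 * (‖y‖ ^ 4)⁻¹)) x := by
          refine lintegral_mono fun x => ?_
          unfold hardyInd
          by_cases h : (x, y) ∈ hardySet δ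
          · obtain ⟨h1, h2, h3⟩ := h
            simp only at h1 h2 h3
            have hx0 : 0 < ‖x‖ := hδ.trans h1
            rw [Set.indicator_of_mem (show (x, y) ∈ hardySet δ from ⟨h1, h2, h3⟩),
              Set.indicator_of_mem (by simp; linarith), Pi.one_apply, one_mul]
            refine ENNReal.ofReal_le_ofReal ?_
            rw [← div_eq_mul_inv, inv_eq_one_div, div_le_div_iff₀ (by positivity) (by positivity),
              one_mul]
            calc ‖y‖ ^ 4 ≤ (8 * ‖x‖) ^ 4 := by gcongr
              _ = 4096 * ‖x‖ ^ 4 := by ring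
          · rw [Set.indicator_of_notMem h, zero_mul]
            exact zero_le
      _ = ENNReal.ofReal (64 * ballVol * ‖y‖⁻¹) := by
          rw [lintegral_indicator_const measurableSet_ball, volume_ball_eq _ (by positivity),
            ← ENNReal.ofReal_mul (by positivity)]
          congr 1
          field_simp
          ring
  · rw [Set.indicator_of_notMem (show y ∉ outside δ from hy)]
    refine le_of_eq ?_
    rw [lintegral_eq_zero_iff']
    · refine Eventually.of_forall fun x => ?_
      have : (x, y) ∉ hardySet δ := by
        rintro ⟨h1, h2, h3⟩
        simp only at h1 h2 h3
        exact hy (by linarith [norm_nonneg x])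
      simp [hardyInd, Set.indicator_of_notMem this]
    · have := (measurable_hardyInd δ).comp (measurable_id.prodMk (measurable_const (a := y)))
      exact Measurable.aemeasurable (Measurable.mul this (by fun_prop))

theorem enorm_sq_le_two_mul (a b : ℝ) : ‖a‖ₑ ^ 2 ≤ 2 * ‖b‖ₑ ^ 2 + 2 * ‖b - a‖ₑ ^ 2 := by
  have e : ∀ c : ℝ, ‖c‖ₑ ^ 2 = ENNReal.ofReal (c ^ 2) := by
    intro c
    rw [← sq_abs, ENNReal.ofReal_pow (abs_nonneg _), ← Real.norm_eq_abs, ofReal_norm]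
  rw [e, e, e, ← ENNReal.ofReal_ofNat 2, ← ENNReal.ofReal_mul (by norm_num),
    ← ENNReal.ofReal_mul (by norm_num), ← ENNReal.ofReal_add (by positivity) (by positivity)]
  refine ENNReal.ofReal_le_ofReal ?_
  nlinarith [sq_nonneg (2 * b - a)]

/-- The constant in the Hardy inequality. -/
def hardyConst : ℝ := 42 / ballVol

theorem hardyConst_pos : 0 < hardyConst := by
  have := ballVol_pos
  unfold hardyConst; positivity

theorem measurableSet_outside (δ : ℝ) : MeasurableSet (outside δ) :=
  measurableSet_lt measurable_const measurable_norm

theorem measurable_hardyInd_right (δ : ℝ) (x : R3) : Measurable fun y => hardyInd δ x y :=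
  Measurable.of_uncurry_left (f := hardyInd δ) (measurable_hardyInd δ)

theorem measurable_hardyInd_left (δ : ℝ) (y : R3) : Measurable fun x => hardyInd δ x y :=
  Measurable.of_uncurry_right (f := hardyInd δ) (measurable_hardyInd δ)

theorem hardy_left_term (f : R3 → ℝ) {δ : ℝ} (hδ : 0 < δ) :
     ∫⁻ x, ∫⁻ y, hardyInd δ x y * ENNReal.ofReal (‖x‖ ^ 4)⁻¹ * ‖f x‖ₑ ^ 2 =
    ENNReal.ofReal (448 * ballVol) *
        ∫⁻ x in outside δ, ENNReal.ofReal ‖x‖⁻¹ * ‖f x‖ₑ ^ 2  := by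
  have hb := ballVol_pos
  rw [← lintegral_const_mul' _ _ ENNReal.ofReal_ne_top, ← lintegral_indicator (measurableSet_outside δ)]
  refine lintegral_congr fun x => ?_
  have : ∀ y, hardyInd δ x y * ENNReal.ofReal (‖x‖ ^ 4)⁻¹ * ‖f x‖ₑ ^ 2 =
      hardyInd δ x y * (ENNReal.ofReal (‖x‖ ^ 4)⁻¹ * ‖f x‖ₑ ^ 2) := fun y => mul_assoc _ _ _
  simp only [this]
  rw [lintegral_mul_const _ (measurable_hardyInd_right δ x)]
  by_cases hx : δ < ‖x‖
  · have hx0 : 0 < ‖x‖ := hδ.trans hx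
    rw [lintegral_hardyInd_right hδ hx, Set.indicator_of_mem (show x ∈ outside δ from hx), ← mul_assoc,
      ← mul_assoc, ← ENNReal.ofReal_mul (by positivity), ← ENNReal.ofReal_mul (by positivity)]
    congr 2
    field_simp
  · rw [Set.indicator_of_notMem (show x ∉ outside δ from hx)]
    have : ∀ y, hardyInd δ x y = 0 := fun y => by
      unfold hardyInd
      rw [Set.indicator_of_notMem]
      rintro ⟨h, -⟩
      exact hx h
    simp [this]
theorem hardy_right_term_le {f : R3 → ℝ} (hf : Measurable f) {δ : ℝ} (hδ : 0 < δ) :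
     ∫⁻ x, ∫⁻ y, hardyInd δ x y * ENNReal.ofReal (‖x‖ ^ 4)⁻¹ * ‖f y‖ₑ ^ 2 ≤
    ENNReal.ofReal (64 * ballVol) *
        ∫⁻ x in outside δ, ENNReal.ofReal ‖x‖⁻¹ * ‖f x‖ₑ ^ 2   := by
  have hb := ballVol_pos
  rw [lintegral_lintegral_swap (Measurable.aemeasurable
    (((measurable_hardyInd δ).mul (by fun_prop)).mul (by fun_prop)))]
  rw [← lintegral_const_mul' _ _ ENNReal.ofReal_ne_top, ← lintegral_indicator (measurableSet_outside δ)]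
  refine lintegral_mono fun y => ?_
  simp only
  have hm := measurable_hardyInd_left δ y
  rw [lintegral_mul_const _ (by fun_prop)]
  refine (mul_le_mul_left (lintegral_hardyInd_left_le hδ y) _).trans (le_of_eq ?_)
  by_cases hy : δ < ‖y‖
  · rw [Set.indicator_of_mem (show y ∈ outside δ from hy), Set.indicator_of_mem (show y ∈ outside δ from hy),
      ← mul_assoc, ← ENNReal.ofReal_mul (by positivity)]
  · rw [Set.indicator_of_notMem (show y ∉ outside δ from hy), Set.indicator_of_notMem
      (show y ∉ outside δ from hy), zero_mul]
-- On `hardySet` the distance `‖y - x‖` is positive and at most `9‖x‖`, so `‖x‖⁻⁴` is at most `9⁴ =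
-- 6561` times the Gagliardo kernel.
theorem hardy_difference_term_le {f : R3 → ℝ} (hf : Measurable f) {δ : ℝ} (hδ : 0 < δ) :
     ∫⁻ x, ∫⁻ y, hardyInd δ x y * ENNReal.ofReal (‖x‖ ^ 4)⁻¹ * ‖f y - f x‖ₑ ^ 2 ≤
    ENNReal.ofReal 6561 * gagliardo f := by
  rw [gagliardo_eq_double hf, ← lintegral_const_mul' _ _ ENNReal.ofReal_ne_top]
  refine lintegral_mono fun x => ?_
  rw [← lintegral_const_mul' _ _ ENNReal.ofReal_ne_top]
  refine lintegral_mono fun y => ?_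
  simp only
  rw [← mul_assoc]
  gcongr ?_ * _
  unfold hardyInd
  by_cases h : (x, y) ∈ hardySet δ
  · obtain ⟨h1, h2, h3⟩ := h
    simp only at h1 h2 h3
    have hx0 : 0 < ‖x‖ := hδ.trans h1
    have hxy0 : 0 < ‖y - x‖ := by
      have := norm_sub_norm_le y x
      linarith
    have hxy : ‖y - x‖ ≤ 9 * ‖x‖ := by
      have := norm_sub_le y x
      linarith
    rw [Set.indicator_of_mem (show (x, y) ∈ hardySet δ from ⟨h1, h2, h3⟩), Pi.one_apply, one_mul,
      ← ENNReal.ofReal_mul (by norm_num)]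
    refine ENNReal.ofReal_le_ofReal ?_
    rw [← div_eq_mul_inv, inv_eq_one_div, div_le_div_iff₀ (by positivity) (by positivity),
      one_mul]
    calc ‖y - x‖ ^ 4 ≤ (9 * ‖x‖) ^ 4 := by gcongr
      _ = 6561 * ‖x‖ ^ 4 := by ring
  · rw [Set.indicator_of_notMem h, zero_mul]
    exact zero_le
-- The value `f x` is compared with `f y` for `y` in a shell of much larger radius. The Hardy weight
-- is smaller there, so the `f y` term returns only the fraction `128/448` of the left side and can
-- be absorbed; the difference term is a piece of the Gagliardo seminorm. Staying outside a ball
-- makes the left side finite, which the absorption requires.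
theorem hardy_outside_ball {f : R3 → ℝ} (hf : Measurable f) (hfin : ∫⁻ x, ‖f x‖ₑ ^ 2 < ∞)
    {δ : ℝ} (hδ : 0 < δ) :
    ∫⁻ x in outside δ, ENNReal.ofReal ‖x‖⁻¹ * ‖f x‖ₑ ^ 2 ≤
      ENNReal.ofReal hardyConst * gagliardo f := by
  set H := ∫⁻ x in outside δ, ENNReal.ofReal ‖x‖⁻¹ * ‖f x‖ₑ ^ 2 with hH
  have hb := ballVol_pos
  have hHfin : H < ∞ := by
    calc H ≤ ∫⁻ x in outside δ, ENNReal.ofReal δ⁻¹ * ‖f x‖ₑ ^ 2 := by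
          refine setLIntegral_mono' (measurableSet_outside δ) fun x hx => ?_
          have : δ < ‖x‖ := hx
          gcongr
      _ ≤ ∫⁻ x, ENNReal.ofReal δ⁻¹ * ‖f x‖ₑ ^ 2 := setLIntegral_le_lintegral _ _
      _ = ENNReal.ofReal δ⁻¹ * ∫⁻ x, ‖f x‖ₑ ^ 2 := lintegral_const_mul' _ _ ENNReal.ofReal_ne_top
      _ < ∞ := ENNReal.mul_lt_top ENNReal.ofReal_lt_top hfin
  have hI := measurable_hardyInd δ
  have hI1 := measurable_hardyInd_right δ
  have e1 := hardy_left_term f hδ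
  have e2 := hardy_right_term_le hf hδ
  have e3 := hardy_difference_term_le hf hδ
  rw [← hH] at e1 e2
  have key : ENNReal.ofReal (448 * ballVol) * H ≤
      2 * (ENNReal.ofReal (64 * ballVol) * H) + 2 * (ENNReal.ofReal 6561 * gagliardo f) := by
    rw [← e1]
    refine le_trans ?_ (add_le_add (mul_le_mul_right e2 2) (mul_le_mul_right e3 2))
    rw [← lintegral_const_mul' _ _ (by simp), ← lintegral_const_mul' _ _ (by simp),
      ← lintegral_add_left (Measurable.const_mul (Measurable.lintegral_prod_right
        ((hI.mul (by fun_prop)).mul (by fun_prop))) _)]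
    refine lintegral_mono fun x => ?_
    have hm := hI1 x
    rw [← lintegral_const_mul' _ _ (by simp), ← lintegral_const_mul' _ _ (by simp),
      ← lintegral_add_left (by fun_prop)]
    refine lintegral_mono fun y => ?_
    calc hardyInd δ x y * ENNReal.ofReal (‖x‖ ^ 4)⁻¹ * ‖f x‖ₑ ^ 2
        ≤ hardyInd δ x y * ENNReal.ofReal (‖x‖ ^ 4)⁻¹ * (2 * ‖f y‖ₑ ^ 2 + 2 * ‖f y - f x‖ₑ ^ 2) := by
          gcongr; exact enorm_sq_le_two_mul _ _
      _ = _ := by ring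
  rcases eq_or_ne (gagliardo f) ∞ with hG | hG
  · rw [hG, ENNReal.mul_top (by simpa using hardyConst_pos)]
    exact le_top
  · rw [← ENNReal.ofReal_toReal hHfin.ne, ← ENNReal.ofReal_toReal hG,
      ← ENNReal.ofReal_ofNat 2, ← ENNReal.ofReal_mul (by positivity),
      ← ENNReal.ofReal_mul (by positivity), ← ENNReal.ofReal_mul (by positivity),
      ← ENNReal.ofReal_mul (by positivity), ← ENNReal.ofReal_mul (by positivity),
      ← ENNReal.ofReal_add (by positivity) (by positivity),
      ENNReal.ofReal_le_ofReal_iff (by positivity)] at key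
    rw [← ENNReal.ofReal_toReal hHfin.ne, ← ENNReal.ofReal_toReal hG,
      ← ENNReal.ofReal_mul hardyConst_pos.le]
    refine ENNReal.ofReal_le_ofReal ?_
    rw [hardyConst, div_mul_eq_mul_div, le_div_iff₀ hb]
    have : 0 ≤ (gagliardo f).toReal := ENNReal.toReal_nonneg
    -- After absorption `320 ballVol H ≤ 13122 G`, where `320 = 448 - 2·64` and `13122 = 2·6561`;
    -- the constant 42 suffices because `320·42 = 13440`.
    nlinarith

/-- The bound outside a ball does not depend on the radius, so monotone convergence reaches the
complement of the origin, which has full measure. -/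
theorem hardy {f : R3 → ℝ} (hf : Measurable f) (hfin : ∫⁻ x, ‖f x‖ₑ ^ 2 < ∞) :
    ∫⁻ x, ENNReal.ofReal ‖x‖⁻¹ * ‖f x‖ₑ ^ 2 ≤ ENNReal.ofReal hardyConst * gagliardo f := by
  set S : ℕ → Set R3 := fun n => outside (1 / ((n : ℝ) + 1)) with hS
  have hmono : Monotone S := by
    intro n k hnk x hx
    have hx : 1 / ((n : ℝ) + 1) < ‖x‖ := hx
    exact lt_of_le_of_lt (Nat.one_div_le_one_div hnk) hx
  have hU : ⋃ n, S n = {0}ᶜ := by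
    ext x
    simp only [Set.mem_iUnion, Set.mem_compl_iff, Set.mem_singleton_iff]
    constructor
    · rintro ⟨n, hn⟩ rfl
      have hn : 1 / ((n : ℝ) + 1) < ‖(0 : R3)‖ := hn
      rw [norm_zero] at hn
      exact absurd hn (not_lt.2 (by positivity))
    · intro hx
      exact exists_nat_one_div_lt (norm_pos_iff.2 hx)
  have h0 : ∫⁻ x, ENNReal.ofReal ‖x‖⁻¹ * ‖f x‖ₑ ^ 2 =
      ∫⁻ x in ⋃ n, S n, ENNReal.ofReal ‖x‖⁻¹ * ‖f x‖ₑ ^ 2 := by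
    rw [hU, restrict_compl_singleton]
  rw [h0, setLIntegral_iUnion_of_directed _ (hmono.directed_le)]
  exact iSup_le fun n => hardy_outside_ball hf hfin (by positivity)

/-- By translation invariance the Coulomb potential of `f²` is bounded uniformly in its base point.
-/
theorem hardy_centered {f : R3 → ℝ} (hf : Measurable f) (hfin : ∫⁻ x, ‖f x‖ₑ ^ 2 < ∞) (a : R3) :
    ∫⁻ y, ‖f y‖ₑ ^ 2 * ENNReal.ofReal ‖a - y‖⁻¹ ≤ ENNReal.ofReal hardyConst * gagliardo f := by
  rw [← gagliardo_comp_add f a, ← lintegral_add_right_eq_self _ a]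
  refine le_trans (le_of_eq ?_) (hardy (f := fun x => f (x + a)) (by fun_prop) ?_)
  · refine lintegral_congr fun x => ?_
    rw [mul_comm, sub_add_cancel_right, norm_neg]
  · rwa [lintegral_add_right_eq_self (fun x => ‖f x‖ₑ ^ 2) a]

/-! ### The Coulomb form on nonnegative functions -/

/-- The Coulomb form `∬ F(x) H(y) / |x - y| dx dy` of nonnegative functions. -/
def coulomb (F H : R3 → ℝ≥0∞) : ℝ≥0∞ :=
  ∫⁻ x, ∫⁻ y, F x * H y * ENNReal.ofReal ‖x - y‖⁻¹

/-- The density `f²` with values in `[0, ∞]`. -/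
def density (f : R3 → ℝ) (x : R3) : ℝ≥0∞ := ‖f x‖ₑ ^ 2

@[fun_prop]
theorem measurable_density {f : R3 → ℝ} (hf : Measurable f) : Measurable (density f) := by
  unfold density; fun_prop

theorem density_eq_ofReal (f : R3 → ℝ) (x : R3) : density f x = ENNReal.ofReal (f x ^ 2) := by
  rw [density, ← sq_abs, ENNReal.ofReal_pow (abs_nonneg _), ← Real.norm_eq_abs, ofReal_norm]

theorem lintegral_density (u : L2) : ∫⁻ x, density u x = ENNReal.ofReal (‖u‖ ^ 2) :=
  lintegral_sq_eq u

theorem coulomb_comm {F H : R3 → ℝ≥0∞} (hF : Measurable F) (hH : Measurable H) :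
    coulomb F H = coulomb H F := by
  unfold coulomb
  rw [lintegral_lintegral_swap (Measurable.aemeasurable (by fun_prop))]
  refine lintegral_congr fun x => lintegral_congr fun y => ?_
  rw [norm_sub_rev, mul_comm (F y)]

theorem coulomb_mono {F F' H H' : R3 → ℝ≥0∞} (hF : ∀ᵐ x, F x ≤ F' x) (hH : ∀ᵐ x, H x ≤ H' x) :
    coulomb F H ≤ coulomb F' H' := by
  unfold coulomb
  refine lintegral_mono_ae ?_
  filter_upwards [hF] with x hx
  refine lintegral_mono_ae ?_
  filter_upwards [hH] with y hy
  gcongr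

theorem coulomb_congr {F F' H H' : R3 → ℝ≥0∞} (hF : F =ᵐ[volume] F') (hH : H =ᵐ[volume] H') :
    coulomb F H = coulomb F' H' :=
  le_antisymm (coulomb_mono hF.le hH.le) (coulomb_mono hF.symm.le hH.symm.le)

theorem coulomb_add_left {F F' H : R3 → ℝ≥0∞} (hF : Measurable F) (hH : Measurable H) :
    coulomb (fun x => F x + F' x) H = coulomb F H + coulomb F' H := by
  unfold coulomb
  rw [← lintegral_add_left (Measurable.lintegral_prod_right (by fun_prop))]
  refine lintegral_congr fun x => ?_
  rw [← lintegral_add_left (by fun_prop)]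
  refine lintegral_congr fun y => ?_
  ring

theorem coulomb_add_right {F H H' : R3 → ℝ≥0∞} (hF : Measurable F) (hH : Measurable H) :
    coulomb F (fun x => H x + H' x) = coulomb F H + coulomb F H' := by
  unfold coulomb
  rw [← lintegral_add_left (Measurable.lintegral_prod_right (by fun_prop))]
  refine lintegral_congr fun x => ?_
  rw [← lintegral_add_left (by fun_prop)]
  refine lintegral_congr fun y => ?_
  ring

theorem coulomb_const_mul_left {F H : R3 → ℝ≥0∞} {c : ℝ≥0∞} (hc : c ≠ ∞) :
    coulomb (fun x => c * F x) H = c * coulomb F H := by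
  unfold coulomb
  rw [← lintegral_const_mul' _ _ hc]
  refine lintegral_congr fun x => ?_
  rw [← lintegral_const_mul' _ _ hc]
  refine lintegral_congr fun y => ?_
  ring

theorem coulomb_const_mul_right {F H : R3 → ℝ≥0∞} {c : ℝ≥0∞} (hc : c ≠ ∞) :
    coulomb F (fun x => c * H x) = c * coulomb F H := by
  unfold coulomb
  rw [← lintegral_const_mul' _ _ hc]
  refine lintegral_congr fun x => ?_
  rw [← lintegral_const_mul' _ _ hc]
  refine lintegral_congr fun y => ?_
  ring

theorem coulomb_le_of_potential_le {F H : R3 → ℝ≥0∞} {C : ℝ≥0∞} (hF : Measurable F)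
    (hH : Measurable H) (h : ∀ x, ∫⁻ y, H y * ENNReal.ofReal ‖x - y‖⁻¹ ≤ C) :
    coulomb F H ≤ C * ∫⁻ x, F x := by
  unfold coulomb
  rw [← lintegral_const_mul _ hF]
  refine lintegral_mono fun x => ?_
  simp only [mul_assoc]
  rw [lintegral_const_mul _ (by fun_prop), mul_comm C]
  gcongr
  exact h x

/-- The basic estimate for all that follows: one factor needs only finite mass to give a finite
bound, since Hardy bounds the potential of the other in `L^∞`. -/
theorem coulomb_density_le {F : R3 → ℝ≥0∞} {f : R3 → ℝ} (hF : Measurable F) (hf : Measurable f)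
    (hfin : ∫⁻ x, density f x < ∞) :
    coulomb F (density f) ≤ ENNReal.ofReal hardyConst * gagliardo f * ∫⁻ x, F x :=
  coulomb_le_of_potential_le hF (by fun_prop) fun x => hardy_centered hf hfin x

theorem hartreeEnergy_eq (u v : L2) :
    hartreeEnergy u v = (coulomb (density u) (density v)).toReal := by
  have hu := measurable_coeFn u
  have hv := measurable_coeFn v
  unfold hartreeEnergy
  rw [integral_eq_lintegral_of_nonneg_ae (Eventually.of_forall fun p => by positivity)
    (Measurable.aestronglyMeasurable (by fun_prop)), Measure.volume_eq_prod,
    lintegral_prod _ (Measurable.aemeasurable (by fun_prop)), coulomb]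
  congr 1
  refine lintegral_congr fun x => lintegral_congr fun y => ?_
  rw [div_eq_mul_inv, ENNReal.ofReal_mul (by positivity), ENNReal.ofReal_mul (by positivity),
    density_eq_ofReal, density_eq_ofReal]

theorem hartreeEnergy_nonneg (u v : L2) : 0 ≤ hartreeEnergy u v := by
  rw [hartreeEnergy_eq]; exact ENNReal.toReal_nonneg

theorem coulomb_lt_top {u v : L2} (hv : v ∈ HHalf) :
    coulomb (density u) (density v) < ∞ := by
  have h := coulomb_density_le (F := density u) (measurable_density (measurable_coeFn u))
    (measurable_coeFn v) (by rw [lintegral_density]; exact ENNReal.ofReal_lt_top)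
  rw [lintegral_density] at h
  have := (mem_HHalf_iff v).1 hv
  exact h.trans_lt (by finiteness)

theorem coulomb_comp_add (F H : R3 → ℝ≥0∞) (a : R3) :
    coulomb (fun x => F (x + a)) (fun x => H (x + a)) = coulomb F H := by
  unfold coulomb
  rw [← lintegral_add_right_eq_self (fun x => ∫⁻ y, F x * H y * ENNReal.ofReal ‖x - y‖⁻¹) a]
  refine lintegral_congr fun x => ?_
  rw [← lintegral_add_right_eq_self (fun y => F (x + a) * H y * ENNReal.ofReal ‖x + a - y‖⁻¹) a]
  refine lintegral_congr fun y => ?_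
  simp

theorem coulomb_comp_smul (F H : R3 → ℝ≥0∞) {c : ℝ} (hc : 0 < c) :
    coulomb (fun x => F (c • x)) (fun x => H (c • x)) =
      ENNReal.ofReal (c ^ 5)⁻¹ * coulomb F H := by
  unfold coulomb
  have h1 : ∀ x : R3, ∫⁻ y, F (c • x) * H (c • y) * ENNReal.ofReal ‖x - y‖⁻¹ =
      ENNReal.ofReal (c ^ 2)⁻¹ * ∫⁻ y, F (c • x) * H y * ENNReal.ofReal ‖c • x - y‖⁻¹ := by
    intro x
    have e := lintegral_comp_smul c hc
      (fun y => F (c • x) * H y * ENNReal.ofReal ‖c • x - y‖⁻¹)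
    have e2 : ∀ y : R3, F (c • x) * H (c • y) * ENNReal.ofReal ‖x - y‖⁻¹ =
        ENNReal.ofReal c * (F (c • x) * H (c • y) * ENNReal.ofReal ‖c • x - c • y‖⁻¹) := by
      intro y
      rw [← smul_sub, norm_smul, Real.norm_of_nonneg hc.le, mul_inv,
        ENNReal.ofReal_mul (by positivity)]
      have : ENNReal.ofReal c * ENNReal.ofReal c⁻¹ = 1 := by
        rw [← ENNReal.ofReal_mul hc.le, mul_inv_cancel₀ hc.ne', ENNReal.ofReal_one]
      calc _ = (ENNReal.ofReal c * ENNReal.ofReal c⁻¹) *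
            (F (c • x) * H (c • y) * ENNReal.ofReal ‖x - y‖⁻¹) := by rw [this, one_mul]
        _ = _ := by ring
    simp only [e2]
    rw [lintegral_const_mul' _ _ ENNReal.ofReal_ne_top, e, ← mul_assoc,
      ← ENNReal.ofReal_mul hc.le]
    congr 2
    field_simp
  simp only [h1]
  rw [lintegral_const_mul' _ _ ENNReal.ofReal_ne_top, lintegral_comp_smul c hc
    (fun x => ∫⁻ y, F x * H y * ENNReal.ofReal ‖x - y‖⁻¹), ← mul_assoc,
    ← ENNReal.ofReal_mul (by positivity)]
  congr 2
  field_simp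

/-! ### Positivity of the Coulomb form -/

/-- The Gaussian factor in the decomposition of the Coulomb kernel. -/
def gaussFactor (p : ℝ × R3) (x : R3) : ℝ≥0∞ :=
  ENNReal.ofReal (Real.exp (-(2 * p.1 ^ 2 * ‖x - p.2‖ ^ 2)))

theorem measurable_gaussFactor : Measurable fun q : (ℝ × R3) × R3 => gaussFactor q.1 q.2 := by
  unfold gaussFactor; fun_prop

/-- The Gaussian integral `∫ e^{-4|z|²} dz`. -/
def gaussConst : ℝ := ∫ z : R3, Real.exp (-(4 * ‖z‖ ^ 2))

theorem integrable_gauss : Integrable fun z : R3 => Real.exp (-(4 * ‖z‖ ^ 2)) := by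
  have := (GaussianFourier.integrable_cexp_neg_mul_sq_norm_add (b := 4) (by norm_num) 0
    (0 : R3)).norm
  refine this.congr (Eventually.of_forall fun z => ?_)
  simp only [Complex.norm_exp]
  congr 1
  simp [← Complex.ofReal_pow]

theorem gaussConst_pos : 0 < gaussConst := by
  unfold gaussConst
  rw [integral_pos_iff_support_of_nonneg (fun z => (Real.exp_pos _).le) integrable_gauss]
  have : Function.support (fun z : R3 => Real.exp (-(4 * ‖z‖ ^ 2))) = Set.univ := by
    ext z; simp [Real.exp_ne_zero]
  rw [this]
  simp

/-- With `z` recentred at the midpoint of `x` and `y`, the parallelogram law separates the exponent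
into `s²‖x - y‖²` and `4s²‖z‖²`. -/
theorem lintegral_gaussFactor_mul {s : ℝ} (hs : 0 < s) (x y : R3) :
    ∫⁻ z, gaussFactor (s, z) x * gaussFactor (s, z) y =
      ENNReal.ofReal (gaussConst * (s ^ 3)⁻¹ * Real.exp (-(‖x - y‖ ^ 2 * s ^ 2))) := by
  have h1 : ∀ z : R3, gaussFactor (s, z + (1 / 2 : ℝ) • (x + y)) x *
      gaussFactor (s, z + (1 / 2 : ℝ) • (x + y)) y =
      ENNReal.ofReal (Real.exp (-(‖x - y‖ ^ 2 * s ^ 2))) *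
        ENNReal.ofReal (Real.exp (-(4 * ‖s • z‖ ^ 2))) := by
    intro z
    unfold gaussFactor
    rw [← ENNReal.ofReal_mul (Real.exp_pos _).le, ← ENNReal.ofReal_mul (Real.exp_pos _).le,
      ← Real.exp_add, ← Real.exp_add]
    congr 2
    have e1 : x - (z + (1 / 2 : ℝ) • (x + y)) = (1 / 2 : ℝ) • (x - y) - z := by module
    have e2 : y - (z + (1 / 2 : ℝ) • (x + y)) = -((1 / 2 : ℝ) • (x - y) + z) := by module
    have e3 := parallelogram_law_with_norm ℝ ((1 / 2 : ℝ) • (x - y)) z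
    rw [e1, e2, norm_neg, norm_smul s, Real.norm_of_nonneg hs.le]
    rw [norm_smul (1 / 2 : ℝ), Real.norm_of_nonneg (by norm_num : (0 : ℝ) ≤ 1 / 2)] at e3
    linear_combination (-(2 * s ^ 2)) * e3
  rw [← lintegral_add_right_eq_self _ ((1 / 2 : ℝ) • (x + y))]
  simp only [h1]
  rw [lintegral_const_mul' _ _ ENNReal.ofReal_ne_top, lintegral_comp_smul s hs
    (fun z => ENNReal.ofReal (Real.exp (-(4 * ‖z‖ ^ 2)))),
    ← ofReal_integral_eq_lintegral_ofReal integrable_gauss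
      (Eventually.of_forall fun z => (Real.exp_pos _).le), ← ENNReal.ofReal_mul (by positivity),
    ← ENNReal.ofReal_mul (by positivity)]
  congr 1
  rw [gaussConst]
  ring

/-- The measure on the parameters of the Gaussian factors. -/
def gaussMeasure : Measure (ℝ × R3) := (volume.restrict (Set.Ioi (0 : ℝ))).prod volume

instance : SFinite gaussMeasure := by unfold gaussMeasure; infer_instance

/-- The weight `s³` cancels the `s⁻³` of the integral over `z`, and `∫₀^∞ e^{-r²s²} ds = √π / (2r)`
produces the Coulomb kernel. -/
theorem lintegral_gaussFactor_eq_kernel {x y : R3} (hxy : x ≠ y) :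
    ∫⁻ p, ENNReal.ofReal (p.1 ^ 3) * (gaussFactor p x * gaussFactor p y) ∂gaussMeasure =
      ENNReal.ofReal (gaussConst * Real.sqrt Real.pi / 2) * ENNReal.ofReal ‖x - y‖⁻¹ := by
  have hr : 0 < ‖x - y‖ := norm_pos_iff.2 (sub_ne_zero.2 hxy)
  have hm := measurable_gaussFactor
  have hmx : Measurable fun p => gaussFactor p x := Measurable.of_uncurry_right hm
  have hmy : Measurable fun p => gaussFactor p y := Measurable.of_uncurry_right hm
  have hg := gaussConst_pos
  rw [gaussMeasure, lintegral_prod _ (Measurable.aemeasurable (by fun_prop))]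
  have h1 : ∀ s ∈ Set.Ioi (0 : ℝ), ∫⁻ z : R3, ENNReal.ofReal (s ^ 3) *
      (gaussFactor (s, z) x * gaussFactor (s, z) y) =
      ENNReal.ofReal (gaussConst * Real.exp (-‖x - y‖ ^ 2 * s ^ 2)) := by
    intro s hs
    have hs : 0 < s := hs
    rw [lintegral_const_mul' _ _ ENNReal.ofReal_ne_top, lintegral_gaussFactor_mul hs,
      ← ENNReal.ofReal_mul (by positivity)]
    congr 1
    rw [neg_mul]
    field_simp
  rw [setLIntegral_congr_fun measurableSet_Ioi h1,
    ← ofReal_integral_eq_lintegral_ofReal, integral_const_mul, integral_gaussian_Ioi,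
    ← ENNReal.ofReal_mul (by positivity)]
  · congr 1
    rw [Real.sqrt_div Real.pi_pos.le, Real.sqrt_sq hr.le]
    field_simp
  · exact ((integrable_exp_neg_mul_sq (by positivity : 0 < ‖x - y‖ ^ 2)).const_mul _).integrableOn
  · exact Eventually.of_forall fun s => by positivity

theorem lintegral_mul_superposition {T : Type*} [MeasurableSpace T] (ν : Measure T) [SFinite ν]
    {w : T → ℝ≥0∞} {φ : T → R3 → ℝ≥0∞} {F H : R3 → ℝ≥0∞} (hw : Measurable w)
    (hφ : Measurable (Function.uncurry φ)) (hF : Measurable F) (hH : Measurable H) :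
    ∫⁻ x, ∫⁻ y, ∫⁻ p, F x * H y * (w p * (φ p x * φ p y)) ∂ν =
      ∫⁻ p, w p * ((∫⁻ x, F x * φ p x) * ∫⁻ y, H y * φ p y) ∂ν := by
  have hmx : ∀ p, Measurable (φ p) := fun p => hφ.of_uncurry_left
  have e2 : ∀ x, ∫⁻ y, ∫⁻ p, F x * H y * (w p * (φ p x * φ p y)) ∂ν =
      ∫⁻ p, (∫⁻ y, F x * H y * (w p * (φ p x * φ p y))) ∂ν := by
    intro x
    refine lintegral_lintegral_swap (Measurable.aemeasurable ?_)
    have h1 : Measurable fun p => φ p x := hφ.of_uncurry_right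
    have h2 : Measurable fun q : R3 × T => φ q.2 q.1 := hφ.comp measurable_swap
    simp only [Function.uncurry_def]
    fun_prop
  simp only [e2]
  rw [lintegral_lintegral_swap]
  · refine lintegral_congr fun p => ?_
    have h1 := hmx p
    have h2 : ∀ x, ∫⁻ y, F x * H y * (w p * (φ p x * φ p y)) = F x * φ p x *
        (w p * ∫⁻ y, H y * φ p y) := by
      intro x
      rw [← lintegral_const_mul _ (by fun_prop), ← lintegral_const_mul _ (by fun_prop)]
      refine lintegral_congr fun y => ?_
      ring
    simp only [h2]
    rw [lintegral_mul_const _ (by fun_prop)]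
    ring
  · refine Measurable.aemeasurable ?_
    refine Measurable.lintegral_prod_right' (f := fun q : (R3 × T) × R3 =>
      F q.1.1 * H q.2 * (w q.1.2 * (φ q.1.2 q.1.1 * φ q.1.2 q.2))) ?_
    have h1 : Measurable fun q : (R3 × T) × R3 => φ q.1.2 q.1.1 :=
      hφ.comp (measurable_swap.comp measurable_fst)
    have h2 : Measurable fun q : (R3 × T) × R3 => φ q.1.2 q.2 :=
      hφ.comp ((measurable_snd.comp measurable_fst).prodMk measurable_snd)
    fun_prop

/-- The Coulomb form becomes a positive superposition of products of one integral in `F` and one in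
`H`. The diagonal, where the kernel formula is unavailable, is null. -/
theorem coulomb_eq_gauss {F H : R3 → ℝ≥0∞} (hF : Measurable F) (hH : Measurable H) :
    ENNReal.ofReal (gaussConst * Real.sqrt Real.pi / 2) * coulomb F H =
      ∫⁻ p, ENNReal.ofReal (p.1 ^ 3) * ((∫⁻ x, F x * gaussFactor p x) *
        ∫⁻ y, H y * gaussFactor p y) ∂gaussMeasure := by
  rw [← lintegral_mul_superposition gaussMeasure (w := fun p => ENNReal.ofReal (p.1 ^ 3))
    (φ := gaussFactor) (by fun_prop) measurable_gaussFactor hF hH,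
    coulomb, ← lintegral_const_mul' _ _ ENNReal.ofReal_ne_top]
  refine lintegral_congr fun x => ?_
  rw [← lintegral_const_mul' _ _ ENNReal.ofReal_ne_top]
  refine lintegral_congr_ae ?_
  filter_upwards [Measure.ae_ne volume x] with y hy
  have h1 : Measurable fun p => gaussFactor p x := Measurable.of_uncurry_right
    (f := gaussFactor) measurable_gaussFactor
  have h2 : Measurable fun p => gaussFactor p y := Measurable.of_uncurry_right
    (f := gaussFactor) measurable_gaussFactor
  rw [lintegral_const_mul _ (by fun_prop), lintegral_gaussFactor_eq_kernel hy.symm]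
  ring

theorem two_mul_mul_le_sq_add_sq (a b : ℝ≥0∞) : 2 * (a * b) ≤ a * a + b * b := by
  rcases le_total a b with h | h
  · obtain ⟨c, rfl⟩ := exists_add_of_le h
    calc 2 * (a * (a + c)) ≤ 2 * (a * (a + c)) + c * c := le_self_add
      _ = _ := by ring
  · obtain ⟨c, rfl⟩ := exists_add_of_le h
    calc 2 * ((b + c) * b) ≤ 2 * ((b + c) * b) + c * c := le_self_add
      _ = _ := by ring

/-- Positive definiteness of the Coulomb kernel, in a form without subtraction in `[0, ∞]`: the
Gaussian superposition reduces it to `2ab ≤ a² + b²` for each parameter. -/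
theorem two_mul_coulomb_le {F H : R3 → ℝ≥0∞} (hF : Measurable F) (hH : Measurable H) :
    2 * coulomb F H ≤ coulomb F F + coulomb H H := by
  have hc : 0 < gaussConst * Real.sqrt Real.pi / 2 := by
    have := gaussConst_pos
    positivity
  have hm := measurable_gaussFactor
  have hA : ∀ {G : R3 → ℝ≥0∞}, Measurable G → Measurable fun p => ∫⁻ x, G x * gaussFactor p x :=
    fun hG => Measurable.lintegral_prod_right (by fun_prop)
  have h1 := hA hF
  have h2 := hA hH
  rw [← ENNReal.mul_le_mul_iff_right (a := ENNReal.ofReal (gaussConst * Real.sqrt Real.pi / 2))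
    (by simpa using hc) ENNReal.ofReal_ne_top, mul_left_comm, mul_add, coulomb_eq_gauss hF hH,
    coulomb_eq_gauss hF hF, coulomb_eq_gauss hH hH, ← lintegral_add_left (by fun_prop),
    ← lintegral_const_mul' _ _ (by simp)]
  refine lintegral_mono fun p => ?_
  simp only
  rw [← mul_add, mul_left_comm]
  gcongr
  exact two_mul_mul_le_sq_add_sq _ _

/-! ### Averages over balls -/

/-- The average of `f` over the ball of radius `r` around `x`. -/
def ballAverage (r : ℝ) (f : R3 → ℝ) (x : R3) : ℝ :=
  (r ^ 3 * ballVol)⁻¹ * ∫ h in Metric.ball (0 : R3) r, f (x + h)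

theorem measurable_ballAverage (r : ℝ) {f : R3 → ℝ} (hf : Measurable f) :
    Measurable (ballAverage r f) := by
  unfold ballAverage
  have : StronglyMeasurable fun x : R3 => ∫ h in Metric.ball (0 : R3) r, f (x + h) := by
    refine StronglyMeasurable.integral_prod_right (f := fun x h : R3 => f (x + h)) ?_
    exact (by fun_prop : Measurable (Function.uncurry fun x h : R3 => f (x + h))).stronglyMeasurable
  have := this.measurable
  fun_prop

theorem sq_setLIntegral_le (μ : Measure R3) (s : Set R3) {g : R3 → ℝ≥0∞} (hg : Measurable g) :
    (∫⁻ x in s, g x ∂μ) ^ 2 ≤ μ s * ∫⁻ x in s, g x ^ 2 ∂μ := by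
  have h := ENNReal.lintegral_mul_le_Lp_mul_Lq (μ.restrict s)
    (Real.HolderConjugate.two_two) hg.aemeasurable (aemeasurable_const (b := (1 : ℝ≥0∞)))
  simp only [Pi.mul_apply, mul_one, ENNReal.one_rpow, lintegral_const, one_mul,
    Measure.restrict_apply_univ] at h
  calc _ ≤ ((∫⁻ x in s, g x ^ (2 : ℝ) ∂μ) ^ (1 / (2 : ℝ)) * μ s ^ (1 / (2 : ℝ))) ^ 2 := by gcongr
    _ = _ := by
      rw [mul_pow, ← ENNReal.rpow_natCast, ← ENNReal.rpow_natCast, ← ENNReal.rpow_mul,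
        ← ENNReal.rpow_mul, mul_comm]
      simp

theorem integrableOn_ball_translate (u : L2) (x : R3) (r : ℝ) :
    IntegrableOn (fun h => u (x + h)) (Metric.ball (0 : R3) r) := by
  have h1 : MemLp (fun h => u (x + h)) 2 volume :=
    (Lp.memLp u).comp_measurePreserving (measurePreserving_add_left volume x)
  have : IsFiniteMeasure (volume.restrict (Metric.ball (0 : R3) r)) :=
    ⟨by simpa using measure_ball_lt_top (μ := (volume : Measure R3)) (x := 0) (r := r)⟩
  exact (h1.restrict _).integrable (by norm_num)

theorem enorm_sub_ballAverage_sq_le (u : L2) {r : ℝ} (hr : 0 < r) (x : R3) :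
    ‖u x - ballAverage r u x‖ₑ ^ 2 ≤ ENNReal.ofReal (r ^ 3 * ballVol)⁻¹ *
      ∫⁻ h in Metric.ball (0 : R3) r, ‖u (x + h) - u x‖ₑ ^ 2 := by
  have hb := ballVol_pos
  have hu := measurable_coeFn u
  have hv : (volume (Metric.ball (0 : R3) r)).toReal = r ^ 3 * ballVol := by
    rw [volume_ball_eq _ hr.le, ENNReal.toReal_ofReal (by positivity)]
  have e : u x - ballAverage r u x =
      (r ^ 3 * ballVol)⁻¹ * ∫ h in Metric.ball (0 : R3) r, (u x - u (x + h)) := by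
    have : IntegrableOn (fun _ : R3 => u x) (Metric.ball (0 : R3) r) :=
      integrableOn_const measure_ball_lt_top.ne
    rw [integral_sub this (integrableOn_ball_translate u x r), setIntegral_const, measureReal_def,
      hv, smul_eq_mul, ballAverage, mul_sub]
    field_simp
  rw [e, enorm_mul, mul_pow]
  have h1 : ‖∫ h in Metric.ball (0 : R3) r, (u x - u (x + h))‖ₑ ≤
      ∫⁻ h in Metric.ball (0 : R3) r, ‖u (x + h) - u x‖ₑ := by
    refine (enorm_integral_le_lintegral_enorm _).trans (le_of_eq ?_)
    refine lintegral_congr fun h => ?_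
    rw [← enorm_neg, neg_sub]
  have h2 := sq_setLIntegral_le volume (Metric.ball (0 : R3) r)
    (g := fun h => ‖u (x + h) - u x‖ₑ) (by fun_prop)
  have h3 : ‖(r ^ 3 * ballVol)⁻¹‖ₑ = ENNReal.ofReal (r ^ 3 * ballVol)⁻¹ := by
    rw [← ofReal_norm, Real.norm_of_nonneg (by positivity)]
  rw [volume_ball_eq _ hr.le] at h2
  rw [h3]
  calc _ ≤ ENNReal.ofReal (r ^ 3 * ballVol)⁻¹ ^ 2 * (ENNReal.ofReal (r ^ 3 * ballVol) *
        ∫⁻ h in Metric.ball (0 : R3) r, ‖u (x + h) - u x‖ₑ ^ 2) := by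
        gcongr
        exact le_trans (by gcongr) h2
    _ = _ := by
        rw [← mul_assoc, ← ENNReal.ofReal_pow (by positivity), ← ENNReal.ofReal_mul (by positivity)]
        congr 2
        field_simp

/-- Averaging at scale `r` costs only `O(r)` in squared `L²` norm: for `‖h‖ < r` the factor
`r⁴‖h‖⁻⁴` exceeds 1, and `r⁴ / (r³ ballVol) = r / ballVol`. -/
theorem lintegral_sub_ballAverage_le (u : L2) {r : ℝ} (hr : 0 < r) :
    ∫⁻ x, ‖u x - ballAverage r u x‖ₑ ^ 2 ≤ ENNReal.ofReal (r / ballVol) * gagliardo u := by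
  have hb := ballVol_pos
  have hu := measurable_coeFn u
  calc ∫⁻ x, ‖u x - ballAverage r u x‖ₑ ^ 2
      ≤ ∫⁻ x, ENNReal.ofReal (r ^ 3 * ballVol)⁻¹ *
        ∫⁻ h in Metric.ball (0 : R3) r, ‖u (x + h) - u x‖ₑ ^ 2 :=
        lintegral_mono fun x => enorm_sub_ballAverage_sq_le u hr x
    _ = ENNReal.ofReal (r ^ 3 * ballVol)⁻¹ *
        ∫⁻ h in Metric.ball (0 : R3) r, ∫⁻ x, ‖u (x + h) - u x‖ₑ ^ 2 := by
        rw [lintegral_const_mul' _ _ ENNReal.ofReal_ne_top, lintegral_lintegral_swap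
          (Measurable.aemeasurable (by fun_prop))]
    _ ≤ ENNReal.ofReal (r ^ 3 * ballVol)⁻¹ * ∫⁻ h in Metric.ball (0 : R3) r,
          ENNReal.ofReal (r ^ 4) * (ENNReal.ofReal (‖h‖ ^ 4)⁻¹ *
            ∫⁻ x, ‖u (x + h) - u x‖ₑ ^ 2) := by
        gcongr ENNReal.ofReal _ * ?_
        refine setLIntegral_mono' measurableSet_ball fun h hh => ?_
        rcases eq_or_ne h 0 with rfl | h0
        · simp
        · have hn : 0 < ‖h‖ := norm_pos_iff.2 h0
          have hhr : ‖h‖ < r := by simpa using hh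
          rw [← mul_assoc, ← ENNReal.ofReal_mul (by positivity)]
          refine le_mul_of_one_le_left zero_le ?_
          rw [ENNReal.one_le_ofReal, ← div_eq_mul_inv, one_le_div (by positivity)]
          gcongr
    _ ≤ ENNReal.ofReal (r ^ 3 * ballVol)⁻¹ * (ENNReal.ofReal (r ^ 4) * gagliardo u) := by
        gcongr
        rw [lintegral_const_mul' _ _ ENNReal.ofReal_ne_top]
        gcongr
        exact setLIntegral_le_lintegral _ _
    _ = _ := by
        rw [← mul_assoc, ← ENNReal.ofReal_mul (by positivity)]
        congr 2
        field_simp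

/-- As inner products with fixed `L²` functions, ball averages converge pointwise along weakly
convergent sequences. -/
theorem ballAverage_eq_inner (u : L2) (r : ℝ) (x : R3) :
    ballAverage r u x = (r ^ 3 * ballVol)⁻¹ * inner ℝ (indicatorConstLp 2
      (measurableSet_ball (x := x) (ε := r)) measure_ball_lt_top.ne (1 : ℝ) : L2) u := by
  have h := (measurePreserving_add_left volume x).setIntegral_preimage_emb
    (MeasurableEquiv.addLeft x).measurableEmbedding u (Metric.ball x r)
  have hs : (fun y => x + y) ⁻¹' Metric.ball x r = Metric.ball 0 r := by
    ext y
    simp [dist_eq_norm]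
  rw [L2.inner_indicatorConstLp_one, ballAverage, ← h, hs]

theorem abs_ballAverage_le (u : L2) {r : ℝ} (hr : 0 < r) (x : R3) :
    |ballAverage r u x| ≤ (r ^ 3 * ballVol)⁻¹ * (Real.sqrt (r ^ 3 * ballVol) * ‖u‖) := by
  have hb := ballVol_pos
  rw [ballAverage_eq_inner, abs_mul, abs_of_pos (by positivity)]
  gcongr
  refine (abs_real_inner_le_norm _ _).trans (le_of_eq ?_)
  rw [norm_indicatorConstLp (by simp) (by simp), measureReal_def, volume_ball_eq _ hr.le,
    ENNReal.toReal_ofReal (by positivity), Real.sqrt_eq_rpow]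
  simp

/-! ### Local compactness -/

theorem enorm_sq_eq_ofReal (c : ℝ) : ‖c‖ₑ ^ 2 = ENNReal.ofReal (c ^ 2) := by
  rw [← sq_abs, ENNReal.ofReal_pow (abs_nonneg _), ← Real.norm_eq_abs, ofReal_norm]

theorem density_le_two_mul (f g : R3 → ℝ) (x : R3) :
    density f x ≤ 2 * density g x + 2 * ‖f x - g x‖ₑ ^ 2 := by
  have := enorm_sq_le_two_mul (f x) (g x)
  rwa [← enorm_neg (g x - f x), neg_sub] at this

/-- Rellich's theorem: weakly null sequences bounded in `H^{1/2}` converge in `L²` on balls. -/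
theorem tendsto_setLIntegral_density {w : ℕ → L2} (hw : ∀ g : L2, Tendsto (fun n => inner ℝ g (w n))
    atTop (nhds 0)) {C : ℝ} (hC : ∀ n, ‖w n‖ ≤ C) {B : ℝ} (hB : ∀ n, gagliardo (w n) ≤
    ENNReal.ofReal B) (R : ℝ) :
    Tendsto (fun n => ∫⁻ x in Metric.ball (0 : R3) R, density (w n) x) atTop (nhds 0) := by
  have hb := ballVol_pos
  have hwm := fun n => measurable_coeFn (w n)
  -- For fixed `r` the averages tend to 0 pointwise by weak convergence and are bounded uniformly in
  -- `n`, so dominated convergence applies on the ball.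
  have havg : ∀ r : ℝ, 0 < r → Tendsto (fun n => ∫⁻ x in Metric.ball (0 : R3) R,
      density (ballAverage r (w n)) x) atTop (nhds 0) := by
    intro r hr
    set K := (r ^ 3 * ballVol)⁻¹ * (Real.sqrt (r ^ 3 * ballVol) * C) with hK
    have := tendsto_lintegral_of_dominated_convergence
      (μ := volume.restrict (Metric.ball (0 : R3) R))
      (F := fun n x => density (ballAverage r (w n)) x) (f := fun _ => 0)
      (fun _ => ENNReal.ofReal (K ^ 2))
      (fun n => measurable_density (measurable_ballAverage r (hwm n)))
      (fun n => Eventually.of_forall fun x => by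
        have h1 := abs_ballAverage_le (w n) hr x
        have h2 : |ballAverage r (w n) x| ≤ K := h1.trans (by rw [hK]; gcongr; exact hC n)
        simp only [density_eq_ofReal]
        refine ENNReal.ofReal_le_ofReal ?_
        rw [← sq_abs]
        gcongr)
      (by
        rw [lintegral_const, Measure.restrict_apply_univ]
        exact ENNReal.mul_ne_top ENNReal.ofReal_ne_top measure_ball_lt_top.ne)
      (Eventually.of_forall fun x => by
        simp only [density_eq_ofReal, ballAverage_eq_inner]
        have h1 := ((hw (indicatorConstLp 2 (measurableSet_ball (x := x) (ε := r))
          measure_ball_lt_top.ne (1 : ℝ))).const_mul (r ^ 3 * ballVol)⁻¹).pow 2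
        simpa using ENNReal.tendsto_ofReal h1)
    simpa using this
  rw [ENNReal.tendsto_nhds_zero]
  intro ε hε
  -- The scale is chosen so that the averaging error is small for all `n` at once; only then is `n`
  -- taken large.
  obtain ⟨r, hr, hrε⟩ : ∃ r : ℝ, 0 < r ∧
      2 * (ENNReal.ofReal (r / ballVol) * ENNReal.ofReal B) ≤ ε / 2 := by
    have hε2 : 0 < ε / 2 := ENNReal.half_pos hε.ne'
    have h1 : Tendsto (fun r : ℝ => 2 * (ENNReal.ofReal (r / ballVol) * ENNReal.ofReal B))
        (nhdsWithin 0 (Set.Ioi 0)) (nhds (2 * (ENNReal.ofReal (0 / ballVol) * ENNReal.ofReal B))) := by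
      refine ENNReal.Tendsto.const_mul (ENNReal.Tendsto.mul_const ?_ (Or.inr ENNReal.ofReal_ne_top))
        (Or.inr (by simp))
      refine ENNReal.tendsto_ofReal ?_
      exact ((continuous_id.div_const ballVol).tendsto 0).mono_left nhdsWithin_le_nhds
    rw [zero_div, ENNReal.ofReal_zero, zero_mul, mul_zero] at h1
    have h2 := (h1.eventually_le_const hε2).and self_mem_nhdsWithin
    obtain ⟨r, hr1, hr2⟩ := h2.exists
    exact ⟨r, hr2, hr1⟩
  have h3 := ENNReal.Tendsto.const_mul (a := 2) (havg r hr) (Or.inr (by simp))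
  rw [mul_zero] at h3
  filter_upwards [h3.eventually_le_const (ENNReal.half_pos hε.ne')] with n hn
  have hm := measurable_density (measurable_ballAverage r (hwm n))
  calc ∫⁻ x in Metric.ball (0 : R3) R, density (w n) x
      ≤ ∫⁻ x in Metric.ball (0 : R3) R, (2 * density (ballAverage r (w n)) x +
        2 * ‖w n x - ballAverage r (w n) x‖ₑ ^ 2) :=
        lintegral_mono fun x => density_le_two_mul _ _ x
    _ = 2 * (∫⁻ x in Metric.ball (0 : R3) R, density (ballAverage r (w n)) x) +
        2 * ∫⁻ x in Metric.ball (0 : R3) R, ‖w n x - ballAverage r (w n) x‖ₑ ^ 2 := by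
        rw [lintegral_add_left (by fun_prop), lintegral_const_mul' _ _ (by simp),
          lintegral_const_mul' _ _ (by simp)]
    _ ≤ ε / 2 + ε / 2 := by
        refine add_le_add hn (le_trans ?_ hrε)
        gcongr
        exact (setLIntegral_le_lintegral _ _).trans
          ((lintegral_sub_ballAverage_le (w n) hr).trans (by gcongr; exact hB n))
    _ = ε := ENNReal.add_halves ε

/-! ### Nonvanishing -/

/-- The integral of `1/|y|` over a ball. -/
def ballPotential (R : ℝ) : ℝ≥0∞ := ∫⁻ y in Metric.ball (0 : R3) R, ENNReal.ofReal ‖y‖⁻¹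

theorem ballPotential_lt_top {R : ℝ} (hR : 0 ≤ R) : ballPotential R < ∞ := by
  -- On the ball, `‖y‖⁻¹ ≤ (1 + R³) ‖y‖⁻⁴ min(‖y‖², 1)` away from the origin, so the integral
  -- already known to be finite dominates.
  have h : ballPotential R ≤ ENNReal.ofReal (1 + R ^ 3) * cutoffConst := by
    unfold ballPotential cutoffConst
    rw [← lintegral_const_mul' _ _ ENNReal.ofReal_ne_top]
    refine le_trans (setLIntegral_mono' measurableSet_ball fun y hy => ?_)
      (setLIntegral_le_lintegral _ _)
    rw [← ENNReal.ofReal_mul (by positivity)]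
    refine ENNReal.ofReal_le_ofReal ?_
    have hy : ‖y‖ < R := by simpa using hy
    rcases eq_or_ne y 0 with rfl | h0
    · simp
    have hn : 0 < ‖y‖ := norm_pos_iff.2 h0
    have e : (1 + R ^ 3) * ((‖y‖ ^ 4)⁻¹ * min (‖y‖ ^ 2) 1) =
        (1 + R ^ 3) * min (‖y‖ ^ 2) 1 / ‖y‖ ^ 4 := by field_simp
    rw [e, le_div_iff₀ (by positivity)]
    have e2 : ‖y‖⁻¹ * ‖y‖ ^ 4 = ‖y‖ ^ 3 := by field_simp
    rw [e2]
    rcases le_total (‖y‖ ^ 2) 1 with h | h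
    · rw [min_eq_left h]
      have h1 : ‖y‖ ≤ 1 := by nlinarith
      have : 0 ≤ R ^ 3 := by positivity
      nlinarith [sq_nonneg ‖y‖, mul_nonneg this (sq_nonneg ‖y‖)]
    · rw [min_eq_right h]
      have : ‖y‖ ^ 3 ≤ R ^ 3 := by gcongr
      linarith
  exact h.trans_lt (ENNReal.mul_lt_top ENNReal.ofReal_lt_top cutoffConst_lt_top)

theorem potential_le_of_bounded {f : R3 → ℝ} {η R : ℝ} (hR : 0 < R)
    (hη : ∀ x, |f x| ≤ η) (x : R3) :
    ∫⁻ y, density f y * ENNReal.ofReal ‖x - y‖⁻¹ ≤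
      ENNReal.ofReal (η ^ 2) * ballPotential R + ENNReal.ofReal R⁻¹ * ∫⁻ y, density f y := by
  rw [← lintegral_add_compl _ (measurableSet_ball (x := x) (ε := R))]
  refine add_le_add ?_ ?_
  · calc ∫⁻ y in Metric.ball x R, density f y * ENNReal.ofReal ‖x - y‖⁻¹
        ≤ ∫⁻ y in Metric.ball x R, ENNReal.ofReal (η ^ 2) * ENNReal.ofReal ‖y - x‖⁻¹ := by
          refine lintegral_mono fun y => ?_
          rw [density_eq_ofReal, norm_sub_rev, ← sq_abs]
          gcongr
          exact hη y
      _ = ENNReal.ofReal (η ^ 2) * ∫⁻ y in Metric.ball x R, ENNReal.ofReal ‖y - x‖⁻¹ :=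
          lintegral_const_mul' _ _ ENNReal.ofReal_ne_top
      _ = ENNReal.ofReal (η ^ 2) * ballPotential R := by
          rw [ballPotential, ← (measurePreserving_sub_right volume x).setLIntegral_comp_preimage_emb
            (MeasurableEquiv.subRight x).measurableEmbedding (fun y => ENNReal.ofReal ‖y‖⁻¹)
            (Metric.ball 0 R)]
          congr 3
          ext y
          simp [dist_eq_norm]
  · calc ∫⁻ y in (Metric.ball x R)ᶜ, density f y * ENNReal.ofReal ‖x - y‖⁻¹
        ≤ ∫⁻ y in (Metric.ball x R)ᶜ, ENNReal.ofReal R⁻¹ * density f y := by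
          refine setLIntegral_mono' measurableSet_ball.compl fun y hy => ?_
          rw [mul_comm]
          have : R ≤ ‖x - y‖ := by
            rw [norm_sub_rev, ← dist_eq_norm]
            simpa using hy
          gcongr
      _ = ENNReal.ofReal R⁻¹ * ∫⁻ y in (Metric.ball x R)ᶜ, density f y :=
          lintegral_const_mul' _ _ ENNReal.ofReal_ne_top
      _ ≤ _ := by
          exact mul_le_mul_right (setLIntegral_le_lintegral _ _) _

/-- One density is replaced by that of the ball average, whose potential is small near its base
point by the bound `η` and small far away by `1/R`. The remainder has mass `O(r)`, and Hardy bounds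
the potential of `u` against it. -/
theorem coulomb_le_of_ballAverage_le (u : L2) {r R η M B : ℝ} (hr : 0 < r) (hR : 0 < R)
    (hM : ‖u‖ ^ 2 ≤ M) (hB : gagliardo u ≤ ENNReal.ofReal B) (hB0 : 0 ≤ B)
    (hη : ∀ x, |ballAverage r u x| ≤ η) :
    coulomb (density u) (density u) ≤ ENNReal.ofReal (2 * ((η ^ 2 * (ballPotential R).toReal +
      R⁻¹ * (2 * M + 2 * (r / ballVol * B))) * M) +
      2 * (hardyConst * B * (r / ballVol * B))) := by
  have hb := ballVol_pos
  have hK := hardyConst_pos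
  have hM0 : 0 ≤ M := (sq_nonneg _).trans hM
  have hu := measurable_coeFn u
  set f := ballAverage r u with hf
  have hfm : Measurable f := measurable_ballAverage r hu
  set g : R3 → ℝ≥0∞ := fun x => ‖u x - f x‖ₑ ^ 2 with hg
  have hgm : Measurable g := by simp only [hg]; fun_prop
  have hgi : ∫⁻ x, g x ≤ ENNReal.ofReal (r / ballVol * B) := by
    rw [ENNReal.ofReal_mul (by positivity)]
    exact (lintegral_sub_ballAverage_le u hr).trans (by gcongr)
  have hui : ∫⁻ x, density u x ≤ ENNReal.ofReal M := by
    rw [lintegral_density]; exact ENNReal.ofReal_le_ofReal hM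
  have hfi : ∫⁻ x, density f x ≤ ENNReal.ofReal (2 * M + 2 * (r / ballVol * B)) := by
    calc ∫⁻ x, density f x ≤ ∫⁻ x, (2 * density u x + 2 * g x) := by
          refine lintegral_mono fun x => ?_
          have := density_le_two_mul f u x
          rwa [← enorm_neg (f x - u x), neg_sub] at this
      _ = 2 * (∫⁻ x, density u x) + 2 * ∫⁻ x, g x := by
          rw [lintegral_add_left (by fun_prop), lintegral_const_mul' _ _ (by simp),
            lintegral_const_mul' _ _ (by simp)]
      _ ≤ 2 * ENNReal.ofReal M + 2 * ENNReal.ofReal (r / ballVol * B) := by gcongr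
      _ = _ := by
          rw [ENNReal.ofReal_add (by positivity) (by positivity), ENNReal.ofReal_mul (p := 2) (by norm_num),
            ENNReal.ofReal_mul (p := 2) (q := r / ballVol * B) (by norm_num), ENNReal.ofReal_ofNat]
  have h1 : coulomb (density u) (density f) ≤ ENNReal.ofReal ((η ^ 2 * (ballPotential R).toReal +
      R⁻¹ * (2 * M + 2 * (r / ballVol * B))) * M) := by
    refine (coulomb_le_of_potential_le (by fun_prop) (by fun_prop)
      (potential_le_of_bounded hR hη)).trans ?_
    rw [ENNReal.ofReal_mul (by positivity)]
    gcongr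
    rw [ENNReal.ofReal_add (by positivity) (by positivity), ENNReal.ofReal_mul (by positivity),
      ENNReal.ofReal_mul (p := R⁻¹) (by positivity),
      ENNReal.ofReal_toReal (ballPotential_lt_top hR.le).ne]
    gcongr
  have h2 : coulomb g (density u) ≤ ENNReal.ofReal (hardyConst * B * (r / ballVol * B)) := by
    refine (coulomb_density_le hgm hu (hui.trans_lt ENNReal.ofReal_lt_top)).trans ?_
    rw [ENNReal.ofReal_mul (by positivity), ENNReal.ofReal_mul (p := hardyConst) (by positivity)]
    gcongr
  calc coulomb (density u) (density u)
      ≤ coulomb (density u) (fun x => 2 * density f x + 2 * g x) :=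
        coulomb_mono (Eventually.of_forall fun x => le_rfl)
          (Eventually.of_forall fun x => density_le_two_mul _ _ x)
    _ = 2 * coulomb (density u) (density f) + 2 * coulomb g (density u) := by
        rw [coulomb_add_right (by fun_prop) (by fun_prop), coulomb_const_mul_right (by simp),
          coulomb_const_mul_right (by simp), coulomb_comm hgm (by fun_prop)]
    _ ≤ 2 * ENNReal.ofReal ((η ^ 2 * (ballPotential R).toReal +
          R⁻¹ * (2 * M + 2 * (r / ballVol * B))) * M) +
        2 * ENNReal.ofReal (hardyConst * B * (r / ballVol * B)) := by gcongr
    _ = _ := by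
        rw [ENNReal.ofReal_add (by positivity) (by positivity),
          ENNReal.ofReal_mul (p := 2) (by norm_num),
          ENNReal.ofReal_mul (p := 2) (q := hardyConst * B * (r / ballVol * B)) (by norm_num),
          ENNReal.ofReal_ofNat]

/-- A bounded set in `H^{1/2}` with Coulomb energy bounded below does not vanish. -/
theorem exists_ballAverage_gt {M B δ : ℝ} (hM : 0 < M) (hB : 0 < B) (hδ : 0 < δ) :
    ∃ r > 0, ∃ η > 0, ∀ u : L2, ‖u‖ ^ 2 ≤ M → gagliardo u ≤ ENNReal.ofReal B →
      ENNReal.ofReal δ ≤ coulomb (density u) (density u) → ∃ x, η < |ballAverage r u x| := by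
  have hb := ballVol_pos
  have hK := hardyConst_pos
  -- The choice of `r` makes the remainder contribute `δ/4`; `R` and `η` then bound the far and near
  -- parts by `δ/8` before doubling. The total is `3δ/4 < δ`, a contradiction.
  set r := δ * ballVol / (8 * (hardyConst * B * B)) with hr
  have hr0 : 0 < r := by positivity
  set R := (2 * M + 2 * (r / ballVol * B)) * M * 8 / δ with hR
  have hR0 : 0 < R := by positivity
  have hP : 0 ≤ (ballPotential R).toReal := ENNReal.toReal_nonneg
  set η := Real.sqrt (δ / (8 * M * (1 + (ballPotential R).toReal))) with hη
  have hη0 : 0 < η := Real.sqrt_pos.2 (by positivity)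
  refine ⟨r, hr0, η, hη0, fun u h1 h2 h3 => ?_⟩
  by_contra! hc
  have h4 := h3.trans (coulomb_le_of_ballAverage_le u hr0 hR0 h1 h2 hB.le hc)
  rw [ENNReal.ofReal_le_ofReal_iff'] at h4
  have e1 : 2 * (hardyConst * B * (r / ballVol * B)) = δ / 4 := by
    rw [hr]; field_simp; norm_num
  have e2 : R⁻¹ * (2 * M + 2 * (r / ballVol * B)) * M = δ / 8 := by
    rw [hR]; field_simp
  have e3 : η ^ 2 * (ballPotential R).toReal * M ≤ δ / 8 := by
    rw [hη, Real.sq_sqrt (by positivity)]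
    have : δ / (8 * M * (1 + (ballPotential R).toReal)) * (ballPotential R).toReal * M =
      δ / 8 * ((ballPotential R).toReal / (1 + (ballPotential R).toReal)) := by
      field_simp
    rw [this]
    refine mul_le_of_le_one_right (by positivity) ?_
    rw [div_le_one (by positivity)]
    linarith
  rcases h4 with h4 | h4
  · nlinarith
  · linarith

/-! ### Weak compactness -/

/-- Sequential Banach–Alaoglu in the dual, carried back to the Hilbert space by the Riesz
isomorphism. -/
theorem exists_weak_limit {𝕜 H : Type*} [RCLike 𝕜] [NormedAddCommGroup H] [InnerProductSpace 𝕜 H]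
    [CompleteSpace H] [TopologicalSpace.SeparableSpace H] {x : ℕ → H} {C : ℝ}
    (hC : ∀ n, ‖x n‖ ≤ C) :
    ∃ y : H, ∃ φ : ℕ → ℕ, StrictMono φ ∧
      ∀ z : H, Tendsto (fun n => inner 𝕜 z (x (φ n))) atTop (nhds (inner 𝕜 z y)) := by
  have hcomp := WeakDual.isSeqCompact_closedBall 𝕜 H (0 : StrongDual 𝕜 H) C
  have hmem : ∀ n, StrongDual.toWeakDual (InnerProductSpace.toDual 𝕜 H (x n)) ∈
      WeakDual.toStrongDual ⁻¹' Metric.closedBall (0 : StrongDual 𝕜 H) C := by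
    intro n
    rw [Set.mem_preimage, mem_closedBall_zero_iff]
    refine le_trans (le_of_eq ?_) (hC n)
    exact (InnerProductSpace.toDual 𝕜 H).norm_map (x n)
  obtain ⟨f, -, φ, hφ, hlim⟩ := hcomp hmem
  refine ⟨(InnerProductSpace.toDual 𝕜 H).symm (WeakDual.toStrongDual f), φ, hφ, fun z => ?_⟩
  have h1 := ((WeakDual.eval_continuous z).tendsto f).comp hlim
  have h2 := (RCLike.continuous_conj.tendsto (f z)).comp h1
  have e : inner 𝕜 z ((InnerProductSpace.toDual 𝕜 H).symm (WeakDual.toStrongDual f)) =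
      (starRingEnd 𝕜) (f z) := by
    rw [← inner_conj_symm, InnerProductSpace.toDual_symm_apply]
    rfl
  rw [e]
  refine h2.congr fun n => ?_
  rw [← inner_conj_symm z]
  rfl

instance fact_two_ne_top : Fact ((2 : ℝ≥0∞) ≠ ∞) := ⟨by simp⟩

theorem tendsto_of_weak {u : L2} {v : ℕ → L2}
    (h : ∀ g : L2, Tendsto (fun n => inner ℝ g (v n)) atTop (nhds (inner ℝ g u)))
    (ℓ : L2 →L[ℝ] ℝ) : Tendsto (fun n => ℓ (v n)) atTop (nhds (ℓ u)) := by
  have h1 := h ((InnerProductSpace.toDual ℝ L2).symm ℓ)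
  simpa only [InnerProductSpace.toDual_symm_apply] using h1

/-- The Fourier transform of real-valued `L²` functions as a real-linear map. -/
def fourierCLMReal : L2 →L[ℝ] Lp ℂ 2 (volume : Measure R3) :=
  (Lp.fourierTransformₗᵢ R3 ℂ).toLinearIsometry.toContinuousLinearMap.restrictScalars ℝ ∘L
    (Complex.ofRealCLM.compLpL 2 volume)

theorem fourierCLMReal_apply (u : L2) : fourierCLMReal u = fourierL2 u := rfl

theorem fourierL2_sub (u v : L2) :
    ∀ᵐ ξ, fourierL2 (u - v) ξ = fourierL2 u ξ - fourierL2 v ξ := by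
  simp only [← fourierCLMReal_apply, map_sub]
  exact Lp.coeFn_sub _ _

theorem fourierL2_add (u v : L2) :
    ∀ᵐ ξ, fourierL2 (u + v) ξ = fourierL2 u ξ + fourierL2 v ξ := by
  simp only [← fourierCLMReal_apply, map_add]
  exact Lp.coeFn_add _ _

theorem fourierL2_smul (c : ℝ) (u : L2) :
    ∀ᵐ ξ, fourierL2 (c • u) ξ = c * fourierL2 u ξ := by
  simp only [← fourierCLMReal_apply, map_smul]
  filter_upwards [Lp.coeFn_smul c (fourierCLMReal u)] with ξ h
  rw [h, Pi.smul_apply, Complex.real_smul]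

/-- Weak convergence is available only against real functionals on the real space `L2`, so the real
and imaginary parts of the complex pairing are treated separately. -/
theorem tendsto_inner_fourierL2 {u : L2} {v : ℕ → L2}
    (h : ∀ g : L2, Tendsto (fun n => inner ℝ g (v n)) atTop (nhds (inner ℝ g u)))
    (ψ : Lp ℂ 2 (volume : Measure R3)) :
    Tendsto (fun n => inner ℂ ψ (fourierL2 (v n))) atTop (nhds (inner ℂ ψ (fourierL2 u))) := by
  set ℓ : L2 →L[ℝ] ℂ := (innerSL ℂ ψ).restrictScalars ℝ ∘L fourierCLMReal with hℓ
  have hre := tendsto_of_weak h (Complex.reCLM ∘L ℓ)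
  have him := tendsto_of_weak h (Complex.imCLM ∘L ℓ)
  have h1 : ∀ w : L2, inner ℂ ψ (fourierL2 w) = ((Complex.reCLM ∘L ℓ) w : ℂ) +
      ((Complex.imCLM ∘L ℓ) w : ℂ) * Complex.I := by
    intro w
    have : inner ℂ ψ (fourierL2 w) = ℓ w := rfl
    rw [this]
    exact (Complex.re_add_im _).symm
  simp only [h1]
  exact ((Complex.continuous_ofReal.tendsto _).comp hre).add
    (((Complex.continuous_ofReal.tendsto _).comp him).mul_const _)

/-! ### Weighted quadratic forms in Fourier space -/

/-- The form `∫ σ(ξ) |û(ξ)|² dξ` is finite. -/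
def FiniteForm (σ : R3 → ℝ) (u : L2) : Prop :=
  Integrable fun ξ => σ ξ * ‖fourierL2 u ξ‖ ^ 2

/-- The quadratic form `∫ σ(ξ) |û(ξ)|² dξ`. -/
def weightedForm (σ : R3 → ℝ) (u : L2) : ℝ := ∫ ξ, σ ξ * ‖fourierL2 u ξ‖ ^ 2

theorem weightedForm_nonneg {σ : R3 → ℝ} (hσ : ∀ ξ, 0 ≤ σ ξ) (u : L2) : 0 ≤ weightedForm σ u :=
  integral_nonneg fun ξ => mul_nonneg (hσ ξ) (by positivity)

theorem memLp_sqrt_mul {σ : R3 → ℝ} (hσm : Measurable σ) (hσ : ∀ ξ, 0 ≤ σ ξ) {u : L2}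
    (hu : FiniteForm σ u) :
    MemLp (fun ξ => (Real.sqrt (σ ξ) : ℂ) * fourierL2 u ξ) 2 volume := by
  have hF := measurable_fourierL2 u
  rw [memLp_two_iff_integrable_sq_norm (Measurable.aestronglyMeasurable (by fun_prop))]
  refine hu.congr (Eventually.of_forall fun ξ => ?_)
  simp only [norm_mul, Complex.norm_real, Real.norm_of_nonneg (Real.sqrt_nonneg _), mul_pow,
    Real.sq_sqrt (hσ ξ)]

/-- The element `√σ û` of `L²`. -/
def weightedLift {σ : R3 → ℝ} (hσm : Measurable σ) (hσ : ∀ ξ, 0 ≤ σ ξ) {u : L2}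
    (hu : FiniteForm σ u) : Lp ℂ 2 (volume : Measure R3) :=
  (memLp_sqrt_mul hσm hσ hu).toLp

theorem coeFn_weightedLift {σ : R3 → ℝ} (hσm : Measurable σ) (hσ : ∀ ξ, 0 ≤ σ ξ) {u : L2}
    (hu : FiniteForm σ u) :
    ∀ᵐ ξ, weightedLift hσm hσ hu ξ = (Real.sqrt (σ ξ) : ℂ) * fourierL2 u ξ :=
  (memLp_sqrt_mul hσm hσ hu).coeFn_toLp

theorem norm_sq_eq_integral (f : Lp ℂ 2 (volume : Measure R3)) : ‖f‖ ^ 2 = ∫ ξ, ‖f ξ‖ ^ 2 := by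
  have h := L2.inner_def (𝕜 := ℂ) f f
  have h1 : inner ℂ f f = ((‖f‖ ^ 2 : ℝ) : ℂ) := by
    rw [inner_self_eq_norm_sq_to_K]; norm_cast
  have h2 : ∀ ξ, inner ℂ (f ξ) (f ξ) = ((‖f ξ‖ ^ 2 : ℝ) : ℂ) := by
    intro ξ
    rw [inner_self_eq_norm_sq_to_K]; norm_cast
  rw [h1] at h
  simp only [h2] at h
  rw [integral_complex_ofReal] at h
  exact_mod_cast h

theorem norm_weightedLift_sq {σ : R3 → ℝ} (hσm : Measurable σ) (hσ : ∀ ξ, 0 ≤ σ ξ) {u : L2}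
    (hu : FiniteForm σ u) : ‖weightedLift hσm hσ hu‖ ^ 2 = weightedForm σ u := by
  rw [norm_sq_eq_integral, weightedForm]
  refine integral_congr_ae ?_
  filter_upwards [coeFn_weightedLift hσm hσ hu] with ξ h
  rw [h, norm_mul, Complex.norm_real, Real.norm_of_nonneg (Real.sqrt_nonneg _), mul_pow,
    Real.sq_sqrt (hσ ξ)]

theorem norm_weightedLift_sub_sq {σ : R3 → ℝ} (hσm : Measurable σ) (hσ : ∀ ξ, 0 ≤ σ ξ) {u v : L2}
    (hu : FiniteForm σ u) (hv : FiniteForm σ v) :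
    ‖weightedLift hσm hσ hu - weightedLift hσm hσ hv‖ ^ 2 = weightedForm σ (u - v) := by
  rw [norm_sq_eq_integral, weightedForm]
  refine integral_congr_ae ?_
  filter_upwards [coeFn_weightedLift hσm hσ hu, coeFn_weightedLift hσm hσ hv,
    Lp.coeFn_sub (weightedLift hσm hσ hu) (weightedLift hσm hσ hv), fourierL2_sub u v]
    with ξ h1 h2 h3 h4
  rw [h3, Pi.sub_apply, h1, h2, h4, ← mul_sub, norm_mul, Complex.norm_real,
    Real.norm_of_nonneg (Real.sqrt_nonneg _), mul_pow, Real.sq_sqrt (hσ ξ)]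

theorem memLp_bounded_mul {b : R3 → ℝ} (hbm : Measurable b) {K : ℝ} (hb : ∀ ξ, |b ξ| ≤ K)
    (ψ : Lp ℂ 2 (volume : Measure R3)) : MemLp (fun ξ => (b ξ : ℂ) * ψ ξ) 2 volume := by
  refine (Lp.memLp ψ).of_le_mul (c := K) ?_ (Eventually.of_forall fun ξ => ?_)
  · exact (Complex.measurable_ofReal.comp hbm).aestronglyMeasurable.mul
      (Lp.aestronglyMeasurable ψ)
  · rw [norm_mul, Complex.norm_real]
    exact mul_le_mul_of_nonneg_right (hb ξ) (norm_nonneg _)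

/-- Extraction of a weak limit from a sequence bounded for a weighted form, with the asymptotic
splitting of the form. -/
theorem exists_weak_limit_weightedForm {σ : R3 → ℝ} (hσm : Measurable σ) {c : ℝ} (hc : 0 < c)
    (hσ : ∀ ξ, c ≤ σ ξ) {v : ℕ → L2} {C B : ℝ} (hC : ∀ n, ‖v n‖ ≤ C)
    (hfin : ∀ n, FiniteForm σ (v n)) (hB : ∀ n, weightedForm σ (v n) ≤ B) :
    ∃ u : L2, ∃ φ : ℕ → ℕ, StrictMono φ ∧ FiniteForm σ u ∧
      (∀ g : L2, Tendsto (fun n => inner ℝ g (v (φ n))) atTop (nhds (inner ℝ g u))) ∧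
      Tendsto (fun n => weightedForm σ (v (φ n)) - weightedForm σ (v (φ n) - u)) atTop
        (nhds (weightedForm σ u)) := by
  have hσ0 : ∀ ξ, 0 ≤ σ ξ := fun ξ => hc.le.trans (hσ ξ)
  obtain ⟨u, φ, hφ, hu⟩ := exists_weak_limit (𝕜 := ℝ) hC
  have hJ : ∀ n, ‖weightedLift hσm hσ0 (hfin (φ n))‖ ≤ Real.sqrt B := by
    intro n
    refine Real.le_sqrt_of_sq_le ?_
    rw [norm_weightedLift_sq]
    exact hB _
  -- The lifts `√σ v̂ₙ` are bounded in `L²` and have their own weak limit `g`, which must be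
  -- identified with `√σ û`.
  obtain ⟨g, ψ, hψ, hg⟩ := exists_weak_limit (𝕜 := ℂ) hJ
  have hu' : ∀ g : L2, Tendsto (fun n => inner ℝ g (v (φ (ψ n)))) atTop (nhds (inner ℝ g u)) :=
    fun g => (hu g).comp hψ.tendsto_atTop
  -- Multiplication by `σ^{-1/2}` is bounded because `σ ≥ c`, and it is self-adjoint; it sends the
  -- lifts back to `v̂ₙ`, so by weak continuity it sends `g` to `û`.
  set b : R3 → ℝ := fun ξ => (Real.sqrt (σ ξ))⁻¹ with hb
  have hbm : Measurable b := by simp only [hb]; fun_prop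
  have hspos : ∀ ξ, 0 < Real.sqrt (σ ξ) := fun ξ => Real.sqrt_pos.2 (hc.trans_le (hσ ξ))
  have hbb : ∀ ξ, |b ξ| ≤ (Real.sqrt c)⁻¹ := by
    intro ξ
    rw [hb, abs_of_pos (inv_pos.2 (hspos ξ))]
    exact inv_anti₀ (Real.sqrt_pos.2 hc) (Real.sqrt_le_sqrt (hσ ξ))
  have hmul : ∀ (χ θ : Lp ℂ 2 (volume : Measure R3)),
      inner ℂ (memLp_bounded_mul hbm hbb χ).toLp θ =
        inner ℂ χ (memLp_bounded_mul hbm hbb θ).toLp := by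
    intro χ θ
    rw [L2.inner_def, L2.inner_def]
    refine integral_congr_ae ?_
    filter_upwards [(memLp_bounded_mul hbm hbb χ).coeFn_toLp,
      (memLp_bounded_mul hbm hbb θ).coeFn_toLp] with ξ h1 h2
    rw [h1, h2]
    simp only [RCLike.inner_apply, map_mul, Complex.conj_ofReal]
    ring
  have hlift : ∀ n, (memLp_bounded_mul hbm hbb (weightedLift hσm hσ0 (hfin n))).toLp =
      fourierL2 (v n) := by
    intro n
    refine Lp.ext ?_
    filter_upwards [(memLp_bounded_mul hbm hbb (weightedLift hσm hσ0 (hfin n))).coeFn_toLp,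
      coeFn_weightedLift hσm hσ0 (hfin n)] with ξ h1 h2
    have : (Real.sqrt (σ ξ) : ℂ) ≠ 0 := by exact_mod_cast (hspos ξ).ne'
    rw [h1, h2, hb, ← mul_assoc, Complex.ofReal_inv, inv_mul_cancel₀ this, one_mul]
  have hid : fourierL2 u = (memLp_bounded_mul hbm hbb g).toLp := by
    refine ext_inner_left ℂ fun χ => ?_
    have h1 := tendsto_inner_fourierL2 hu' χ
    have h2 := hg (memLp_bounded_mul hbm hbb χ).toLp
    rw [hmul] at h2
    refine tendsto_nhds_unique h1 (h2.congr fun n => ?_)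
    rw [hmul, hlift]
  have hidae : ∀ᵐ ξ, g ξ = (Real.sqrt (σ ξ) : ℂ) * fourierL2 u ξ := by
    filter_upwards [(memLp_bounded_mul hbm hbb g).coeFn_toLp] with ξ h1
    have : (Real.sqrt (σ ξ) : ℂ) ≠ 0 := by exact_mod_cast (hspos ξ).ne'
    rw [hid, h1, hb, Complex.ofReal_inv, ← mul_assoc, mul_inv_cancel₀ this, one_mul]
  have hufin : FiniteForm σ u := by
    have h1 := (memLp_two_iff_integrable_sq_norm (Lp.aestronglyMeasurable g)).1 (Lp.memLp g)
    refine h1.congr ?_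
    filter_upwards [hidae] with ξ h
    rw [h, norm_mul, Complex.norm_real, Real.norm_of_nonneg (Real.sqrt_nonneg _), mul_pow,
      Real.sq_sqrt (hσ0 ξ)]
  have hgu : g = weightedLift hσm hσ0 hufin := by
    refine Lp.ext ?_
    filter_upwards [hidae, coeFn_weightedLift hσm hσ0 hufin] with ξ h1 h2
    rw [h1, h2]
  refine ⟨u, φ ∘ ψ, hφ.comp hψ, hufin, hu', ?_⟩
  -- In a Hilbert space `‖xₙ‖² - ‖xₙ - g‖² = 2 Re⟨g, xₙ⟩ - ‖g‖²`, which tends to `‖g‖²` under weak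
  -- convergence.
  have h3 : Tendsto (fun n => 2 * RCLike.re (inner ℂ g (weightedLift hσm hσ0 (hfin (φ (ψ n))))) -
      ‖g‖ ^ 2) atTop (nhds (2 * RCLike.re (inner ℂ g g) - ‖g‖ ^ 2)) := by
    refine Tendsto.sub_const (Tendsto.const_mul _ ?_) _
    exact (RCLike.continuous_re.tendsto _).comp (hg g)
  have h4 : 2 * RCLike.re (inner ℂ g g) - ‖g‖ ^ 2 = weightedForm σ u := by
    rw [inner_self_eq_norm_sq, hgu, norm_weightedLift_sq]
    ring
  rw [h4] at h3
  refine h3.congr fun n => ?_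
  rw [Function.comp_apply, ← norm_weightedLift_sub_sq hσm hσ0 (hfin (φ (ψ n))) hufin,
    ← norm_weightedLift_sq hσm hσ0 (hfin (φ (ψ n))), ← hgu, @norm_sub_sq ℂ,
    ← inner_conj_symm, RCLike.conj_re]
  ring

/-! ### The `H^{1/2}` norm -/

/-- The weight `1 + 2π|ξ|` of `H^{1/2}`. -/
def hWeight (ξ : R3) : ℝ := 1 + 2 * Real.pi * ‖ξ‖

theorem one_le_hWeight (ξ : R3) : 1 ≤ hWeight ξ := by
  unfold hWeight
  have := Real.pi_pos
  have : 0 ≤ 2 * Real.pi * ‖ξ‖ := by positivity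
  linarith

theorem hWeight_nonneg (ξ : R3) : 0 ≤ hWeight ξ := zero_le_one.trans (one_le_hWeight ξ)

theorem measurable_hWeight : Measurable hWeight := by unfold hWeight; fun_prop

/-- The squared `H^{1/2}` norm `‖(-Δ)^{1/4} u‖₂² + ‖u‖₂²`. -/
def hNormSq (u : L2) : ℝ := kinetic 0 u + ‖u‖ ^ 2

theorem integrable_fourierL2_sq (u : L2) : Integrable fun ξ => ‖fourierL2 u ξ‖ ^ 2 :=
  (memLp_two_iff_integrable_sq_norm (Lp.aestronglyMeasurable _)).1 (Lp.memLp (fourierL2 u))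

theorem integral_fourierL2_sq (u : L2) : ∫ ξ, ‖fourierL2 u ξ‖ ^ 2 = ‖u‖ ^ 2 := by
  have h := lintegral_fourierL2_sq u
  rw [lintegral_sq_eq] at h
  rw [integral_eq_lintegral_of_nonneg_ae (Eventually.of_forall fun ξ => by positivity)
    (integrable_fourierL2_sq u).aestronglyMeasurable]
  have e : ∀ ξ, ENNReal.ofReal (‖fourierL2 u ξ‖ ^ 2) = ‖fourierL2 u ξ‖ₑ ^ 2 := by
    intro ξ
    rw [ENNReal.ofReal_pow (norm_nonneg _), ofReal_norm]
  simp only [e]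
  rw [h, ENNReal.toReal_ofReal (by positivity)]

theorem kinetic_zero_eq_integral (u : L2) :
    kinetic 0 u = ∫ ξ, 2 * Real.pi * ‖ξ‖ * ‖fourierL2 u ξ‖ ^ 2 := by
  unfold kinetic
  congr 1
  ext ξ
  have h := Real.pi_pos
  rw [zero_pow two_ne_zero, add_zero, Real.sqrt_sq (by positivity)]

theorem integrable_norm_mul_fourierL2_sq {u : L2} (hu : u ∈ HHalf) :
    Integrable fun ξ => 2 * Real.pi * ‖ξ‖ * ‖fourierL2 u ξ‖ ^ 2 := by
  have h : Integrable fun ξ : R3 => (1 + 2 * Real.pi * ‖ξ‖) * ‖fourierL2 u ξ‖ ^ 2 := hu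
  refine (h.sub (integrable_fourierL2_sq u)).congr (Eventually.of_forall fun ξ => ?_)
  simp only [Pi.sub_apply]
  ring

theorem weightedForm_hWeight {u : L2} (hu : u ∈ HHalf) : weightedForm hWeight u = hNormSq u := by
  rw [hNormSq, kinetic_zero_eq_integral, ← integral_fourierL2_sq, ← integral_add
    (integrable_norm_mul_fourierL2_sq hu) (integrable_fourierL2_sq u), weightedForm]
  congr 1
  ext ξ
  unfold hWeight
  ring

theorem kinetic_nonneg (m : ℝ) (u : L2) : 0 ≤ kinetic m u :=
  integral_nonneg fun ξ => by positivity

theorem norm_sq_le_hNormSq (u : L2) : ‖u‖ ^ 2 ≤ hNormSq u :=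
  le_add_of_nonneg_left (kinetic_nonneg 0 u)

theorem hNormSq_pos {u : L2} (hu : u ≠ 0) : 0 < hNormSq u :=
  (pow_pos (norm_pos_iff.2 hu) 2).trans_le (norm_sq_le_hNormSq u)

theorem gagliardo_eq_ofReal {u : L2} (hu : u ∈ HHalf) :
    gagliardo u = ENNReal.ofReal (kinetic 0 u / kineticConst) := by
  rw [kinetic_zero_eq, mul_div_cancel_left₀ _ kineticConst_pos.ne',
    ENNReal.ofReal_toReal ((mem_HHalf_iff u).1 hu).ne]

theorem FiniteForm.add {σ : R3 → ℝ} (hσm : Measurable σ) (hσ : ∀ ξ, 0 ≤ σ ξ) {u v : L2}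
    (hu : FiniteForm σ u) (hv : FiniteForm σ v) : FiniteForm σ (u + v) := by
  refine Integrable.mono' ((Integrable.const_mul hu 2).add (Integrable.const_mul hv 2)) ?_ ?_
  · have := measurable_fourierL2 (u + v)
    exact Measurable.aestronglyMeasurable (by fun_prop)
  · filter_upwards [fourierL2_add u v] with ξ h
    rw [Real.norm_of_nonneg (mul_nonneg (hσ ξ) (by positivity)), h, Pi.add_apply]
    have h1 : ‖fourierL2 u ξ + fourierL2 v ξ‖ ^ 2 ≤
        2 * ‖fourierL2 u ξ‖ ^ 2 + 2 * ‖fourierL2 v ξ‖ ^ 2 := by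
      have := norm_add_le (fourierL2 u ξ) (fourierL2 v ξ)
      have h0 := norm_nonneg (fourierL2 u ξ + fourierL2 v ξ)
      nlinarith [sq_nonneg (‖fourierL2 u ξ‖ - ‖fourierL2 v ξ‖)]
    nlinarith [mul_le_mul_of_nonneg_left h1 (hσ ξ)]

theorem FiniteForm.smul {σ : R3 → ℝ} {u : L2} (hu : FiniteForm σ u) (c : ℝ) :
    FiniteForm σ (c • u) := by
  refine (Integrable.const_mul hu (c ^ 2)).congr ?_
  filter_upwards [fourierL2_smul c u] with ξ h
  rw [h, norm_mul, Complex.norm_real, mul_pow, Real.norm_eq_abs, sq_abs]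
  ring

theorem HHalf_add {u v : L2} (hu : u ∈ HHalf) (hv : v ∈ HHalf) : u + v ∈ HHalf :=
  FiniteForm.add measurable_hWeight hWeight_nonneg hu hv

theorem HHalf_smul {u : L2} (hu : u ∈ HHalf) (c : ℝ) : c • u ∈ HHalf :=
  FiniteForm.smul (σ := hWeight) hu c

theorem HHalf_sub {u v : L2} (hu : u ∈ HHalf) (hv : v ∈ HHalf) : u - v ∈ HHalf := by
  have := HHalf_add hu (HHalf_smul hv (-1))
  simpa [sub_eq_add_neg] using this

theorem weightedForm_smul (σ : R3 → ℝ) (c : ℝ) (u : L2) :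
    weightedForm σ (c • u) = c ^ 2 * weightedForm σ u := by
  unfold weightedForm
  rw [← integral_const_mul]
  refine integral_congr_ae ?_
  filter_upwards [fourierL2_smul c u] with ξ h
  rw [h, norm_mul, Complex.norm_real, mul_pow, Real.norm_eq_abs, sq_abs]
  ring

theorem kinetic_smul (m c : ℝ) (u : L2) : kinetic m (c • u) = c ^ 2 * kinetic m u :=
  weightedForm_smul (fun ξ => Real.sqrt ((2 * Real.pi * ‖ξ‖) ^ 2 + m ^ 2)) c u

theorem norm_smul_sq (c : ℝ) (u : L2) : ‖c • u‖ ^ 2 = c ^ 2 * ‖u‖ ^ 2 := by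
  rw [norm_smul, mul_pow, Real.norm_eq_abs, sq_abs]

theorem hNormSq_smul (c : ℝ) (u : L2) : hNormSq (c • u) = c ^ 2 * hNormSq u := by
  rw [hNormSq, kinetic_smul, norm_smul_sq, hNormSq]
  ring

theorem density_smul (c : ℝ) (u : L2) :
    density (c • u : L2) =ᵐ[volume] fun x => ENNReal.ofReal (c ^ 2) * density u x := by
  filter_upwards [Lp.coeFn_smul c u] with x h
  rw [density_eq_ofReal, density_eq_ofReal, h, Pi.smul_apply, smul_eq_mul, mul_pow,
    ENNReal.ofReal_mul (sq_nonneg c)]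

theorem hartreeEnergy_smul (c d : ℝ) (u v : L2) :
    hartreeEnergy (c • u) (d • v) = c ^ 2 * d ^ 2 * hartreeEnergy u v := by
  rw [hartreeEnergy_eq, hartreeEnergy_eq, coulomb_congr (density_smul c u) (density_smul d v),
    coulomb_const_mul_left ENNReal.ofReal_ne_top, coulomb_const_mul_right ENNReal.ofReal_ne_top,
    ← mul_assoc, ENNReal.toReal_mul, ENNReal.toReal_mul, ENNReal.toReal_ofReal (sq_nonneg c),
    ENNReal.toReal_ofReal (sq_nonneg d)]

theorem hartreeEnergy_le {u v : L2} (hv : v ∈ HHalf) :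
    hartreeEnergy u v ≤ hardyConst / kineticConst * kinetic 0 v * ‖u‖ ^ 2 := by
  have hk := kineticConst_pos
  have hh := hardyConst_pos
  have hv0 := kinetic_nonneg 0 v
  rw [hartreeEnergy_eq]
  refine ENNReal.toReal_le_of_le_ofReal (by positivity) ?_
  refine (coulomb_density_le (measurable_density (measurable_coeFn u)) (measurable_coeFn v)
    (by rw [lintegral_density]; exact ENNReal.ofReal_lt_top)).trans (le_of_eq ?_)
  rw [gagliardo_eq_ofReal hv, lintegral_density, ← ENNReal.ofReal_mul hh.le,
    ← ENNReal.ofReal_mul (by positivity)]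
  congr 1
  ring

theorem gagliardo_congr {f g : R3 → ℝ} (h : f =ᵐ[volume] g) : gagliardo f = gagliardo g := by
  unfold gagliardo
  refine lintegral_congr fun a => ?_
  congr 1
  refine lintegral_congr_ae ?_
  filter_upwards [h, (measurePreserving_add_right volume a).quasiMeasurePreserving.ae h]
    with x h1 h2
  rw [h1, h2]

theorem gagliardo_translate (a : R3) (u : L2) : gagliardo (translate a u) = gagliardo u := by
  rw [gagliardo_congr (coeFn_translate a u), gagliardo_comp_add]

theorem HHalf_translate {u : L2} (hu : u ∈ HHalf) (a : R3) : translate a u ∈ HHalf := by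
  rw [mem_HHalf_iff, gagliardo_translate]
  exact (mem_HHalf_iff u).1 hu

theorem norm_translate (a : R3) (u : L2) : ‖translate a u‖ = ‖u‖ :=
  Lp.norm_compMeasurePreserving u (measurePreserving_add_right volume a)

theorem hNormSq_translate (a : R3) (u : L2) : hNormSq (translate a u) = hNormSq u := by
  rw [hNormSq, hNormSq, kinetic_zero_eq, kinetic_zero_eq, gagliardo_translate, norm_translate]

theorem hartreeEnergy_translate (a : R3) (u : L2) :
    hartreeEnergy (translate a u) (translate a u) = hartreeEnergy u u := by
  have h : density (translate a u) =ᵐ[volume] fun x => density u (x + a) := by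
    filter_upwards [coeFn_translate a u] with x hx
    rw [density, hx, density]
  rw [hartreeEnergy_eq, hartreeEnergy_eq, coulomb_congr h h, coulomb_comp_add]

theorem ballAverage_translate (r : ℝ) (a : R3) (u : L2) :
    ballAverage r (translate a u) 0 = ballAverage r u a := by
  unfold ballAverage
  congr 1
  refine integral_congr_ae (ae_restrict_of_ae ?_)
  filter_upwards [coeFn_translate a u] with h hh
  rw [zero_add, hh, add_comm]

/-! ### Asymptotic splitting of the Coulomb energy -/

theorem exists_lintegral_compl_ball_le {F : R3 → ℝ≥0∞} (hF : Measurable F)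
    (hfin : ∫⁻ x, F x ≠ ∞) {ε : ℝ≥0∞} (hε : 0 < ε) :
    ∃ R : ℝ, 0 < R ∧ ∫⁻ x in (Metric.ball (0 : R3) R)ᶜ, F x ≤ ε := by
  have h := tendsto_lintegral_of_dominated_convergence (μ := (volume : Measure R3))
    (F := fun (n : ℕ) x => (Metric.ball (0 : R3) ((n : ℝ) + 1))ᶜ.indicator F x) (f := fun _ => 0) F
    (fun n => hF.indicator measurableSet_ball.compl)
    (fun n => Eventually.of_forall fun x => Set.indicator_le_self _ _ _) hfin
    (Eventually.of_forall fun x => by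
      obtain ⟨N, hN⟩ := exists_nat_gt ‖x‖
      refine tendsto_const_nhds.congr' ?_
      filter_upwards [eventually_ge_atTop N] with n hn
      rw [Set.indicator_of_notMem]
      have : (N : ℝ) ≤ n := by exact_mod_cast hn
      simp only [Set.mem_compl_iff, Metric.mem_ball, dist_zero_right, not_not]
      linarith)
  rw [lintegral_zero] at h
  obtain ⟨n, hn⟩ := (h.eventually_le_const hε).exists
  refine ⟨(n : ℝ) + 1, by positivity, ?_⟩
  rwa [lintegral_indicator measurableSet_ball.compl] at hn

theorem lintegral_mul_le_sqrt (μ : Measure R3) {f g : R3 → ℝ≥0∞} (hf : Measurable f)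
    (hg : Measurable g) :
    ∫⁻ x, f x * g x ∂μ ≤ (∫⁻ x, f x ^ 2 ∂μ) ^ (1 / 2 : ℝ) * (∫⁻ x, g x ^ 2 ∂μ) ^ (1 / 2 : ℝ) := by
  have h := ENNReal.lintegral_mul_le_Lp_mul_Lq μ
    (Real.HolderConjugate.two_two) hf.aemeasurable hg.aemeasurable
  simpa using h

/-- The hypotheses on a weakly null sequence bounded in `H^{1/2}`. -/
structure WeaklyNull (w : ℕ → L2) (C B : ℝ) : Prop where
  tendsto_inner : ∀ g : L2, Tendsto (fun n => inner ℝ g (w n)) atTop (nhds 0)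
  norm_le : ∀ n, ‖w n‖ ≤ C
  gagliardo_le : ∀ n, gagliardo (w n) ≤ ENNReal.ofReal B

theorem WeaklyNull.lintegral_density_le {w : ℕ → L2} {C B : ℝ} (hw : WeaklyNull w C B) (n : ℕ) :
    ∫⁻ x, density (w n) x ≤ ENNReal.ofReal (C ^ 2) := by
  rw [lintegral_density]
  exact ENNReal.ofReal_le_ofReal (pow_le_pow_left₀ (norm_nonneg _) (hw.norm_le n) 2)

/-- Cauchy–Schwarz inside and outside a large ball: inside, `w n` is small by local compactness;
outside, the tail of `u` is small. -/
theorem WeaklyNull.tendsto_lintegral_mul {w : ℕ → L2} {C B : ℝ} (hw : WeaklyNull w C B) (u : L2) :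
    Tendsto (fun n => ∫⁻ x, ‖u x‖ₑ * ‖w n x‖ₑ) atTop (nhds 0) := by
  have hu := measurable_coeFn u
  have hwm := fun n => measurable_coeFn (w n)
  rw [ENNReal.tendsto_nhds_zero]
  intro ε hε
  have hε2 := ENNReal.half_pos hε.ne'
  set K : ℝ≥0∞ := ENNReal.ofReal (C ^ 2) ^ (1 / 2 : ℝ) with hK
  have hKfin : K ≠ ∞ := ENNReal.rpow_ne_top_of_nonneg (by norm_num) ENNReal.ofReal_ne_top
  set L : ℝ≥0∞ := ENNReal.ofReal (‖u‖ ^ 2) ^ (1 / 2 : ℝ) with hL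
  have hLfin : L ≠ ∞ := ENNReal.rpow_ne_top_of_nonneg (by norm_num) ENNReal.ofReal_ne_top
  obtain ⟨δ, hδ, hδε⟩ : ∃ δ : ℝ≥0∞, 0 < δ ∧ δ ^ (1 / 2 : ℝ) * K ≤ ε / 2 := by
    have h1 : Tendsto (fun δ : ℝ≥0∞ => δ ^ (1 / 2 : ℝ) * K) (nhdsWithin 0 (Set.Ioi 0))
        (nhds ((0 : ℝ≥0∞) ^ (1 / 2 : ℝ) * K)) :=
      (ENNReal.Tendsto.mul_const ((ENNReal.continuous_rpow_const).tendsto 0)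
        (Or.inr hKfin)).mono_left nhdsWithin_le_nhds
    rw [ENNReal.zero_rpow_of_pos (by norm_num), zero_mul] at h1
    obtain ⟨δ, h2, h3⟩ := ((h1.eventually_le_const hε2).and self_mem_nhdsWithin).exists
    exact ⟨δ, h3, h2⟩
  obtain ⟨R, -, hR⟩ := exists_lintegral_compl_ball_le (measurable_density hu)
    (by rw [lintegral_density]; exact ENNReal.ofReal_ne_top) hδ
  have h1 := tendsto_setLIntegral_density hw.tendsto_inner hw.norm_le hw.gagliardo_le R
  have h2 : Tendsto (fun n => L * (∫⁻ x in Metric.ball (0 : R3) R, density (w n) x) ^ (1 / 2 : ℝ))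
      atTop (nhds (L * (0 : ℝ≥0∞) ^ (1 / 2 : ℝ))) :=
    ENNReal.Tendsto.const_mul (((ENNReal.continuous_rpow_const).tendsto 0).comp h1) (Or.inr hLfin)
  rw [ENNReal.zero_rpow_of_pos (by norm_num), mul_zero] at h2
  filter_upwards [h2.eventually_le_const hε2] with n hn
  rw [← lintegral_add_compl _ (measurableSet_ball (x := (0 : R3)) (ε := R)),
    ← ENNReal.add_halves ε]
  refine add_le_add (le_trans ?_ hn) (le_trans ?_ hδε)
  · refine (lintegral_mul_le_sqrt _ hu.enorm (hwm n).enorm).trans ?_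
    refine mul_le_mul' (ENNReal.rpow_le_rpow ?_ (by norm_num)) le_rfl
    exact (setLIntegral_le_lintegral _ _).trans (lintegral_density u).le
  · refine (lintegral_mul_le_sqrt _ hu.enorm (hwm n).enorm).trans ?_
    refine mul_le_mul' (ENNReal.rpow_le_rpow hR (by norm_num))
      (ENNReal.rpow_le_rpow ?_ (by norm_num))
    exact (setLIntegral_le_lintegral _ _).trans (hw.lintegral_density_le n)

theorem coulomb_indicator_le {F H : R3 → ℝ≥0∞} (hF : Measurable F) (hH : Measurable H) {R L : ℝ}
    (hL : 0 < L) :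
    coulomb ((Metric.ball (0 : R3) R).indicator F) ((Metric.ball (0 : R3) (R + L))ᶜ.indicator H) ≤
      ENNReal.ofReal L⁻¹ * (∫⁻ x, F x) * ∫⁻ x, H x := by
  unfold coulomb
  calc _ ≤ ∫⁻ x, ∫⁻ y, ENNReal.ofReal L⁻¹ * F x * H y := by
        refine lintegral_mono fun x => lintegral_mono fun y => ?_
        by_cases hx : x ∈ Metric.ball (0 : R3) R
        · by_cases hy : y ∈ (Metric.ball (0 : R3) (R + L))ᶜ
          · rw [Set.indicator_of_mem hx, Set.indicator_of_mem hy, mul_comm, mul_assoc]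
            have h1 : ‖x‖ < R := by simpa using hx
            have h2 : R + L ≤ ‖y‖ := by simpa using hy
            have h3 : L ≤ ‖x - y‖ := by
              have := norm_sub_norm_le y x
              rw [norm_sub_rev] at this
              linarith
            gcongr
          · rw [Set.indicator_of_notMem hy]; simp
        · rw [Set.indicator_of_notMem hx]; simp
    _ = _ := by
        simp only [lintegral_const_mul _ hH]
        rw [lintegral_mul_const _ (by fun_prop), lintegral_const_mul _ hF]

theorem indicator_add_indicator_compl (s : Set R3) (F : R3 → ℝ≥0∞) :
    F = fun x => s.indicator F x + sᶜ.indicator F x := by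
  ext x
  rw [Set.indicator_self_add_compl_apply]

/-- The densities are cut at radii `R` and `R + L`. The tail of `u` is paired with `w n` by Hardy;
the core of `u` and the far part of `w n` are at distance at least `L`; the near part of `w n`
vanishes by local compactness. -/
theorem WeaklyNull.tendsto_coulomb {w : ℕ → L2} {C B : ℝ} (hw : WeaklyNull w C B) {u : L2}
    (hu : u ∈ HHalf) : Tendsto (fun n => coulomb (density u) (density (w n))) atTop (nhds 0) := by
  have hum := measurable_density (measurable_coeFn u)
  have hwm := fun n => measurable_density (measurable_coeFn (w n))
  have hGu := ((mem_HHalf_iff u).1 hu).ne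
  have hufin : ∫⁻ x, density u x < ∞ := by rw [lintegral_density]; exact ENNReal.ofReal_lt_top
  have hwfin : ∀ n, ∫⁻ x, density (w n) x < ∞ := fun n =>
    (hw.lintegral_density_le n).trans_lt ENNReal.ofReal_lt_top
  set K := ENNReal.ofReal hardyConst with hK
  rw [ENNReal.tendsto_nhds_zero]
  intro ε hε
  have hε3 : 0 < ε / 3 := ENNReal.div_pos hε.ne' (by simp)
  obtain ⟨δ, hδ, hδε⟩ : ∃ δ : ℝ≥0∞, 0 < δ ∧ K * ENNReal.ofReal B * δ ≤ ε / 3 := by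
    have h1 : Tendsto (fun δ : ℝ≥0∞ => K * ENNReal.ofReal B * δ) (nhdsWithin 0 (Set.Ioi 0))
        (nhds (K * ENNReal.ofReal B * 0)) :=
      (ENNReal.Tendsto.const_mul tendsto_id (Or.inr (by finiteness))).mono_left nhdsWithin_le_nhds
    rw [mul_zero] at h1
    obtain ⟨δ, h2, h3⟩ := ((h1.eventually_le_const hε3).and self_mem_nhdsWithin).exists
    exact ⟨δ, h3, h2⟩
  obtain ⟨R, -, hR⟩ := exists_lintegral_compl_ball_le hum hufin.ne hδ
  obtain ⟨L, hL, hLε⟩ : ∃ L : ℝ, 0 < L ∧ ENNReal.ofReal L⁻¹ * (∫⁻ x, density u x) *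
      ENNReal.ofReal (C ^ 2) ≤ ε / 3 := by
    have h1 : Tendsto (fun L : ℝ => ENNReal.ofReal L⁻¹ * (∫⁻ x, density u x) *
        ENNReal.ofReal (C ^ 2)) atTop (nhds (ENNReal.ofReal 0 * (∫⁻ x, density u x) *
        ENNReal.ofReal (C ^ 2))) :=
      ENNReal.Tendsto.mul_const (ENNReal.Tendsto.mul_const
        (ENNReal.tendsto_ofReal tendsto_inv_atTop_zero) (Or.inr hufin.ne))
        (Or.inr ENNReal.ofReal_ne_top)
    rw [ENNReal.ofReal_zero, zero_mul, zero_mul] at h1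
    obtain ⟨L, h2, h3⟩ := ((h1.eventually_le_const hε3).and (eventually_gt_atTop 0)).exists
    exact ⟨L, h3, h2⟩
  have h1 := tendsto_setLIntegral_density hw.tendsto_inner hw.norm_le hw.gagliardo_le (R + L)
  have h2 := ENNReal.Tendsto.const_mul (a := K * gagliardo u) h1 (Or.inr (by finiteness))
  rw [mul_zero] at h2
  filter_upwards [h2.eventually_le_const hε3] with n hn
  set s := Metric.ball (0 : R3) R
  set t := Metric.ball (0 : R3) (R + L)
  have hsm : MeasurableSet s := measurableSet_ball
  have htm : MeasurableSet t := measurableSet_ball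
  have hA : coulomb (s.indicator (density u)) (t.indicator (density (w n))) ≤ ε / 3 := by
    calc _ ≤ coulomb (density u) (t.indicator (density (w n))) :=
          coulomb_mono (Eventually.of_forall fun x => Set.indicator_le_self _ _ _)
            (Eventually.of_forall fun x => le_rfl)
      _ ≤ K * gagliardo u * ∫⁻ x, t.indicator (density (w n)) x := by
          rw [coulomb_comm hum ((hwm n).indicator htm)]
          exact coulomb_density_le ((hwm n).indicator htm) (measurable_coeFn u) hufin
      _ ≤ ε / 3 := by rwa [lintegral_indicator htm]
  have hBd : coulomb (s.indicator (density u)) (tᶜ.indicator (density (w n))) ≤ ε / 3 :=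
    (coulomb_indicator_le hum (hwm n) hL).trans
      ((mul_le_mul' le_rfl (hw.lintegral_density_le n)).trans hLε)
  have hCd : coulomb (sᶜ.indicator (density u)) (density (w n)) ≤ ε / 3 := by
    calc _ ≤ K * gagliardo (w n) * ∫⁻ x, sᶜ.indicator (density u) x :=
          coulomb_density_le (hum.indicator hsm.compl) (measurable_coeFn _) (hwfin n)
      _ ≤ K * ENNReal.ofReal B * δ := by
          rw [lintegral_indicator hsm.compl]
          gcongr
          exact hw.gagliardo_le n
      _ ≤ ε / 3 := hδε
  calc coulomb (density u) (density (w n))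
      = coulomb (s.indicator (density u)) (density (w n)) +
        coulomb (sᶜ.indicator (density u)) (density (w n)) := by
        conv_lhs => rw [indicator_add_indicator_compl s (density u)]
        exact coulomb_add_left (hum.indicator hsm) (hwm n)
    _ = (coulomb (s.indicator (density u)) (t.indicator (density (w n))) +
        coulomb (s.indicator (density u)) (tᶜ.indicator (density (w n)))) +
        coulomb (sᶜ.indicator (density u)) (density (w n)) := by
        congr 1
        conv_lhs => rw [indicator_add_indicator_compl t (density (w n))]
        exact coulomb_add_right (hum.indicator hsm) ((hwm n).indicator htm)
    _ ≤ ε / 3 + ε / 3 + ε / 3 := by gcongr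
    _ = ε := ENNReal.add_thirds ε

/-- With `σ = f² + g²` and `τ = 2|fg| ≤ σ`, the density of the sum is at most `σ + τ`. Each term
containing `τ` is bounded by the mass of `τ` times the Hardy bound for the potential of `σ`; there
are three of them, whence the factor 3. -/
theorem coulomb_density_add_le {f g : R3 → ℝ} (hf : Measurable f) (hg : Measurable g)
    (hfi : ∫⁻ x, density f x < ∞) (hgi : ∫⁻ x, density g x < ∞) :
    coulomb (density (fun x => f x + g x)) (density (fun x => f x + g x)) ≤
      coulomb (density f) (density f) + coulomb (density g) (density g) +
      (2 * coulomb (density f) (density g) +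
        ENNReal.ofReal hardyConst * (3 * gagliardo f + 3 * gagliardo g) *
          (2 * ∫⁻ x, ‖f x‖ₑ * ‖g x‖ₑ)) := by
  set σ : R3 → ℝ≥0∞ := fun x => density f x + density g x with hσ
  set τ : R3 → ℝ≥0∞ := fun x => 2 * (‖f x‖ₑ * ‖g x‖ₑ) with hτ
  set ρ := density (fun x => f x + g x) with hρ
  have hfm := measurable_density hf
  have hgm := measurable_density hg
  have hσm : Measurable σ := by simp only [hσ]; fun_prop
  have hτm : Measurable τ := by simp only [hτ]; fun_prop
  have hle : ∀ x, ρ x ≤ σ x + τ x := by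
    intro x
    calc ρ x ≤ (‖f x‖ₑ + ‖g x‖ₑ) ^ 2 := by
          simp only [hρ, density]
          gcongr
          exact enorm_add_le _ _
      _ = σ x + τ x := by simp only [hσ, hτ, density]; ring
  have hτσ : ∀ x, τ x ≤ σ x := by
    intro x
    have := two_mul_mul_le_sq_add_sq ‖f x‖ₑ ‖g x‖ₑ
    simpa only [hσ, hτ, density, sq] using this
  set G := ENNReal.ofReal hardyConst * (gagliardo f + gagliardo g) with hG
  have hστ : coulomb τ σ ≤ G * ∫⁻ x, τ x := by
    rw [hσ, coulomb_add_right hτm hfm, hG, mul_add, add_mul]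
    exact add_le_add (coulomb_density_le hτm hf hfi) (coulomb_density_le hτm hg hgi)
  have hττ : coulomb τ τ ≤ G * ∫⁻ x, τ x :=
    (coulomb_mono (Eventually.of_forall fun x => le_rfl) (Eventually.of_forall hτσ)).trans hστ
  calc coulomb ρ ρ ≤ coulomb (fun x => σ x + τ x) (fun x => σ x + τ x) :=
        coulomb_mono (Eventually.of_forall hle) (Eventually.of_forall hle)
    _ = coulomb σ σ + (coulomb τ σ + coulomb τ σ + coulomb τ τ) := by
        rw [coulomb_add_left hσm (H := fun x => σ x + τ x) (hσm.add hτm), coulomb_add_right hσm hσm,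
          coulomb_add_right hτm hσm, coulomb_comm hσm hτm]
        ring
    _ ≤ coulomb σ σ + (G * (∫⁻ x, τ x) + G * (∫⁻ x, τ x) + G * ∫⁻ x, τ x) := by gcongr
    _ ≤ _ := by
        have e : coulomb σ σ = coulomb (density f) (density f) + coulomb (density g) (density g) +
            2 * coulomb (density f) (density g) := by
          rw [hσ, coulomb_add_left hfm hσm, coulomb_add_right hfm hfm, coulomb_add_right hgm hfm,
            coulomb_comm hgm hfm]
          ring
        have e2 : ∫⁻ x, τ x = 2 * ∫⁻ x, ‖f x‖ₑ * ‖g x‖ₑ := lintegral_const_mul' _ _ (by simp)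
        rw [e, e2, hG]
        set I := 2 * ∫⁻ x, ‖f x‖ₑ * ‖g x‖ₑ
        set K := ENNReal.ofReal hardyConst
        rw [add_assoc (_ + _)]
        gcongr _ + (_ + ?_)
        exact le_of_eq (by ring)

/-- The Coulomb energy of `u + w n` is asymptotically at most the sum of the energies. -/
theorem WeaklyNull.exists_error {w : ℕ → L2} {C B : ℝ} (hw : WeaklyNull w C B)
    (hwH : ∀ n, w n ∈ HHalf) {u : L2} (hu : u ∈ HHalf) :
    ∃ e : ℕ → ℝ, Tendsto e atTop (nhds 0) ∧ ∀ n, hartreeEnergy (u + w n) (u + w n) ≤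
      hartreeEnergy u u + hartreeEnergy (w n) (w n) + e n := by
  have hGu := ((mem_HHalf_iff u).1 hu).ne
  set K := ENNReal.ofReal hardyConst
  set E : ℕ → ℝ≥0∞ := fun n => 2 * coulomb (density u) (density (w n)) +
    K * (3 * gagliardo u + 3 * ENNReal.ofReal B) * (2 * ∫⁻ x, ‖u x‖ₑ * ‖w n x‖ₑ) with hE
  have hEt : Tendsto E atTop (nhds 0) := by
    have h1 := ENNReal.Tendsto.const_mul (a := 2) (hw.tendsto_coulomb hu) (Or.inr (by simp))
    have h2 := ENNReal.Tendsto.const_mul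
      (a := K * (3 * gagliardo u + 3 * ENNReal.ofReal B)) (ENNReal.Tendsto.const_mul (a := 2)
      (hw.tendsto_lintegral_mul u) (Or.inr (by simp))) (Or.inr (by finiteness))
    simpa using h1.add h2
  have hEfin : ∀ n, E n ≠ ∞ := by
    intro n
    have h1 : coulomb (density u) (density (w n)) ≠ ∞ := (coulomb_lt_top (hwH n)).ne
    have h2 : ∫⁻ x, ‖u x‖ₑ * ‖w n x‖ₑ ≠ ∞ := by
      refine ((lintegral_mul_le_sqrt volume (measurable_coeFn u).enorm
        (measurable_coeFn (w n)).enorm).trans_lt ?_).ne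
      rw [lintegral_sq_eq, lintegral_sq_eq]
      exact ENNReal.mul_lt_top (ENNReal.rpow_lt_top_of_nonneg (by norm_num) ENNReal.ofReal_ne_top)
        (ENNReal.rpow_lt_top_of_nonneg (by norm_num) ENNReal.ofReal_ne_top)
    simp only [hE]
    finiteness
  refine ⟨fun n => (E n).toReal, ?_, fun n => ?_⟩
  · have := (ENNReal.tendsto_toReal ENNReal.zero_ne_top).comp hEt
    simpa [Function.comp_def] using this
  · have h1 : density (u + w n : L2) =ᵐ[volume] density (fun x => u x + w n x) := by
      filter_upwards [Lp.coeFn_add u (w n)] with x hx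
      rw [density, hx, density, Pi.add_apply]
    rw [hartreeEnergy_eq, hartreeEnergy_eq, hartreeEnergy_eq, coulomb_congr h1 h1,
      ← ENNReal.toReal_add (coulomb_lt_top hu).ne (coulomb_lt_top (hwH n)).ne,
      ← ENNReal.toReal_add (by
        have := (coulomb_lt_top (u := u) hu).ne
        have := (coulomb_lt_top (u := w n) (hwH n)).ne
        finiteness) (hEfin n)]
    refine ENNReal.toReal_mono (by
        have := (coulomb_lt_top (u := u) hu).ne
        have := (coulomb_lt_top (u := w n) (hwH n)).ne
        have := hEfin n
        finiteness) ?_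
    refine (coulomb_density_add_le (measurable_coeFn u) (measurable_coeFn (w n))
      (by rw [lintegral_density]; exact ENNReal.ofReal_lt_top)
      (by rw [lintegral_density]; exact ENNReal.ofReal_lt_top)).trans ?_
    simp only [hE]
    gcongr
    exact hw.gagliardo_le n

/-! ### Existence of an optimizer -/

theorem kinetic_zero_le_hNormSq (u : L2) : kinetic 0 u ≤ hNormSq u :=
  le_add_of_nonneg_right (pow_nonneg (norm_nonneg u) 2)

theorem hartreeEnergy_le_hNormSq_sq {u : L2} (hu : u ∈ HHalf) :
    hartreeEnergy u u ≤ hardyConst / kineticConst * hNormSq u ^ 2 := by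
  have hk := kineticConst_pos
  have hh := hardyConst_pos
  have h0 := kinetic_nonneg 0 u
  refine (hartreeEnergy_le hu).trans ?_
  rw [mul_assoc, sq (hNormSq u)]
  gcongr
  · exact h0.trans (kinetic_zero_le_hNormSq u)
  · exact kinetic_zero_le_hNormSq u
  · exact norm_sq_le_hNormSq u

theorem gagliardo_le_of_hNormSq_le {u : L2} (hu : u ∈ HHalf) {B : ℝ} (h : hNormSq u ≤ B) :
    gagliardo u ≤ ENNReal.ofReal (B / kineticConst) := by
  have hk := kineticConst_pos
  rw [gagliardo_eq_ofReal hu]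
  refine ENNReal.ofReal_le_ofReal ?_
  gcongr
  exact (kinetic_zero_le_hNormSq u).trans h

/-- A maximizing sequence for `D(u) / N(u)²`, after translations, has a nonzero weak limit. -/
theorem exists_translated_sequence {v : ℕ → L2} (hv : ∀ n, v n ∈ HHalf)
    (hN : ∀ n, hNormSq (v n) = 1) {δ : ℝ} (hδ : 0 < δ)
    (hD : ∀ n, δ ≤ hartreeEnergy (v n) (v n)) :
    ∃ t : ℕ → L2, (∀ n, t n ∈ HHalf) ∧ (∀ n, hNormSq (t n) = 1) ∧
      (∀ n, hartreeEnergy (t n) (t n) = hartreeEnergy (v n) (v n)) ∧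
      ∃ r > 0, ∃ η > 0, ∀ n, η < |ballAverage r (t n) 0| := by
  have hk := kineticConst_pos
  obtain ⟨r, hr, η, hη, h⟩ := exists_ballAverage_gt (M := 1) (B := 1 / kineticConst) one_pos
    (by positivity) hδ
  have hx : ∀ n, ∃ x, η < |ballAverage r (v n) x| := by
    intro n
    refine h (v n) ((norm_sq_le_hNormSq _).trans (hN n).le)
      (gagliardo_le_of_hNormSq_le (hv n) (hN n).le) ?_
    rw [ENNReal.ofReal_le_iff_le_toReal (coulomb_lt_top (hv n)).ne, ← hartreeEnergy_eq]
    exact hD n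
  choose x hx using hx
  refine ⟨fun n => translate (x n) (v n), fun n => HHalf_translate (hv n) _, fun n => ?_,
    fun n => hartreeEnergy_translate _ _, r, hr, η, hη, fun n => ?_⟩
  · rw [hNormSq_translate, hN]
  · rw [ballAverage_translate]
    exact hx n

/-- With `s = hNormSq u` for the weak limit `u`, the splitting gives `C ≤ hartreeEnergy u u +
C(1-s)² ≤ C(s² + (1-s)²)`, so `s` is 0 or 1. The ball averages at the origin pass to the weak limit
and exclude `s = 0`. -/
theorem exists_maximizer_of_sequence {C : ℝ} (hC : 0 < C)
    (hle : ∀ u ∈ HHalf, hartreeEnergy u u ≤ C * hNormSq u ^ 2) {t : ℕ → L2}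
    (ht : ∀ n, t n ∈ HHalf) (hN : ∀ n, hNormSq (t n) = 1)
    (hlim : Tendsto (fun n => hartreeEnergy (t n) (t n)) atTop (nhds C)) {r η : ℝ}
    (hη : 0 < η) (havg : ∀ n, η < |ballAverage r (t n) 0|) :
    ∃ u ∈ HHalf, hNormSq u = 1 ∧ hartreeEnergy u u = C := by
  have hk := kineticConst_pos
  have hnorm : ∀ n, ‖t n‖ ≤ 1 := by
    intro n
    have := (norm_sq_le_hNormSq (t n)).trans (hN n).le
    nlinarith [norm_nonneg (t n)]
  obtain ⟨u, φ, hφ, hu, hweak, hsplit⟩ := exists_weak_limit_weightedForm measurable_hWeight one_pos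
    one_le_hWeight hnorm ht (B := 1) (fun n => by rw [weightedForm_hWeight (ht n), hN])
  have hu : u ∈ HHalf := hu
  have hune : 0 < hNormSq u := by
    refine hNormSq_pos ?_
    rintro rfl
    have h1 := ((hweak (indicatorConstLp 2 (measurableSet_ball (x := (0 : R3)) (ε := r))
      measure_ball_lt_top.ne (1 : ℝ))).const_mul (r ^ 3 * ballVol)⁻¹).abs
    simp only [inner_zero_right, mul_zero, abs_zero, ← ballAverage_eq_inner] at h1
    have h2 := ge_of_tendsto' h1 fun n => (havg (φ n)).le
    linarith
  set w : ℕ → L2 := fun n => t (φ n) - u with hw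
  -- Only the limit of `hNormSq (w n)` is known; it yields both the bound on the sequence and
  -- `hNormSq u ≤ 1`.
  have hwH : ∀ n, w n ∈ HHalf := fun n => HHalf_sub (ht _) hu
  have hwlim : Tendsto (fun n => hNormSq (w n)) atTop (nhds (1 - hNormSq u)) := by
    rw [weightedForm_hWeight hu] at hsplit
    refine (hsplit.const_sub 1).congr fun n => ?_
    rw [weightedForm_hWeight (ht _), hN, weightedForm_hWeight (hwH n)]
    ring
  have hs1 : hNormSq u ≤ 1 := by
    have := ge_of_tendsto' hwlim fun n =>
      (sq_nonneg ‖w n‖).trans (norm_sq_le_hNormSq (w n))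
    linarith
  obtain ⟨B, hB⟩ := hwlim.bddAbove_range
  have hwB : ∀ n, hNormSq (w n) ≤ B := fun n => hB (Set.mem_range_self n)
  have hnull : WeaklyNull w (1 + ‖u‖) (B / kineticConst) := by
    refine ⟨fun g => ?_, fun n => ?_, fun n => gagliardo_le_of_hNormSq_le (hwH n) (hwB n)⟩
    · have := (hweak g).sub_const (inner ℝ g u)
      rw [sub_self] at this
      refine this.congr fun n => ?_
      rw [hw, inner_sub_right]
    · exact (norm_sub_le _ _).trans (by gcongr; exact hnorm _)
  obtain ⟨e, he, hE⟩ := hnull.exists_error hwH hu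
  have key : C ≤ hartreeEnergy u u + C * (1 - hNormSq u) ^ 2 := by
    have h1 : Tendsto (fun n => hartreeEnergy u u + C * hNormSq (w n) ^ 2 + e n) atTop
        (nhds (hartreeEnergy u u + C * (1 - hNormSq u) ^ 2 + 0)) :=
      (((hwlim.pow 2).const_mul C).const_add _).add he
    rw [add_zero] at h1
    refine le_of_tendsto_of_tendsto' (hlim.comp hφ.tendsto_atTop) h1 fun n => ?_
    have h2 := hE n
    have e1 : u + w n = t (φ n) := add_sub_cancel _ _
    rw [e1] at h2
    refine h2.trans ?_
    gcongr
    exact hle _ (hwH n)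
  have hDu := hle u hu
  have hs : hNormSq u = 1 := by
    by_contra hne
    have hlt : hNormSq u < 1 := lt_of_le_of_ne hs1 hne
    have h3 : C ≤ C * (hNormSq u ^ 2 + (1 - hNormSq u) ^ 2) := by linarith
    have h4 : 1 ≤ hNormSq u ^ 2 + (1 - hNormSq u) ^ 2 := by
      by_contra! h5
      nlinarith
    nlinarith
  refine ⟨u, hu, hs, ?_⟩
  rw [hs] at key hDu
  linarith

/-- The constant is the supremum of the scale-invariant quotient `D/N²`, finite by Hardy. A function
of positive energy makes it positive, which rules out vanishing of a maximizing sequence. -/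
theorem exists_optimizer (hne : ∃ q ∈ HHalf, 0 < hartreeEnergy q q) :
    ∃ C : ℝ, 0 < C ∧ (∀ u ∈ HHalf, hartreeEnergy u u ≤ C * hNormSq u ^ 2) ∧
      ∃ u ∈ HHalf, hNormSq u = 1 ∧ hartreeEnergy u u = C := by
  have hk := kineticConst_pos
  have hh := hardyConst_pos
  set S : Set ℝ := {c | ∃ u ∈ HHalf, hNormSq u = 1 ∧ hartreeEnergy u u = c} with hS
  have hnormalize : ∀ u ∈ HHalf, u ≠ 0 → hartreeEnergy u u / hNormSq u ^ 2 ∈ S := by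
    intro u hu hu0
    have hpos := hNormSq_pos hu0
    refine ⟨(Real.sqrt (hNormSq u))⁻¹ • u, HHalf_smul hu _, ?_, ?_⟩
    · rw [hNormSq_smul, inv_pow, Real.sq_sqrt hpos.le, inv_mul_cancel₀ hpos.ne']
    · rw [hartreeEnergy_smul, inv_pow, Real.sq_sqrt hpos.le]
      field_simp
  have hbdd : BddAbove S := by
    refine ⟨hardyConst / kineticConst, ?_⟩
    rintro c ⟨u, hu, hu1, rfl⟩
    have := hartreeEnergy_le_hNormSq_sq hu
    rwa [hu1, one_pow, mul_one] at this
  have hzero : hartreeEnergy (0 : L2) 0 = 0 := by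
    have := hartreeEnergy_smul 0 0 (0 : L2) 0
    simpa using this
  have hle : ∀ u ∈ HHalf, hartreeEnergy u u ≤ sSup S * hNormSq u ^ 2 := by
    intro u hu
    rcases eq_or_ne u 0 with rfl | hu0
    · have h1 : hNormSq (0 : L2) = 0 := by
        have := hNormSq_smul 0 (0 : L2)
        simpa using this
      rw [hzero, h1]; simp
    · have hpos := hNormSq_pos hu0
      rw [← div_le_iff₀ (by positivity)]
      exact le_csSup hbdd (hnormalize u hu hu0)
  obtain ⟨q, hq, hqD⟩ := hne
  have hq0 : q ≠ 0 := by
    rintro rfl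
    rw [hzero] at hqD
    exact hqD.false
  have hSne : S.Nonempty := ⟨_, hnormalize q hq hq0⟩
  have hpos : 0 < sSup S := by
    have h1 := le_csSup hbdd (hnormalize q hq hq0)
    have h2 := hNormSq_pos hq0
    exact lt_of_lt_of_le (by positivity) h1
  obtain ⟨c, -, hclim, hcS⟩ := exists_seq_tendsto_sSup hSne hbdd
  -- Dropping the first `N` terms keeps every energy above half the supremum, the lower bound that
  -- nonvanishing needs.
  obtain ⟨N, hN⟩ := eventually_atTop.1 (hclim.eventually_const_le (half_lt_self hpos))
  choose v hvH hv1 hvD using fun n => hcS (n + N)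
  obtain ⟨t, htH, ht1, htD, r, -, η, hη, havg⟩ := exists_translated_sequence hvH hv1
    (half_pos hpos) (fun n => by rw [hvD]; exact hN _ (Nat.le_add_left _ _))
  refine ⟨sSup S, hpos, hle, exists_maximizer_of_sequence hpos hle htH ht1 ?_ hη havg⟩
  refine (hclim.comp (tendsto_add_atTop_nat N)).congr fun n => ?_
  rw [htD, hvD, Function.comp_apply]

/-! ### The Euler–Lagrange equation of an optimizer -/

theorem norm_add_real_mul_sq (a b : ℂ) (ε : ℝ) :
    ‖a + ε * b‖ ^ 2 = ‖a‖ ^ 2 + 2 * ε * (a * (starRingEnd ℂ) b).re + ε ^ 2 * ‖b‖ ^ 2 := by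
  rw [← Complex.normSq_eq_norm_sq, ← Complex.normSq_eq_norm_sq, ← Complex.normSq_eq_norm_sq]
  simp only [Complex.normSq_apply, Complex.add_re, Complex.add_im, Complex.mul_re, Complex.mul_im,
    Complex.ofReal_re, Complex.ofReal_im, Complex.conj_re, Complex.conj_im]
  ring

theorem integrable_pairing {u φ : L2} (hu : u ∈ HHalf) (hφ : φ ∈ HHalf) :
    Integrable fun ξ : R3 => 2 * Real.pi * ‖ξ‖ *
      (fourierL2 u ξ * (starRingEnd ℂ) (fourierL2 φ ξ)).re := by
  have h1 := measurable_fourierL2 u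
  have h2 := measurable_fourierL2 φ
  have hpi := Real.pi_pos
  refine Integrable.mono' ((integrable_norm_mul_fourierL2_sq hu).add
    (integrable_norm_mul_fourierL2_sq hφ)) ?_ (Eventually.of_forall fun ξ => ?_)
  · have h3 : Measurable fun ξ => (starRingEnd ℂ) (fourierL2 φ ξ) :=
      Complex.continuous_conj.measurable.comp h2
    have h4 : Measurable fun ξ => (fourierL2 u ξ * (starRingEnd ℂ) (fourierL2 φ ξ)).re :=
      Complex.measurable_re.comp (h1.mul h3)
    exact Measurable.aestronglyMeasurable (by fun_prop)
  · rw [norm_mul, Real.norm_of_nonneg (by positivity), Pi.add_apply, ← mul_add]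
    refine mul_le_mul_of_nonneg_left ?_ (by positivity)
    refine (Complex.abs_re_le_norm _).trans ?_
    rw [norm_mul, RCLike.norm_conj]
    nlinarith [sq_nonneg (‖fourierL2 u ξ‖ - ‖fourierL2 φ ξ‖), sq_nonneg ‖fourierL2 u ξ‖,
      sq_nonneg ‖fourierL2 φ ξ‖]

theorem kinetic_zero_add_smul {u φ : L2} (hu : u ∈ HHalf) (hφ : φ ∈ HHalf) (ε : ℝ) :
    kinetic 0 (u + ε • φ) =
      kinetic 0 u + 2 * ε * sqrtLaplacianPairing u φ + ε ^ 2 * kinetic 0 φ := by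
  rw [kinetic_zero_eq_integral, kinetic_zero_eq_integral, kinetic_zero_eq_integral,
    sqrtLaplacianPairing, ← integral_const_mul, ← integral_const_mul,
    ← integral_add (integrable_norm_mul_fourierL2_sq hu) ((integrable_pairing hu hφ).const_mul _),
    ← integral_add ((integrable_norm_mul_fourierL2_sq hu).fun_add
      ((integrable_pairing hu hφ).const_mul _)) ((integrable_norm_mul_fourierL2_sq hφ).const_mul _)]
  refine integral_congr_ae ?_
  filter_upwards [fourierL2_add u (ε • φ), fourierL2_smul ε φ] with ξ h1 h2
  rw [h1, h2, norm_add_real_mul_sq]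
  ring

theorem inner_eq_integral (u φ : L2) : inner ℝ u φ = ∫ x, u x * φ x := by
  rw [L2.inner_def]
  refine integral_congr_ae (Eventually.of_forall fun x => ?_)
  simp [mul_comm]

theorem hNormSq_add_smul {u φ : L2} (hu : u ∈ HHalf) (hφ : φ ∈ HHalf) (ε : ℝ) :
    hNormSq (u + ε • φ) = hNormSq u +
      2 * ε * (sqrtLaplacianPairing u φ + ∫ x, u x * φ x) + ε ^ 2 * hNormSq φ := by
  rw [hNormSq, kinetic_zero_add_smul hu hφ, norm_add_sq_real, inner_smul_right, norm_smul_sq,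
    inner_eq_integral, hNormSq, hNormSq]
  ring

theorem integrable_hartree (u : L2) {v : L2} (hv : v ∈ HHalf) :
    Integrable fun p : R3 × R3 => u p.1 ^ 2 * v p.2 ^ 2 / ‖p.1 - p.2‖ := by
  have hum := measurable_coeFn u
  have hvm := measurable_coeFn v
  refine ⟨Measurable.aestronglyMeasurable (by fun_prop), ?_⟩
  rw [hasFiniteIntegral_iff_ofReal (Eventually.of_forall fun p => by positivity),
    Measure.volume_eq_prod, lintegral_prod _ (Measurable.aemeasurable (by fun_prop))]
  refine lt_of_eq_of_lt ?_ (coulomb_lt_top (u := u) hv)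
  refine lintegral_congr fun x => lintegral_congr fun y => ?_
  rw [div_eq_mul_inv, ENNReal.ofReal_mul (by positivity), ENNReal.ofReal_mul (by positivity),
    density_eq_ofReal, density_eq_ofReal]

theorem integrable_coulomb_of_le {u φ : L2} (hu : u ∈ HHalf) (hφ : φ ∈ HHalf) {f g : R3 → ℝ}
    (hfm : Measurable f) (hgm : Measurable g) (hf : ∀ x, |f x| ≤ u x ^ 2 + φ x ^ 2)
    (hg : ∀ x, |g x| ≤ u x ^ 2 + φ x ^ 2) :
    Integrable fun p : R3 × R3 => f p.1 * g p.2 / ‖p.1 - p.2‖ := by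
  refine Integrable.mono' (((integrable_hartree u hu).add (integrable_hartree u hφ)).add
    ((integrable_hartree φ hu).add (integrable_hartree φ hφ)))
    (Measurable.aestronglyMeasurable (by fun_prop)) (Eventually.of_forall fun p => ?_)
  simp only [Pi.add_apply, ← add_div, norm_div, norm_mul, Real.norm_eq_abs,
    abs_norm]
  refine div_le_div_of_nonneg_right ?_ (norm_nonneg (p.1 - p.2))
  calc |f p.1| * |g p.2| ≤ (u p.1 ^ 2 + φ p.1 ^ 2) * (u p.2 ^ 2 + φ p.2 ^ 2) :=
        mul_le_mul (hf _) (hg _) (abs_nonneg _) (by positivity)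
    _ = _ := by ring

theorem abs_mul_le_sq_add_sq (a b : ℝ) : |a * b| ≤ a ^ 2 + b ^ 2 := by
  rw [abs_le]
  constructor <;> nlinarith [sq_nonneg (a + b), sq_nonneg (a - b), sq_nonneg a, sq_nonneg b]

theorem integral_potential_mul {u φ : L2} (hu : u ∈ HHalf) (hφ : φ ∈ HHalf) :
    ∫ p : R3 × R3, (u p.1 * φ p.1) * u p.2 ^ 2 / ‖p.1 - p.2‖ =
      ∫ x, hartreePotential u x * u x * φ x := by
  have hum := measurable_coeFn u
  have hφm := measurable_coeFn φ
  have hint := integrable_coulomb_of_le hu hφ (f := fun x => u x * φ x) (g := fun x => u x ^ 2)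
    (by fun_prop) (by fun_prop) (fun x => abs_mul_le_sq_add_sq _ _)
    (fun x => by rw [abs_of_nonneg (sq_nonneg _)]; nlinarith [sq_nonneg (φ x)])
  rw [Measure.volume_eq_prod, integral_prod _ hint]
  refine integral_congr_ae (Eventually.of_forall fun x => ?_)
  simp only [hartreePotential, mul_div_assoc]
  rw [integral_const_mul]
  ring

/-- The energy is a quartic polynomial in `ε`; only the linear coefficient has to be known for the
first variation. -/
theorem hartreeEnergy_add_smul {u φ : L2} (hu : u ∈ HHalf) (hφ : φ ∈ HHalf) :
    ∃ c₂ c₃ c₄ : ℝ, ∀ ε : ℝ, hartreeEnergy (u + ε • φ) (u + ε • φ) =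
      hartreeEnergy u u + 4 * (∫ x, hartreePotential u x * u x * φ x) * ε +
        c₂ * ε ^ 2 + c₃ * ε ^ 3 + c₄ * ε ^ 4 := by
  have hum := measurable_coeFn u
  have hφm := measurable_coeFn φ
  have b1 : ∀ x, |u x ^ 2| ≤ u x ^ 2 + φ x ^ 2 := fun x => by
    rw [abs_of_nonneg (sq_nonneg _)]; nlinarith [sq_nonneg (φ x)]
  have b2 : ∀ x, |u x * φ x| ≤ u x ^ 2 + φ x ^ 2 := fun x => abs_mul_le_sq_add_sq _ _
  have b3 : ∀ x, |φ x ^ 2| ≤ u x ^ 2 + φ x ^ 2 := fun x => by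
    rw [abs_of_nonneg (sq_nonneg _)]; nlinarith [sq_nonneg (u x)]
  have m1 : Measurable fun x => u x ^ 2 := by fun_prop
  have m2 : Measurable fun x => u x * φ x := by fun_prop
  have m3 : Measurable fun x => φ x ^ 2 := by fun_prop
  have i11 := integrable_coulomb_of_le hu hφ m1 m1 b1 b1
  have i12 := integrable_coulomb_of_le hu hφ m1 m2 b1 b2
  have i21 := integrable_coulomb_of_le hu hφ m2 m1 b2 b1
  have i13 := integrable_coulomb_of_le hu hφ m1 m3 b1 b3
  have i31 := integrable_coulomb_of_le hu hφ m3 m1 b3 b1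
  have i22 := integrable_coulomb_of_le hu hφ m2 m2 b2 b2
  have i23 := integrable_coulomb_of_le hu hφ m2 m3 b2 b3
  have i32 := integrable_coulomb_of_le hu hφ m3 m2 b3 b2
  have i33 := integrable_coulomb_of_le hu hφ m3 m3 b3 b3
  -- The two linear terms, with `uφ` in either variable, agree by symmetry of the kernel; each has
  -- coefficient 2, which gives the factor 4.
  have hswap : ∫ p : R3 × R3, u p.1 ^ 2 * (u p.2 * φ p.2) / ‖p.1 - p.2‖ =
      ∫ x, hartreePotential u x * u x * φ x := by
    rw [← integral_potential_mul hu hφ]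
    have h := integral_prod_swap (μ := (volume : Measure R3)) (ν := (volume : Measure R3))
      (fun p : R3 × R3 => (u p.1 * φ p.1) * u p.2 ^ 2 / ‖p.1 - p.2‖)
    rw [Measure.volume_eq_prod, ← h]
    refine integral_congr_ae (Eventually.of_forall fun p => ?_)
    simp only [Prod.fst_swap, Prod.snd_swap]
    rw [norm_sub_rev, mul_comm]
  set F2 : R3 × R3 → ℝ := fun p => u p.1 ^ 2 * φ p.2 ^ 2 / ‖p.1 - p.2‖ +
    4 * ((u p.1 * φ p.1) * (u p.2 * φ p.2) / ‖p.1 - p.2‖) +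
    φ p.1 ^ 2 * u p.2 ^ 2 / ‖p.1 - p.2‖ with hF2
  set F3 : R3 × R3 → ℝ := fun p => 2 * ((u p.1 * φ p.1) * φ p.2 ^ 2 / ‖p.1 - p.2‖) +
    2 * (φ p.1 ^ 2 * (u p.2 * φ p.2) / ‖p.1 - p.2‖) with hF3
  set F4 : R3 × R3 → ℝ := fun p => φ p.1 ^ 2 * φ p.2 ^ 2 / ‖p.1 - p.2‖ with hF4
  have j2 : Integrable F2 := (i13.add (i22.const_mul 4)).add i31
  have j3 : Integrable F3 := (i23.const_mul 2).add (i32.const_mul 2)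
  refine ⟨∫ p, F2 p, ∫ p, F3 p, ∫ p, F4 p, fun ε => ?_⟩
  have e1 : 4 * (∫ x, hartreePotential u x * u x * φ x) * ε =
      ∫ p : R3 × R3, ((2 * ε) * (u p.1 ^ 2 * (u p.2 * φ p.2) / ‖p.1 - p.2‖) +
        (2 * ε) * ((u p.1 * φ p.1) * u p.2 ^ 2 / ‖p.1 - p.2‖)) := by
    rw [integral_add (i12.const_mul _) (i21.const_mul _), integral_const_mul, integral_const_mul,
      hswap, integral_potential_mul hu hφ]
    ring
  have j1 : Integrable fun p : R3 × R3 => (2 * ε) * (u p.1 ^ 2 * (u p.2 * φ p.2) / ‖p.1 - p.2‖) +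
        (2 * ε) * ((u p.1 * φ p.1) * u p.2 ^ 2 / ‖p.1 - p.2‖) :=
    (i12.const_mul _).add (i21.const_mul _)
  have k2 := j2.mul_const (ε ^ 2)
  have k3 := j3.mul_const (ε ^ 3)
  have k4 := i33.mul_const (ε ^ 4)
  rw [e1, ← integral_mul_const, ← integral_mul_const, ← integral_mul_const]
  unfold hartreeEnergy
  rw [← integral_add i11 j1, ← integral_add (i11.fun_add j1) k2,
    ← integral_add ((i11.fun_add j1).fun_add k2) k3,
    ← integral_add (((i11.fun_add j1).fun_add k2).fun_add k3) k4]
  refine integral_congr_ae ?_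
  have hae : ∀ᵐ x : R3, (u + ε • φ : L2) x = u x + ε * φ x := by
    filter_upwards [Lp.coeFn_add u (ε • φ), Lp.coeFn_smul ε φ] with x h1 h2
    rw [h1, Pi.add_apply, h2, Pi.smul_apply, smul_eq_mul]
  have hfst := (Measure.quasiMeasurePreserving_fst (μ := (volume : Measure R3))
    (ν := (volume : Measure R3))).ae hae
  have hsnd := (Measure.quasiMeasurePreserving_snd (μ := (volume : Measure R3))
    (ν := (volume : Measure R3))).ae hae
  rw [Measure.volume_eq_prod]
  filter_upwards [hfst, hsnd] with p h1 h2
  rw [h1, h2]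
  simp only [hF2, hF3, hF4, div_eq_mul_inv]
  ring

/-- The polynomial `C N(u + εφ)² - D(u + εφ)` is nonnegative and vanishes at `ε = 0`, so its
derivative there is zero. -/
theorem euler_lagrange {C : ℝ} (hle : ∀ u ∈ HHalf, hartreeEnergy u u ≤ C * hNormSq u ^ 2) {u : L2}
    (hu : u ∈ HHalf) (hu1 : hNormSq u = 1) (huC : hartreeEnergy u u = C) {φ : L2}
    (hφ : φ ∈ HHalf) :
    C * (sqrtLaplacianPairing u φ + ∫ x, u x * φ x) = ∫ x, hartreePotential u x * u x * φ x := by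
  obtain ⟨c₂, c₃, c₄, h⟩ := hartreeEnergy_add_smul hu hφ
  set A := sqrtLaplacianPairing u φ + ∫ x, u x * φ x with hA
  set I := ∫ x, hartreePotential u x * u x * φ x with hI
  set P : ℝ → ℝ := fun ε => C * (1 + 2 * ε * A + ε ^ 2 * hNormSq φ) ^ 2 -
    (C + 4 * I * ε + c₂ * ε ^ 2 + c₃ * ε ^ 3 + c₄ * ε ^ 4) with hP
  have hP0 : ∀ ε, 0 ≤ P ε := by
    intro ε
    have h1 := hle _ (HHalf_add hu (HHalf_smul hφ ε))
    rw [h ε, hNormSq_add_smul hu hφ, hu1, huC] at h1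
    simp only [hP]
    linarith
  have hmin : IsLocalMin P 0 := by
    refine Eventually.of_forall fun ε => ?_
    have : P 0 = 0 := by simp [hP]
    rw [this]
    exact hP0 ε
  have hder : HasDerivAt P (4 * C * A - 4 * I) 0 := by
    have hid := hasDerivAt_id' (0 : ℝ)
    have hq : HasDerivAt (fun ε : ℝ => 1 + 2 * ε * A + ε ^ 2 * hNormSq φ) (2 * A) 0 := by
      refine ((((hid.const_mul 2).mul_const A).const_add 1).fun_add
        ((hid.fun_pow 2).mul_const (hNormSq φ))).congr_deriv ?_
      simp
    refine (((hq.fun_pow 2).const_mul C).fun_sub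
      (((((hid.const_mul (4 * I)).const_add C).fun_add ((hid.fun_pow 2).const_mul c₂)).fun_add
        ((hid.fun_pow 3).const_mul c₃)).fun_add ((hid.fun_pow 4).const_mul c₄))).congr_deriv ?_
    simp
    ring
  have := hmin.hasDerivAt_eq_zero hder
  linarith

/-! ### Dilations -/

theorem memLp_dilate (u : L2) {c : ℝ} (hc : 0 < c) :
    MemLp (fun x => Real.sqrt (c ^ 3) * u (c • x)) 2 volume := by
  have hu := measurable_coeFn u
  rw [memLp_two_iff_integrable_sq_norm (Measurable.aestronglyMeasurable (by fun_prop))]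
  have h1 : Integrable fun x => ‖u x‖ ^ 2 :=
    (memLp_two_iff_integrable_sq_norm (Lp.aestronglyMeasurable u)).1 (Lp.memLp u)
  have h2 := (h1.comp_smul hc.ne').const_mul (Real.sqrt (c ^ 3) ^ 2)
  refine h2.congr (Eventually.of_forall fun x => ?_)
  simp only [norm_mul, mul_pow, Real.norm_of_nonneg (Real.sqrt_nonneg _)]

/-- The `L²`-normalized dilation `x ↦ c^{3/2} u(c x)`. -/
def dilate (u : L2) {c : ℝ} (hc : 0 < c) : L2 := (memLp_dilate u hc).toLp

theorem coeFn_dilate (u : L2) {c : ℝ} (hc : 0 < c) :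
    ∀ᵐ x, dilate u hc x = Real.sqrt (c ^ 3) * u (c • x) := (memLp_dilate u hc).coeFn_toLp

theorem density_dilate (u : L2) {c : ℝ} (hc : 0 < c) :
    density (dilate u hc) =ᵐ[volume] fun x => ENNReal.ofReal (c ^ 3) * density u (c • x) := by
  filter_upwards [coeFn_dilate u hc] with x h
  rw [density_eq_ofReal, density_eq_ofReal, h, mul_pow, Real.sq_sqrt (by positivity),
    ENNReal.ofReal_mul (by positivity)]

theorem norm_dilate (u : L2) {c : ℝ} (hc : 0 < c) : ‖dilate u hc‖ ^ 2 = ‖u‖ ^ 2 := by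
  have h := lintegral_density (dilate u hc)
  rw [lintegral_congr_ae (density_dilate u hc), lintegral_const_mul' _ _ ENNReal.ofReal_ne_top,
    lintegral_comp_smul c hc (density u), ← mul_assoc, ← ENNReal.ofReal_mul (by positivity),
    mul_inv_cancel₀ (by positivity), ENNReal.ofReal_one, one_mul, lintegral_density] at h
  exact ((ENNReal.ofReal_eq_ofReal_iff (by positivity) (by positivity)).1 h).symm

theorem hartreeEnergy_dilate (u : L2) {c : ℝ} (hc : 0 < c) :
    hartreeEnergy (dilate u hc) (dilate u hc) = c * hartreeEnergy u u := by
  rw [hartreeEnergy_eq, coulomb_congr (density_dilate u hc) (density_dilate u hc),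
    coulomb_const_mul_left ENNReal.ofReal_ne_top, coulomb_const_mul_right ENNReal.ofReal_ne_top,
    coulomb_comp_smul _ _ hc, hartreeEnergy_eq, ← mul_assoc, ← mul_assoc,
    ← ENNReal.ofReal_mul (by positivity), ← ENNReal.ofReal_mul (by positivity),
    ENNReal.toReal_mul, ENNReal.toReal_ofReal (by positivity)]
  congr 1
  field_simp

theorem gagliardo_dilate (u : L2) {c : ℝ} (hc : 0 < c) :
    gagliardo (dilate u hc) = ENNReal.ofReal c * gagliardo u := by
  rw [gagliardo_congr (coeFn_dilate u hc)]
  unfold gagliardo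
  have h1 : ∀ h : R3, ENNReal.ofReal (‖h‖ ^ 4)⁻¹ *
      ∫⁻ x, ‖Real.sqrt (c ^ 3) * u (c • (x + h)) - Real.sqrt (c ^ 3) * u (c • x)‖ₑ ^ 2 =
      ENNReal.ofReal (c ^ 4) * (ENNReal.ofReal (‖c • h‖ ^ 4)⁻¹ *
        ∫⁻ x, ‖u (x + c • h) - u x‖ₑ ^ 2) := by
    intro h
    have e1 : ∀ x : R3, ‖Real.sqrt (c ^ 3) * u (c • (x + h)) - Real.sqrt (c ^ 3) * u (c • x)‖ₑ ^ 2 =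
        ENNReal.ofReal (c ^ 3) * ‖u (c • x + c • h) - u (c • x)‖ₑ ^ 2 := by
      intro x
      rw [← mul_sub, smul_add, enorm_mul, mul_pow, enorm_sq_eq_ofReal, Real.sq_sqrt (by positivity)]
    simp only [e1]
    rw [lintegral_const_mul' _ _ ENNReal.ofReal_ne_top, lintegral_comp_smul c hc
      (fun x => ‖u (x + c • h) - u x‖ₑ ^ 2), ← mul_assoc (ENNReal.ofReal (c ^ 3)),
      ← ENNReal.ofReal_mul (by positivity), mul_inv_cancel₀ (by positivity), ENNReal.ofReal_one,
      one_mul, ← mul_assoc, ← ENNReal.ofReal_mul (by positivity), norm_smul,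
      Real.norm_of_nonneg hc.le]
    congr 2
    field_simp
  simp only [h1]
  rw [lintegral_const_mul' _ _ ENNReal.ofReal_ne_top, lintegral_comp_smul c hc
    (fun h => ENNReal.ofReal (‖h‖ ^ 4)⁻¹ * ∫⁻ x, ‖u (x + h) - u x‖ₑ ^ 2), ← mul_assoc,
    ← ENNReal.ofReal_mul (by positivity)]
  congr 2
  field_simp

theorem HHalf_dilate {u : L2} (hu : u ∈ HHalf) {c : ℝ} (hc : 0 < c) : dilate u hc ∈ HHalf := by
  rw [mem_HHalf_iff, gagliardo_dilate]
  exact ENNReal.mul_lt_top ENNReal.ofReal_lt_top ((mem_HHalf_iff u).1 hu)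

theorem kinetic_zero_dilate (u : L2) {c : ℝ} (hc : 0 < c) :
    kinetic 0 (dilate u hc) = c * kinetic 0 u := by
  rw [kinetic_zero_eq, kinetic_zero_eq, gagliardo_dilate, ENNReal.toReal_mul,
    ENNReal.toReal_ofReal hc.le]
  ring

/-! ### The sharp inequality -/

/-- A dilation by `c` multiplies `D` and `T` by `c` and preserves the mass, so the bound can be
optimized over `c`. -/
theorem hartreeEnergy_le_of_le_hNormSq {C : ℝ}
    (hle : ∀ u ∈ HHalf, hartreeEnergy u u ≤ C * hNormSq u ^ 2) {u : L2} (hu : u ∈ HHalf) :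
    hartreeEnergy u u ≤ 4 * C * kinetic 0 u * ‖u‖ ^ 2 := by
  have hk := kinetic_nonneg 0 u
  have hn : 0 ≤ ‖u‖ ^ 2 := by positivity
  have hbound := hartreeEnergy_le (u := u) hu
  rcases hk.eq_or_lt with h0 | hT
  · rw [← h0] at hbound ⊢
    simpa using hbound
  rcases hn.eq_or_lt with h0 | hM
  · rw [← h0] at hbound ⊢
    simpa using hbound
  -- This `c` makes the dilated kinetic energy equal to the mass, the case of equality in `(T + M)²
  -- ≥ 4TM`.
  have hc : 0 < ‖u‖ ^ 2 / kinetic 0 u := by positivity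
  have h1 := hle _ (HHalf_dilate hu hc)
  rw [hartreeEnergy_dilate, hNormSq, kinetic_zero_dilate, norm_dilate] at h1
  have e : ‖u‖ ^ 2 / kinetic 0 u * kinetic 0 u = ‖u‖ ^ 2 := by field_simp
  rw [e, div_mul_eq_mul_div, div_le_iff₀ hT] at h1
  refine le_of_mul_le_mul_left ?_ hM
  calc _ ≤ _ := h1
    _ = _ := by ring

theorem sqrtLaplacianPairing_self (u : L2) : sqrtLaplacianPairing u u = kinetic 0 u := by
  rw [kinetic_zero_eq_integral, sqrtLaplacianPairing]
  congr 1
  ext ξ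
  rw [Complex.mul_conj, Complex.ofReal_re, Complex.normSq_eq_norm_sq]

theorem integral_potential_mul_self {u : L2} (hu : u ∈ HHalf) :
    ∫ x, hartreePotential u x * u x * u x = hartreeEnergy u u := by
  rw [← integral_potential_mul hu hu, hartreeEnergy]
  simp only [sq]

theorem sqrtLaplacianPairing_smul_left (c : ℝ) (u φ : L2) :
    sqrtLaplacianPairing (c • u) φ = c * sqrtLaplacianPairing u φ := by
  unfold sqrtLaplacianPairing
  rw [← integral_const_mul]
  refine integral_congr_ae ?_
  filter_upwards [fourierL2_smul c u] with ξ h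
  rw [h, mul_assoc (c : ℂ), Complex.re_ofReal_mul]
  ring

theorem hartreePotential_smul (c : ℝ) (u : L2) (x : R3) :
    hartreePotential (c • u) x = c ^ 2 * hartreePotential u x := by
  unfold hartreePotential
  rw [← integral_const_mul]
  refine integral_congr_ae ?_
  filter_upwards [Lp.coeFn_smul c u] with y h
  rw [h, Pi.smul_apply, smul_eq_mul]
  ring

/-- Multiplying by `γ` scales the linear side by `γ` and the cubic side by `γ³`, so `γ² = 1/C`
removes the Lagrange factor `C`. -/
theorem isWeakSolution_smul_of_optimizer {C : ℝ} (hC : 0 < C)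
    (hle : ∀ u ∈ HHalf, hartreeEnergy u u ≤ C * hNormSq u ^ 2) {u : L2}
    (hu : u ∈ HHalf) (hu1 : hNormSq u = 1) (huC : hartreeEnergy u u = C) :
    IsWeakSolution ((Real.sqrt C)⁻¹ • u) := by
  refine ⟨HHalf_smul hu _, fun φ hφ => ?_⟩
  have h := euler_lagrange hle hu hu1 huC hφ
  set γ := (Real.sqrt C)⁻¹ with hγ
  have hγC : γ ^ 2 * C = 1 := by
    rw [hγ, inv_pow, Real.sq_sqrt hC.le, inv_mul_cancel₀ hC.ne']
  have h1 : ∫ x, (γ • u : L2) x * φ x = γ * ∫ x, u x * φ x := by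
    rw [← integral_const_mul]
    refine integral_congr_ae ?_
    filter_upwards [Lp.coeFn_smul γ u] with x hx
    rw [hx, Pi.smul_apply, smul_eq_mul]
    ring
  have h2 : ∫ x, hartreePotential (γ • u) x * (γ • u : L2) x * φ x =
      γ ^ 3 * ∫ x, hartreePotential u x * u x * φ x := by
    rw [← integral_const_mul]
    refine integral_congr_ae ?_
    filter_upwards [Lp.coeFn_smul γ u] with x hx
    rw [hx, Pi.smul_apply, smul_eq_mul, hartreePotential_smul]
    ring
  rw [sqrtLaplacianPairing_smul_left, h1, h2, ← h]
  linear_combination (-γ * (sqrtLaplacianPairing u φ + ∫ x, u x * φ x)) * hγC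

theorem action_eq (u : L2) : action u = 1 / 2 * hNormSq u - 1 / 4 * hartreeEnergy u u := by
  rw [action, integral_sq_eq, hNormSq]
  ring

/-- The equation is tested with the solution itself; the action of a solution is then a quarter of
its `hNormSq`. -/
theorem hNormSq_eq_of_isWeakSolution {u : L2} (hu : IsWeakSolution u) :
    hNormSq u = hartreeEnergy u u := by
  have h := hu.2 u hu.1
  rw [sqrtLaplacianPairing_self, integral_potential_mul_self hu.1, ← inner_eq_integral,
    real_inner_self_eq_norm_sq] at h
  exact h

/-- The sharp Gagliardo–Nirenberg inequality, with the constant given by a ground state, together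
with the values of the functionals at the ground state. -/
theorem IsGroundState.sharp {Q : L2} (hQ : IsGroundState Q) :
    0 < ‖Q‖ ^ 2 ∧ kinetic 0 Q = ‖Q‖ ^ 2 ∧ hartreeEnergy Q Q = 2 * ‖Q‖ ^ 2 ∧
      ∀ u ∈ HHalf, ‖Q‖ ^ 2 * hartreeEnergy u u ≤ 2 * kinetic 0 u * ‖u‖ ^ 2 := by
  obtain ⟨hsol, hQ0, hmin⟩ := hQ
  have hN := hNormSq_eq_of_isWeakSolution hsol
  have hNpos := hNormSq_pos hQ0
  obtain ⟨C, hC, hle, u, hu, hu1, huC⟩ := exists_optimizer ⟨Q, hsol.1, hN ▸ hNpos⟩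
  have hγC : (Real.sqrt C)⁻¹ ^ 2 * C = 1 := by
    rw [inv_pow, Real.sq_sqrt hC.le, inv_mul_cancel₀ hC.ne']
  have hw0 : (Real.sqrt C)⁻¹ • u ≠ 0 := by
    refine smul_ne_zero (inv_ne_zero (Real.sqrt_ne_zero'.2 hC)) ?_
    rintro rfl
    have : hNormSq (0 : L2) = 0 := by
      have := hNormSq_smul 0 (0 : L2)
      simpa using this
    linarith
  -- The rescaled optimizer has action `1/(4C)` and `Q` has action `N(Q)/4`, so minimality gives
  -- `N(Q) C ≤ 1`. The inequality `N(Q) = D(Q,Q) ≤ C N(Q)²` gives the converse.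
  have hact := hmin _ (isWeakSolution_smul_of_optimizer hC hle hu hu1 huC) hw0
  rw [action_eq, action_eq, hartreeEnergy_smul, hNormSq_smul, hu1, huC, ← hN] at hact
  have hle' : hNormSq Q * C ≤ 1 := by
    have e : (Real.sqrt C)⁻¹ ^ 2 = 1 / C := by rw [eq_div_iff hC.ne', hγC]
    rw [e] at hact
    have e2 : 1 / 2 * (1 / C * 1) - 1 / 4 * (1 / C * (1 / C) * C) = 1 / 4 * (1 / C) := by
      field_simp; norm_num
    rw [e2] at hact
    rw [← le_div_iff₀ hC]
    linarith
  have hge := hle Q hsol.1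
  rw [← hN] at hge
  have hQC : hNormSq Q * C = 1 := by nlinarith
  have hsharp := hartreeEnergy_le_of_le_hNormSq hle hsol.1
  rw [← hN] at hsharp
  have hM : 0 < ‖Q‖ ^ 2 := pow_pos (norm_pos_iff.2 hQ0) 2
  have hsum : kinetic 0 Q + ‖Q‖ ^ 2 = hNormSq Q := rfl
  -- Since `Q` is optimal for `D/N²`, the product form gives `(T + M)² ≤ 4TM` with `M = ‖Q‖²`, that
  -- is, `(T - M)² ≤ 0`.
  have hTM : kinetic 0 Q = ‖Q‖ ^ 2 := by
    have h1 : hNormSq Q ^ 2 ≤ 4 * kinetic 0 Q * ‖Q‖ ^ 2 := by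
      have h2 : C * hNormSq Q ^ 2 ≤ C * (4 * kinetic 0 Q * ‖Q‖ ^ 2) := by
        calc C * hNormSq Q ^ 2 = hNormSq Q * C * hNormSq Q := by ring
          _ = hNormSq Q := by rw [hQC, one_mul]
          _ ≤ _ := hsharp
          _ = _ := by ring
      exact le_of_mul_le_mul_left h2 hC
    rw [← hsum] at h1
    have h3 : (kinetic 0 Q - ‖Q‖ ^ 2) ^ 2 ≤ 0 := by nlinarith
    have h4 := pow_eq_zero_iff (two_ne_zero) |>.1 (le_antisymm h3 (sq_nonneg _))
    linarith
  refine ⟨hM, hTM, by rw [← hN, ← hsum, hTM]; ring, fun v hv => ?_⟩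
  have h1 := hartreeEnergy_le_of_le_hNormSq hle hv
  have h2 : 2 * (‖Q‖ ^ 2 * C) = 1 := by rw [← hQC, ← hsum, hTM]; ring
  calc ‖Q‖ ^ 2 * hartreeEnergy v v ≤ ‖Q‖ ^ 2 * (4 * C * kinetic 0 v * ‖v‖ ^ 2) := by gcongr
    _ = 2 * (2 * (‖Q‖ ^ 2 * C)) * kinetic 0 v * ‖v‖ ^ 2 := by ring
    _ = _ := by rw [h2]; ring

/-! ### Cutoffs -/

/-- A Lipschitz cutoff function equal to `1` for `|x| ≤ R` and to `0` for `|x| ≥ 2R`. -/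
def cutoff (R : ℝ) (x : R3) : ℝ := max 0 (min 1 (2 - ‖x‖ / R))

theorem cutoff_nonneg (R : ℝ) (x : R3) : 0 ≤ cutoff R x := le_max_left _ _

theorem cutoff_le_one (R : ℝ) (x : R3) : cutoff R x ≤ 1 := by
  unfold cutoff
  exact max_le zero_le_one (min_le_left _ _)

theorem cutoff_eq_one {R : ℝ} (hR : 0 < R) {x : R3} (hx : ‖x‖ ≤ R) : cutoff R x = 1 := by
  have : ‖x‖ / R ≤ 1 := (div_le_one hR).2 hx
  unfold cutoff
  rw [min_eq_left (by linarith), max_eq_right zero_le_one]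

theorem cutoff_eq_zero {R : ℝ} (hR : 0 < R) {x : R3} (hx : 2 * R ≤ ‖x‖) : cutoff R x = 0 := by
  have : 2 ≤ ‖x‖ / R := (le_div_iff₀ hR).2 hx
  unfold cutoff
  rw [min_eq_right (by linarith), max_eq_left (by linarith)]

theorem measurable_cutoff (R : ℝ) : Measurable (cutoff R) := by
  unfold cutoff; fun_prop

theorem abs_cutoff_sub_le {R : ℝ} (hR : 0 < R) (x y : R3) :
    |cutoff R x - cutoff R y| ≤ ‖x - y‖ / R := by
  unfold cutoff
  calc _ ≤ |min 1 (2 - ‖x‖ / R) - min 1 (2 - ‖y‖ / R)| := by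
        simpa using abs_max_sub_max_le_max 0 (min 1 (2 - ‖x‖ / R)) 0 (min 1 (2 - ‖y‖ / R))
    _ ≤ |(2 - ‖x‖ / R) - (2 - ‖y‖ / R)| := by
        simpa using abs_min_sub_min_le_max 1 (2 - ‖x‖ / R) 1 (2 - ‖y‖ / R)
    _ = |‖x‖ - ‖y‖| / R := by
        rw [abs_sub_comm, sub_sub_sub_cancel_left, ← sub_div, abs_div, abs_of_pos hR]
    _ ≤ _ := by
        gcongr
        exact abs_norm_sub_norm_le x y

theorem cutoff_sub_sq_le {R : ℝ} (hR : 0 < R) (x y : R3) :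
    (cutoff R x - cutoff R y) ^ 2 ≤ min (‖R⁻¹ • (x - y)‖ ^ 2) 1 := by
  refine le_min ?_ ?_
  · rw [norm_smul, Real.norm_of_nonneg (by positivity), ← sq_abs]
    gcongr
    rw [inv_mul_eq_div]
    exact abs_cutoff_sub_le hR x y
  · rw [sq_le_one_iff_abs_le_one, abs_le]
    have := cutoff_nonneg R x
    have := cutoff_le_one R x
    have := cutoff_nonneg R y
    have := cutoff_le_one R y
    constructor <;> linarith

theorem lintegral_min_smul {R : ℝ} (hR : 0 < R) :
    ∫⁻ h : R3, ENNReal.ofReal (‖h‖ ^ 4)⁻¹ * ENNReal.ofReal (min (‖R⁻¹ • h‖ ^ 2) 1) =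
      ENNReal.ofReal R⁻¹ * cutoffConst := by
  have hRi : 0 < R⁻¹ := inv_pos.2 hR
  have h1 := lintegral_comp_smul R⁻¹ hRi
    (fun h => ENNReal.ofReal (R⁻¹ ^ 4) * ENNReal.ofReal ((‖h‖ ^ 4)⁻¹ * min (‖h‖ ^ 2) 1))
  rw [lintegral_const_mul' _ (fun h : R3 => ENNReal.ofReal ((‖h‖ ^ 4)⁻¹ * min (‖h‖ ^ 2) 1))
    ENNReal.ofReal_ne_top, ← mul_assoc, ← ENNReal.ofReal_mul (by positivity)] at h1
  unfold cutoffConst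
  convert h1 using 1
  · refine lintegral_congr fun h => ?_
    rw [← ENNReal.ofReal_mul (by positivity), ← ENNReal.ofReal_mul (by positivity)]
    congr 1
    rw [norm_smul, Real.norm_of_nonneg hRi.le]
    field_simp
  · congr 2
    field_simp

theorem sq_add_le_mul (a b : ℝ) {s : ℝ} (hs : 0 < s) :
    (a + b) ^ 2 ≤ (1 + s) * a ^ 2 + (1 + s⁻¹) * b ^ 2 := by
  have h : (1 + s) * a ^ 2 + (1 + s⁻¹) * b ^ 2 - (a + b) ^ 2 = s⁻¹ * (s * a - b) ^ 2 := by
    field_simp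
    ring
  have : 0 ≤ s⁻¹ * (s * a - b) ^ 2 := by positivity
  linarith

/-- The increment of the product is split into an increment of `f` and one of the cutoff. The
weighted square inequality keeps the first constant at `1 + s`, as close to 1 as desired, and puts
the loss on the cutoff term, which is `O(1/R)` by scaling. -/
theorem gagliardo_cutoff_le {f : R3 → ℝ} (hf : Measurable f) {R s : ℝ} (hR : 0 < R) (hs : 0 < s) :
    gagliardo (fun x => cutoff R x * f x) ≤ ENNReal.ofReal (1 + s) * gagliardo f +
      ENNReal.ofReal (1 + s⁻¹) * (ENNReal.ofReal R⁻¹ * cutoffConst * ∫⁻ x, density f x) := by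
  have hpt : ∀ h x : R3, ‖cutoff R (x + h) * f (x + h) - cutoff R x * f x‖ₑ ^ 2 ≤
      ENNReal.ofReal (1 + s) * ‖f (x + h) - f x‖ₑ ^ 2 +
      ENNReal.ofReal (1 + s⁻¹) * (ENNReal.ofReal (min (‖R⁻¹ • h‖ ^ 2) 1) * density f x) := by
    intro h x
    rw [density_eq_ofReal, enorm_sq_eq_ofReal, enorm_sq_eq_ofReal,
      ← ENNReal.ofReal_mul (by positivity), ← ENNReal.ofReal_mul (by positivity),
      ← ENNReal.ofReal_mul (by positivity), ← ENNReal.ofReal_add (by positivity) (by positivity)]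
    refine ENNReal.ofReal_le_ofReal ?_
    have e : cutoff R (x + h) * f (x + h) - cutoff R x * f x =
        cutoff R (x + h) * (f (x + h) - f x) + (cutoff R (x + h) - cutoff R x) * f x := by ring
    rw [e]
    refine (sq_add_le_mul _ _ hs).trans ?_
    rw [mul_pow, mul_pow]
    have h1 := cutoff_sub_sq_le hR (x + h) x
    rw [add_sub_cancel_left] at h1
    have h2 : cutoff R (x + h) ^ 2 ≤ 1 := pow_le_one₀ (cutoff_nonneg _ _) (cutoff_le_one _ _)
    gcongr
    exact mul_le_of_le_one_left (sq_nonneg _) h2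
  have hm := measurable_density hf
  calc gagliardo (fun x => cutoff R x * f x)
      ≤ ∫⁻ h : R3, (ENNReal.ofReal (1 + s) * (ENNReal.ofReal (‖h‖ ^ 4)⁻¹ *
          ∫⁻ x, ‖f (x + h) - f x‖ₑ ^ 2) + ENNReal.ofReal (1 + s⁻¹) * ((ENNReal.ofReal (‖h‖ ^ 4)⁻¹ *
          ENNReal.ofReal (min (‖R⁻¹ • h‖ ^ 2) 1)) * ∫⁻ x, density f x)) := by
        refine lintegral_mono fun h => ?_
        simp only
        refine (mul_le_mul' le_rfl (lintegral_mono (hpt h))).trans (le_of_eq ?_)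
        rw [lintegral_add_left (by fun_prop), lintegral_const_mul' _ _ ENNReal.ofReal_ne_top,
          lintegral_const_mul' _ _ ENNReal.ofReal_ne_top,
          lintegral_const_mul' _ _ ENNReal.ofReal_ne_top]
        ring
    _ = _ := by
        rw [lintegral_add_left, lintegral_const_mul' _ _ ENNReal.ofReal_ne_top,
          lintegral_const_mul' _ _ ENNReal.ofReal_ne_top, lintegral_mul_const _ (by fun_prop),
          lintegral_min_smul hR, gagliardo]
        have : Measurable fun h : R3 => ∫⁻ x, ‖f (x + h) - f x‖ₑ ^ 2 :=
          Measurable.lintegral_prod_right (by fun_prop)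
        fun_prop

theorem memLp_cutoff (R : ℝ) (u : L2) : MemLp (fun x => cutoff R x * u x) 2 volume := by
  refine (Lp.memLp u).of_le_mul (c := 1) ?_ (Eventually.of_forall fun x => ?_)
  · exact (measurable_cutoff R).aestronglyMeasurable.mul (Lp.aestronglyMeasurable u)
  · rw [norm_mul, Real.norm_of_nonneg (cutoff_nonneg R x)]
    exact mul_le_mul_of_nonneg_right (cutoff_le_one R x) (norm_nonneg _)

/-- The product of an `L²` function with a cutoff. -/
def cutoffLp (R : ℝ) (u : L2) : L2 := (memLp_cutoff R u).toLp

theorem coeFn_cutoffLp (R : ℝ) (u : L2) : ∀ᵐ x, cutoffLp R u x = cutoff R x * u x :=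
  (memLp_cutoff R u).coeFn_toLp

theorem density_cutoffLp_le (R : ℝ) (u : L2) : ∀ᵐ x, density (cutoffLp R u) x ≤ density u x := by
  filter_upwards [coeFn_cutoffLp R u] with x h
  rw [density_eq_ofReal, density_eq_ofReal, h, mul_pow]
  refine ENNReal.ofReal_le_ofReal ?_
  exact mul_le_of_le_one_left (sq_nonneg _)
    (pow_le_one₀ (cutoff_nonneg _ _) (cutoff_le_one _ _))

theorem norm_cutoffLp_sq_le (R : ℝ) (u : L2) : ‖cutoffLp R u‖ ^ 2 ≤ ‖u‖ ^ 2 := by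
  have h := lintegral_mono_ae (density_cutoffLp_le R u)
  rwa [lintegral_density, lintegral_density, ENNReal.ofReal_le_ofReal_iff (by positivity)] at h

theorem gagliardo_cutoffLp_le (u : L2) {R s : ℝ} (hR : 0 < R) (hs : 0 < s) :
    gagliardo (cutoffLp R u) ≤ ENNReal.ofReal (1 + s) * gagliardo u +
      ENNReal.ofReal (1 + s⁻¹) * (ENNReal.ofReal R⁻¹ * cutoffConst * ENNReal.ofReal (‖u‖ ^ 2)) := by
  rw [gagliardo_congr (coeFn_cutoffLp R u), ← lintegral_density]
  exact gagliardo_cutoff_le (measurable_coeFn u) hR hs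

theorem HHalf_cutoffLp {u : L2} (hu : u ∈ HHalf) {R : ℝ} (hR : 0 < R) : cutoffLp R u ∈ HHalf := by
  rw [mem_HHalf_iff]
  refine (gagliardo_cutoffLp_le u hR one_pos).trans_lt ?_
  have h1 := (mem_HHalf_iff u).1 hu
  have h2 := cutoffConst_lt_top
  finiteness

theorem kinetic_zero_cutoffLp_le {u : L2} (hu : u ∈ HHalf) {R s : ℝ} (hR : 0 < R) (hs : 0 < s) :
    kinetic 0 (cutoffLp R u) ≤ (1 + s) * kinetic 0 u +
      kineticConst * (1 + s⁻¹) * cutoffConst.toReal * ‖u‖ ^ 2 * R⁻¹ := by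
  have hk := kineticConst_pos
  have h1 := ((mem_HHalf_iff u).1 hu).ne
  have h2 := cutoffConst_lt_top.ne
  have h := ENNReal.toReal_mono (by finiteness) (gagliardo_cutoffLp_le u hR hs)
  rw [ENNReal.toReal_add (by finiteness) (by finiteness), ENNReal.toReal_mul, ENNReal.toReal_mul,
    ENNReal.toReal_mul, ENNReal.toReal_mul, ENNReal.toReal_ofReal (by positivity),
    ENNReal.toReal_ofReal (by positivity), ENNReal.toReal_ofReal (by positivity),
    ENNReal.toReal_ofReal (by positivity)] at h
  rw [kinetic_zero_eq, kinetic_zero_eq]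
  calc _ ≤ _ := mul_le_mul_of_nonneg_left h hk.le
    _ = _ := by ring

/-- The density of `u` is at most that of the truncation plus its own tail; each of the two slots
produces one tail term, bounded by Hardy. -/
theorem coulomb_le_coulomb_cutoffLp (u : L2) {R : ℝ} (hR : 0 < R) :
    coulomb (density u) (density u) ≤ coulomb (density (cutoffLp R u)) (density (cutoffLp R u)) +
      2 * (ENNReal.ofReal hardyConst * gagliardo u *
        ∫⁻ x in (Metric.ball (0 : R3) R)ᶜ, density u x) := by
  have hum := measurable_density (measurable_coeFn u)
  set a := density (cutoffLp R u) with ha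
  have ham : Measurable a := measurable_density (measurable_coeFn _)
  set s := (Metric.ball (0 : R3) R)ᶜ with hs
  have hsm : MeasurableSet s := measurableSet_ball.compl
  set b := s.indicator (density u) with hb
  have hbm : Measurable b := hum.indicator hsm
  have hle : ∀ᵐ x, density u x ≤ a x + b x := by
    filter_upwards [coeFn_cutoffLp R u] with x hx
    by_cases hxs : x ∈ s
    · rw [hb, Set.indicator_of_mem hxs]
      exact le_add_self
    · have hxR : ‖x‖ < R := by simpa [hs] using hxs
      rw [ha, density_eq_ofReal (cutoffLp R u), hx, cutoff_eq_one hR hxR.le, one_mul,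
        ← density_eq_ofReal]
      exact le_self_add
  have hbu : coulomb b (density u) ≤ ENNReal.ofReal hardyConst * gagliardo u *
      ∫⁻ x in s, density u x := by
    rw [← lintegral_indicator hsm]
    exact coulomb_density_le hbm (measurable_coeFn u)
      (by rw [lintegral_density]; exact ENNReal.ofReal_lt_top)
  calc coulomb (density u) (density u) ≤ coulomb (fun x => a x + b x) (density u) :=
        coulomb_mono hle (Eventually.of_forall fun x => le_rfl)
    _ = coulomb a (density u) + coulomb b (density u) := coulomb_add_left ham hum
    _ ≤ coulomb a (fun x => a x + b x) + coulomb b (density u) := by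
        gcongr
        exact coulomb_mono (Eventually.of_forall fun x => le_rfl) hle
    _ = coulomb a a + coulomb b a + coulomb b (density u) := by
        rw [coulomb_add_right ham ham, coulomb_comm ham hbm]
    _ ≤ coulomb a a + coulomb b (density u) + coulomb b (density u) := by
        gcongr
        exact coulomb_mono (Eventually.of_forall fun x => le_rfl) (density_cutoffLp_le R u)
    _ ≤ _ := by
        rw [add_assoc, two_mul]
        gcongr

theorem tendsto_hartreeEnergy_cutoffLp {u : L2} (hu : u ∈ HHalf) {ε : ℝ} (hε : 0 < ε) :
    ∀ᶠ R in atTop, hartreeEnergy u u - ε ≤ hartreeEnergy (cutoffLp R u) (cutoffLp R u) := by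
  have hum := measurable_density (measurable_coeFn u)
  have hG := ((mem_HHalf_iff u).1 hu).ne
  set K := 2 * (ENNReal.ofReal hardyConst * gagliardo u) with hK
  have hKfin : K ≠ ∞ := by simp only [hK]; finiteness
  obtain ⟨δ, hδ, hδε⟩ : ∃ δ : ℝ≥0∞, 0 < δ ∧ K * δ ≤ ENNReal.ofReal ε := by
    have h1 : Tendsto (fun δ : ℝ≥0∞ => K * δ) (nhdsWithin 0 (Set.Ioi 0)) (nhds (K * 0)) :=
      (ENNReal.Tendsto.const_mul tendsto_id (Or.inr hKfin)).mono_left nhdsWithin_le_nhds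
    rw [mul_zero] at h1
    obtain ⟨δ, h2, h3⟩ := ((h1.eventually_le_const (ENNReal.ofReal_pos.2 hε)).and
      self_mem_nhdsWithin).exists
    exact ⟨δ, h3, h2⟩
  obtain ⟨R₀, hR₀, hR⟩ := exists_lintegral_compl_ball_le hum
    (by rw [lintegral_density]; exact ENNReal.ofReal_ne_top) hδ
  filter_upwards [eventually_ge_atTop R₀] with R hRR
  have hRpos : 0 < R := hR₀.trans_le hRR
  have h1 := coulomb_le_coulomb_cutoffLp u hRpos
  have h2 : 2 * (ENNReal.ofReal hardyConst * gagliardo u *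
      ∫⁻ x in (Metric.ball (0 : R3) R)ᶜ, density u x) ≤ ENNReal.ofReal ε := by
    have h0 : ∫⁻ x in (Metric.ball (0 : R3) R)ᶜ, density u x ≤ δ :=
      (lintegral_mono_set (Set.compl_subset_compl.2 (Metric.ball_subset_ball hRR))).trans hR
    refine le_trans (le_of_eq_of_le ?_ (mul_le_mul' (le_refl K) h0)) hδε
    rw [hK, ← mul_assoc]
  have hfin := (coulomb_lt_top (u := cutoffLp R u) (HHalf_cutoffLp hu hRpos)).ne
  have h3 := ENNReal.toReal_mono (by finiteness) (h1.trans (add_le_add le_rfl h2))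
  rw [ENNReal.toReal_add hfin ENNReal.ofReal_ne_top, ENNReal.toReal_ofReal hε.le,
    ← hartreeEnergy_eq, ← hartreeEnergy_eq] at h3
  linarith

/-- Compactly supported normalized functions that are almost optimal. -/
theorem IsGroundState.exists_test {Q : L2} (hQ : IsGroundState Q) {κ : ℝ} (hκ : ‖Q‖ ^ 2 / 2 < κ) :
    ∃ φ ∈ HHalf, ‖φ‖ = 1 ∧ (∃ ρ > 0, ∀ᵐ x, ρ ≤ ‖x‖ → φ x = 0) ∧
      kinetic 0 φ < κ * hartreeEnergy φ φ := by
  obtain ⟨hM, hT, hD, -⟩ := hQ.sharp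
  have hQH := hQ.1.1
  set A := ‖Q‖ ^ 2 with hA
  have hκ0 : 0 < κ := by linarith
  -- The excess `d` over the critical coupling is distributed: `s` and large `R` each cost at most
  -- `d/4` in the kinetic energy, and `ε` costs `A d/4` in `κ D`. Hence `T(q) < A + d/2` while `κ
  -- D(q,q) ≥ A(A + 3d/4)`.
  set d := 2 * κ - A with hd
  have hd0 : 0 < d := by linarith
  set s := d / (4 * A) with hs
  have hs0 : 0 < s := by positivity
  set ε := A * d / (4 * κ) with hε
  have hε0 : 0 < ε := by positivity
  have h1 : Tendsto (fun R : ℝ => kineticConst * (1 + s⁻¹) * cutoffConst.toReal * A * R⁻¹) atTop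
      (nhds (kineticConst * (1 + s⁻¹) * cutoffConst.toReal * A * 0)) :=
    tendsto_inv_atTop_zero.const_mul _
  rw [mul_zero] at h1
  obtain ⟨R, ⟨hR1, hR2⟩, hR0⟩ := (((h1.eventually_lt_const (half_pos (half_pos hd0))).and
    (tendsto_hartreeEnergy_cutoffLp hQH hε0)).and (eventually_gt_atTop 0)).exists
  have hkin := kinetic_zero_cutoffLp_le hQH hR0 hs0
  have hn := norm_cutoffLp_sq_le R Q
  have hH := HHalf_cutoffLp hQH hR0
  have hsupp : ∀ᵐ x, 2 * R ≤ ‖x‖ → cutoffLp R Q x = 0 := by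
    filter_upwards [coeFn_cutoffLp R Q] with x hx hxR
    rw [hx, cutoff_eq_zero hR0 hxR, zero_mul]
  set q := cutoffLp R Q with hq
  have hsA : s * A = d / 4 := by rw [hs]; field_simp
  have hkin' : kinetic 0 q < A + d / 2 := by
    rw [hT] at hkin
    have : (1 + s) * A = A + d / 4 := by rw [← hsA]; ring
    linarith
  have hκε : κ * ε = A * d / 4 := by rw [hε]; field_simp
  have hDq : A * (A + 3 * d / 4) ≤ κ * hartreeEnergy q q := by
    have h2 : κ * (hartreeEnergy Q Q - ε) ≤ κ * hartreeEnergy q q := by gcongr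
    rw [hD, mul_sub, hκε] at h2
    have : κ = (A + d) / 2 := by rw [hd]; ring
    nlinarith
  -- `T‖q‖²` and `D` both have degree four, so this form of the inequality survives the
  -- normalization of `q`.
  have hTM : kinetic 0 q * ‖q‖ ^ 2 < κ * hartreeEnergy q q := by
    have h3 := kinetic_nonneg 0 q
    calc kinetic 0 q * ‖q‖ ^ 2 ≤ kinetic 0 q * A := by gcongr
      _ < A * (A + 3 * d / 4) := by nlinarith
      _ ≤ _ := hDq
  have hq0 : q ≠ 0 := by
    intro h0
    have h4 := hartreeEnergy_smul 0 0 (0 : L2) 0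
    rw [smul_zero] at h4
    rw [h0] at hDq
    have h5 : hartreeEnergy (0 : L2) 0 = 0 := by rw [h4]; ring
    rw [h5, mul_zero] at hDq
    have : 0 < A * (A + 3 * d / 4) := by positivity
    linarith
  have hqn : 0 < ‖q‖ := norm_pos_iff.2 hq0
  refine ⟨‖q‖⁻¹ • q, HHalf_smul hH _, ?_, ⟨2 * R, by positivity, ?_⟩, ?_⟩
  · rw [norm_smul, norm_inv, norm_norm, inv_mul_cancel₀ hqn.ne']
  · filter_upwards [hsupp, Lp.coeFn_smul ‖q‖⁻¹ q] with x h1 h2 h3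
    rw [h2, Pi.smul_apply, h1 h3, smul_zero]
  · rw [kinetic_smul, hartreeEnergy_smul]
    have e : κ * (‖q‖⁻¹ ^ 2 * ‖q‖⁻¹ ^ 2 * hartreeEnergy q q) =
        ‖q‖⁻¹ ^ 2 * (κ * hartreeEnergy q q / ‖q‖ ^ 2) := by
      field_simp
    rw [e]
    refine mul_lt_mul_of_pos_left ?_ (by positivity)
    rwa [lt_div_iff₀ (by positivity)]

/-! ### Trapping potentials -/

theorem IsTrapping.nonneg {V : R3 → ℝ} (hV : IsTrapping V) (x : R3) : 0 ≤ V x :=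
  hV.inf_eq.1 (Set.mem_range_self x)

/-- Local boundedness includes measurability on each compact set, and countably many closed balls
exhaust the space. -/
theorem IsTrapping.aestronglyMeasurable {V : R3 → ℝ} (hV : IsTrapping V) :
    AEStronglyMeasurable V volume := by
  have h : ∀ n : ℕ, AEStronglyMeasurable V (volume.restrict (Metric.closedBall (0 : R3) n)) :=
    fun n => (hV.locBdd _ (isCompact_closedBall 0 (n : ℝ))).aestronglyMeasurable
  have h2 := aestronglyMeasurable_iUnion_iff.2 h
  rwa [Metric.iUnion_closedBall_nat, Measure.restrict_univ] at h2

theorem IsTrapping.exists_bound {V : R3 → ℝ} (hV : IsTrapping V) (ρ : ℝ) :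
    ∃ B : ℝ, 0 ≤ B ∧ ∀ᵐ x, ‖x‖ ≤ ρ → V x ≤ B := by
  have h := hV.locBdd _ (isCompact_closedBall 0 ρ)
  have h1 := h.2
  rw [eLpNorm_exponent_top] at h1
  have h2 := ae_le_eLpNormEssSup (f := V) (μ := volume.restrict (Metric.closedBall (0 : R3) ρ))
  rw [ae_restrict_iff' Metric.isClosed_closedBall.measurableSet] at h2
  refine ⟨(eLpNormEssSup V (volume.restrict (Metric.closedBall (0 : R3) ρ))).toReal,
    ENNReal.toReal_nonneg, ?_⟩
  filter_upwards [h2] with x hx hxρ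
  have h3 := hx (by simpa using hxρ)
  have h4 := ENNReal.toReal_mono h1.ne h3
  rw [toReal_enorm, Real.norm_of_nonneg (hV.nonneg x)] at h4
  exact h4

theorem IsTrapping.integrable_of_support {V : R3 → ℝ} (hV : IsTrapping V) {ρ B : ℝ}
    (hB : ∀ᵐ x, ‖x‖ ≤ ρ → V x ≤ B) {u : L2} (hu : ∀ᵐ x, ρ ≤ ‖x‖ → u x = 0) :
    Integrable (fun x => V x * u x ^ 2) ∧ ∫ x, V x * u x ^ 2 ≤ B * ‖u‖ ^ 2 := by
  have hum := measurable_coeFn u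
  have hint : Integrable fun x => u x ^ 2 := (Lp.memLp u).integrable_sq
  have hle : ∀ᵐ x, V x * u x ^ 2 ≤ B * u x ^ 2 := by
    filter_upwards [hB, hu] with x h1 h2
    rcases le_total ρ ‖x‖ with h | h
    · rw [h2 h]; simp
    · exact mul_le_mul_of_nonneg_right (h1 h) (sq_nonneg _)
  have hI : Integrable fun x => V x * u x ^ 2 := by
    refine Integrable.mono' (hint.const_mul B) ?_ ?_
    · exact hV.aestronglyMeasurable.mul (Measurable.aestronglyMeasurable (by fun_prop))
    · filter_upwards [hle] with x hx
      rwa [Real.norm_of_nonneg (mul_nonneg (hV.nonneg x) (sq_nonneg _))]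
  refine ⟨hI, ?_⟩
  rw [← integral_sq_eq, ← integral_const_mul]
  exact integral_mono_ae hI (hint.const_mul B) hle

/-- For `c ≥ 1` dilation contracts the support, so one bound on the potential over a fixed ball
serves all dilates. -/
theorem dilate_support {u : L2} {ρ : ℝ} (hu : ∀ᵐ x, ρ ≤ ‖x‖ → u x = 0) {c : ℝ} (hc : 0 < c)
    (hc1 : 1 ≤ c) : ∀ᵐ x, ρ ≤ ‖x‖ → dilate u hc x = 0 := by
  have h := (Measure.quasiMeasurePreserving_smul (volume : Measure R3)
    hc.ne').ae hu
  filter_upwards [coeFn_dilate u hc, h] with x h1 h2 h3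
  have h4 : ρ ≤ ‖c • x‖ := by
    rw [norm_smul, Real.norm_of_nonneg hc.le]
    nlinarith [norm_nonneg x]
  have h5 : u (c • x) = 0 := h2 h4
  rw [h1, h5, mul_zero]

/-! ### Comparison of the kinetic energies -/

theorem sqrt_weight_le (m : ℝ) (hm : 0 ≤ m) (ξ : R3) :
    Real.sqrt ((2 * Real.pi * ‖ξ‖) ^ 2 + m ^ 2) ≤ 2 * Real.pi * ‖ξ‖ + m := by
  have hpi := Real.pi_pos
  have h0 : 0 ≤ 2 * Real.pi * ‖ξ‖ := by positivity
  refine Real.sqrt_le_iff.2 ⟨by positivity, ?_⟩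
  nlinarith

theorem le_sqrt_weight (m : ℝ) (ξ : R3) :
    2 * Real.pi * ‖ξ‖ ≤ Real.sqrt ((2 * Real.pi * ‖ξ‖) ^ 2 + m ^ 2) :=
  Real.le_sqrt_of_sq_le (le_add_of_nonneg_right (sq_nonneg m))

theorem integrable_kinetic {u : L2} (hu : u ∈ HHalf) {m : ℝ} (hm : 0 ≤ m) :
    Integrable fun ξ : R3 => Real.sqrt ((2 * Real.pi * ‖ξ‖) ^ 2 + m ^ 2) * ‖fourierL2 u ξ‖ ^ 2 := by
  have hF := measurable_fourierL2 u
  refine Integrable.mono' ((integrable_norm_mul_fourierL2_sq hu).add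
    ((integrable_fourierL2_sq u).const_mul m)) (Measurable.aestronglyMeasurable (by fun_prop))
    (Eventually.of_forall fun ξ => ?_)
  rw [Real.norm_of_nonneg (by positivity), Pi.add_apply, ← add_mul]
  exact mul_le_mul_of_nonneg_right (sqrt_weight_le m hm ξ) (by positivity)

theorem kinetic_le {u : L2} (hu : u ∈ HHalf) {m : ℝ} (hm : 0 ≤ m) :
    kinetic m u ≤ kinetic 0 u + m * ‖u‖ ^ 2 := by
  rw [kinetic_zero_eq_integral, ← integral_fourierL2_sq, ← integral_const_mul, ← integral_add
    (integrable_norm_mul_fourierL2_sq hu) ((integrable_fourierL2_sq u).const_mul m), kinetic]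
  refine integral_mono (integrable_kinetic hu hm) ((integrable_norm_mul_fourierL2_sq hu).add
    ((integrable_fourierL2_sq u).const_mul m)) fun ξ => ?_
  simp only [← add_mul]
  exact mul_le_mul_of_nonneg_right (sqrt_weight_le m hm ξ) (by positivity)

theorem kinetic_zero_le {u : L2} (hu : u ∈ HHalf) {m : ℝ} (hm : 0 ≤ m) :
    kinetic 0 u ≤ kinetic m u := by
  rw [kinetic_zero_eq_integral, kinetic]
  refine integral_mono (integrable_norm_mul_fourierL2_sq hu) (integrable_kinetic hu hm) fun ξ => ?_
  exact mul_le_mul_of_nonneg_right (le_sqrt_weight m ξ) (by positivity)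

/-! ### Nonexistence of minimizers -/

theorem IsMinimizer.energy_le {m : ℝ} {V₁ V₂ : R3 → ℝ} {a₁ a₂ β : ℝ} {u v : L2 × L2}
    (hu : IsMinimizer m V₁ V₂ a₁ a₂ β u) (hv : v ∈ constraintSet V₁ V₂) :
    energy m V₁ V₂ a₁ a₂ β u ≤ energy m V₁ V₂ a₁ a₂ β v := by
  have h : (energy m V₁ V₂ a₁ a₂ β u : EReal) ≤ energy m V₁ V₂ a₁ a₂ β v := by
    rw [hu.2]
    exact iInf₂_le v hv
  exact_mod_cast h

/-- A minimizer would have a real energy bounding the family from below, while the negative slope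
drives the family to `-∞`. -/
theorem not_exists_isMinimizer_of_le {m : ℝ} {V₁ V₂ : R3 → ℝ} {a₁ a₂ β K d : ℝ} (hd : d < 0)
    (h : ∀ c : ℝ, 1 ≤ c → ∃ v ∈ constraintSet V₁ V₂, energy m V₁ V₂ a₁ a₂ β v ≤ K + c * d) :
    ¬ ∃ u, IsMinimizer m V₁ V₂ a₁ a₂ β u := by
  rintro ⟨u, hu⟩
  have h1 : Tendsto (fun c : ℝ => K + c * d) atTop atBot :=
    tendsto_atBot_add_const_left _ _ (tendsto_id.atTop_mul_const_of_neg hd)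
  obtain ⟨c, hc1, hc2⟩ := ((h1.eventually_lt_atBot (energy m V₁ V₂ a₁ a₂ β u)).and
    (eventually_ge_atTop 1)).exists
  obtain ⟨v, hv, hvE⟩ := h c hc2
  exact absurd (hu.energy_le hv) (not_le.2 (hvE.trans_lt hc1))

theorem hartreeEnergy_comm (u v : L2) : hartreeEnergy u v = hartreeEnergy v u := by
  rw [hartreeEnergy_eq, hartreeEnergy_eq, coulomb_comm (measurable_density (measurable_coeFn u))
    (measurable_density (measurable_coeFn v))]

/-- Dilates of a compactly supported function are admissible, with the expected bounds. -/
theorem IsTrapping.dilate_bounds {V : R3 → ℝ} (hV : IsTrapping V) {m : ℝ} (hm : 0 ≤ m) {φ : L2}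
    (hφ : φ ∈ HHalf) (hφ1 : ‖φ‖ = 1) (hsupp : ∃ ρ > 0, ∀ᵐ x, ρ ≤ ‖x‖ → φ x = 0) :
    ∃ B : ℝ, ∀ c : ℝ, ∀ hc : 0 < c, 1 ≤ c → dilate φ hc ∈ trapSpace V ∧
      kinetic m (dilate φ hc) + ∫ x, V x * dilate φ hc x ^ 2 ≤ B + c * kinetic 0 φ := by
  obtain ⟨ρ, -, hρ⟩ := hsupp
  obtain ⟨B, -, hB⟩ := hV.exists_bound ρ
  refine ⟨m + B, fun c hc hc1 => ?_⟩
  obtain ⟨h1, h2⟩ := hV.integrable_of_support hB (dilate_support hρ hc hc1)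
  have hH := HHalf_dilate hφ hc
  refine ⟨⟨hH, h1⟩, ?_⟩
  have h3 := kinetic_le hH hm
  rw [kinetic_zero_dilate] at h3
  rw [norm_dilate, hφ1] at h2 h3
  linarith

theorem integral_dilate_sq {φ : L2} (hφ1 : ‖φ‖ = 1) {c : ℝ} (hc : 0 < c) :
    ∫ x, dilate φ hc x ^ 2 = 1 := by
  rw [integral_sq_eq, norm_dilate, hφ1, one_pow]

/-- When only one component is concentrated, the coupling stays bounded for either sign of `β`:
Hardy is applied to the fixed component. -/
theorem abs_beta_hartreeEnergy_le {φ v : L2} (hφ : φ ∈ HHalf) (hv : ‖v‖ ^ 2 = 1) (β : ℝ) :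
    -β * hartreeEnergy v φ ≤ |β| * (hardyConst / kineticConst * kinetic 0 φ) := by
  have h1 := hartreeEnergy_le (u := v) hφ
  rw [hv, mul_one] at h1
  have h2 := hartreeEnergy_nonneg v φ
  calc -β * hartreeEnergy v φ ≤ |β| * hartreeEnergy v φ :=
        mul_le_mul_of_nonneg_right (neg_le_abs β) h2
    _ ≤ _ := by gcongr

/-- If some `aᵢ` is supercritical, that component alone is concentrated and the other is kept fixed.
If `β` is large, both components are the same concentrating function. -/
theorem not_exists_isMinimizer {m : ℝ} (hm : 0 ≤ m) {V₁ V₂ : R3 → ℝ} (hV₁ : IsTrapping V₁)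
    (hV₂ : IsTrapping V₂) {Q : L2} (hQ : IsGroundState Q) {a₁ a₂ β : ℝ}
    (h : ‖Q‖ ^ 2 < a₁ ∨ ‖Q‖ ^ 2 < a₂ ∨ (‖Q‖ ^ 2 - a₁) / 2 + (‖Q‖ ^ 2 - a₂) / 2 < β) :
    ¬ ∃ u, IsMinimizer m V₁ V₂ a₁ a₂ β u := by
  rcases h with h | h | h
  · obtain ⟨φ, hφ, hφ1, hsupp, hlt⟩ := hQ.exists_test (κ := a₁ / 2) (by linarith)
    obtain ⟨B₁, hB₁⟩ := hV₁.dilate_bounds hm hφ hφ1 hsupp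
    obtain ⟨B₂, hB₂⟩ := hV₂.dilate_bounds hm hφ hφ1 hsupp
    set ψ := dilate φ one_pos with hψ
    obtain ⟨hψV, hψB⟩ := hB₂ 1 one_pos le_rfl
    refine not_exists_isMinimizer_of_le (K := B₁ + (B₂ + 1 * kinetic 0 φ) -
      a₂ / 2 * hartreeEnergy ψ ψ + |β| * (hardyConst / kineticConst * kinetic 0 ψ))
      (d := kinetic 0 φ - a₁ / 2 * hartreeEnergy φ φ) (by linarith) fun c hc => ?_
    have hc0 : 0 < c := by linarith
    obtain ⟨h1, h2⟩ := hB₁ c hc0 hc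
    refine ⟨(dilate φ hc0, ψ), ⟨h1, hψV, integral_dilate_sq hφ1 hc0,
      integral_dilate_sq hφ1 one_pos⟩, ?_⟩
    have h3 := abs_beta_hartreeEnergy_le (v := dilate φ hc0) hψV.1
      (by rw [norm_dilate, hφ1, one_pow]) β
    simp only [energy]
    rw [hartreeEnergy_dilate φ hc0]
    linarith
  · obtain ⟨φ, hφ, hφ1, hsupp, hlt⟩ := hQ.exists_test (κ := a₂ / 2) (by linarith)
    obtain ⟨B₁, hB₁⟩ := hV₁.dilate_bounds hm hφ hφ1 hsupp
    obtain ⟨B₂, hB₂⟩ := hV₂.dilate_bounds hm hφ hφ1 hsupp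
    set ψ := dilate φ one_pos with hψ
    obtain ⟨hψV, hψB⟩ := hB₁ 1 one_pos le_rfl
    refine not_exists_isMinimizer_of_le (K := B₂ + (B₁ + 1 * kinetic 0 φ) -
      a₁ / 2 * hartreeEnergy ψ ψ + |β| * (hardyConst / kineticConst * kinetic 0 ψ))
      (d := kinetic 0 φ - a₂ / 2 * hartreeEnergy φ φ) (by linarith) fun c hc => ?_
    have hc0 : 0 < c := by linarith
    obtain ⟨h1, h2⟩ := hB₂ c hc0 hc
    refine ⟨(ψ, dilate φ hc0), ⟨hψV, h1, integral_dilate_sq hφ1 one_pos,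
      integral_dilate_sq hφ1 hc0⟩, ?_⟩
    have h3 := abs_beta_hartreeEnergy_le (v := dilate φ hc0) hψV.1
      (by rw [norm_dilate, hφ1, one_pow]) β
    rw [hartreeEnergy_comm] at h3
    simp only [energy]
    rw [hartreeEnergy_dilate φ hc0]
    linarith
  -- For equal components the energy has slope `2T - (a₁/2 + a₂/2 + β)D`, and the hypothesis on `β`
  -- says exactly that `a₁/2 + a₂/2 + β > ‖Q‖²`.
  · obtain ⟨φ, hφ, hφ1, hsupp, hlt⟩ := hQ.exists_test (κ := (a₁ / 2 + a₂ / 2 + β) / 2)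
      (by linarith)
    obtain ⟨B₁, hB₁⟩ := hV₁.dilate_bounds hm hφ hφ1 hsupp
    obtain ⟨B₂, hB₂⟩ := hV₂.dilate_bounds hm hφ hφ1 hsupp
    refine not_exists_isMinimizer_of_le (K := B₁ + B₂)
      (d := 2 * kinetic 0 φ - (a₁ / 2 + a₂ / 2 + β) * hartreeEnergy φ φ) (by linarith)
      fun c hc => ?_
    have hc0 : 0 < c := by linarith
    obtain ⟨h1, h2⟩ := hB₁ c hc0 hc
    obtain ⟨h3, h4⟩ := hB₂ c hc0 hc
    refine ⟨(dilate φ hc0, dilate φ hc0), ⟨h1, h3, integral_dilate_sq hφ1 hc0,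
      integral_dilate_sq hφ1 hc0⟩, ?_⟩
    simp only [energy]
    rw [hartreeEnergy_dilate φ hc0]
    linarith

/-! ### Continuity of the Hartree energy -/

theorem lintegral_enorm_sq_sub_sq_le (u v : L2) :
    ∫⁻ x, ‖v x ^ 2 - u x ^ 2‖ₑ ≤ ENNReal.ofReal (‖v - u‖ * ‖v + u‖) := by
  have hroot : ∀ w : L2, (∫⁻ x, ‖w x‖ₑ ^ 2) ^ (1 / 2 : ℝ) = ENNReal.ofReal ‖w‖ := by
    intro w
    have h : ∫⁻ x, ‖w x‖ₑ ^ 2 = ENNReal.ofReal (‖w‖ ^ 2) := lintegral_density w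
    rw [h, ENNReal.ofReal_rpow_of_nonneg (by positivity) (by norm_num), ← Real.sqrt_eq_rpow,
      Real.sqrt_sq (norm_nonneg w)]
  calc ∫⁻ x, ‖v x ^ 2 - u x ^ 2‖ₑ = ∫⁻ x, ‖(v - u) x‖ₑ * ‖(v + u) x‖ₑ := by
        refine lintegral_congr_ae ?_
        filter_upwards [Lp.coeFn_sub v u, Lp.coeFn_add v u] with x h1 h2
        rw [h1, h2, ← enorm_mul, Pi.sub_apply, Pi.add_apply]
        congr 1
        ring
    _ ≤ _ := by
        refine (lintegral_mul_le_sqrt volume (measurable_coeFn (v - u)).enorm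
          (measurable_coeFn (v + u)).enorm).trans (le_of_eq ?_)
        rw [hroot, hroot, ENNReal.ofReal_mul (norm_nonneg _)]

/-- `v² ≤ u² + |v² - u²|`, and the last density has mass at most `‖v - u‖ ‖v + u‖`; Hardy bounds the
potential of `w²` against it. -/
theorem hartreeEnergy_sub_le (u v : L2) {w : L2} (hw : w ∈ HHalf) :
    hartreeEnergy v w - hartreeEnergy u w ≤
      hardyConst / kineticConst * kinetic 0 w * (‖v - u‖ * ‖v + u‖) := by
  have hu := measurable_coeFn u
  have hv := measurable_coeFn v
  have hwm := measurable_coeFn w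
  have hK := kineticConst_pos
  have hH := hardyConst_pos
  have hT := kinetic_nonneg 0 w
  set F : R3 → ℝ≥0∞ := fun x => ‖v x ^ 2 - u x ^ 2‖ₑ with hF
  have hFm : Measurable F := ((hv.pow_const 2).sub (hu.pow_const 2)).enorm
  have hle : ∀ x, density v x ≤ density u x + F x := by
    intro x
    have e : ∀ f : R3 → ℝ, density f x = ‖f x ^ 2‖ₑ := fun f => (enorm_pow (f x) 2).symm
    rw [e, e]
    have h := enorm_add_le (u x ^ 2) (v x ^ 2 - u x ^ 2)
    rwa [add_sub_cancel] at h
  have h1 : coulomb (density v) (density w) ≤ coulomb (density u) (density w) +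
      ENNReal.ofReal (hardyConst / kineticConst * kinetic 0 w * (‖v - u‖ * ‖v + u‖)) := by
    calc coulomb (density v) (density w) ≤ coulomb (fun x => density u x + F x) (density w) :=
          coulomb_mono (Eventually.of_forall hle) (Eventually.of_forall fun x => le_rfl)
      _ = coulomb (density u) (density w) + coulomb F (density w) :=
          coulomb_add_left (measurable_density hu) (measurable_density hwm)
      _ ≤ _ := by
          gcongr
          refine (coulomb_density_le hFm hwm
            (by rw [lintegral_density]; exact ENNReal.ofReal_lt_top)).trans ?_
          refine (mul_le_mul' le_rfl (lintegral_enorm_sq_sub_sq_le u v)).trans (le_of_eq ?_)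
          rw [gagliardo_eq_ofReal hw, ← ENNReal.ofReal_mul hH.le,
            ← ENNReal.ofReal_mul (by positivity)]
          congr 1
          ring
  have h2 := ENNReal.toReal_mono
    (ENNReal.add_ne_top.2 ⟨(coulomb_lt_top hw).ne, ENNReal.ofReal_ne_top⟩) h1
  rw [ENNReal.toReal_add (coulomb_lt_top hw).ne ENNReal.ofReal_ne_top,
    ENNReal.toReal_ofReal (by positivity), ← hartreeEnergy_eq, ← hartreeEnergy_eq] at h2
  linarith

theorem abs_hartreeEnergy_sub_le (u v : L2) {w : L2} (hw : w ∈ HHalf) :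
    |hartreeEnergy v w - hartreeEnergy u w| ≤
      hardyConst / kineticConst * kinetic 0 w * (‖v - u‖ * ‖v + u‖) := by
  have h1 := hartreeEnergy_sub_le u v hw
  have h2 := hartreeEnergy_sub_le v u hw
  rw [norm_sub_rev, add_comm u v] at h2
  exact abs_sub_le_iff.2 ⟨h1, h2⟩

/-- One slot is changed at a time: the first change uses the kinetic bound on `w n`, the second uses
symmetry and the regularity of `u`. Strong `L²` convergence therefore suffices, without convergence
of the kinetic energies. -/
theorem tendsto_hartreeEnergy {v w : ℕ → L2} {u z : L2} (hv : Tendsto v atTop (nhds u))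
    (hw : Tendsto w atTop (nhds z)) (hu : u ∈ HHalf) (hwH : ∀ n, w n ∈ HHalf) {B : ℝ}
    (hB : ∀ n, kinetic 0 (w n) ≤ B) :
    Tendsto (fun n => hartreeEnergy (v n) (w n)) atTop (nhds (hartreeEnergy u z)) := by
  have hK := kineticConst_pos
  have hH := hardyConst_pos
  have h1 : ∀ {s : ℕ → L2} {t : L2}, Tendsto s atTop (nhds t) → ∀ c : ℝ,
      Tendsto (fun n => c * (‖s n - t‖ * ‖s n + t‖)) atTop (nhds 0) := by
    intro s t hs c
    have h := ((hs.sub_const t).norm.mul (hs.add_const t).norm).const_mul c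
    simpa using h
  have h2 : Tendsto (fun n => hartreeEnergy (v n) (w n) - hartreeEnergy u (w n)) atTop
      (nhds 0) := by
    refine squeeze_zero_norm (fun n => ?_) (h1 hv (hardyConst / kineticConst * B))
    rw [Real.norm_eq_abs]
    refine (abs_hartreeEnergy_sub_le u (v n) (hwH n)).trans ?_
    gcongr
    exact hB n
  have h3 : Tendsto (fun n => hartreeEnergy u (w n) - hartreeEnergy u z) atTop (nhds 0) := by
    refine squeeze_zero_norm (fun n => ?_) (h1 hw (hardyConst / kineticConst * kinetic 0 u))
    rw [Real.norm_eq_abs, hartreeEnergy_comm u, hartreeEnergy_comm u]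
    exact abs_hartreeEnergy_sub_le z (w n) hu
  have h4 := (h2.add h3).add_const (hartreeEnergy u z)
  simpa using h4

/-! ### Coercivity -/

theorem two_mul_hartreeEnergy_le {u v : L2} (hu : u ∈ HHalf) (hv : v ∈ HHalf) :
    2 * hartreeEnergy u v ≤ hartreeEnergy u u + hartreeEnergy v v := by
  have h := two_mul_coulomb_le (measurable_density (measurable_coeFn u))
    (measurable_density (measurable_coeFn v))
  have h1 := ENNReal.toReal_mono
    (ENNReal.add_ne_top.2 ⟨(coulomb_lt_top hu).ne, (coulomb_lt_top hv).ne⟩) h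
  rw [ENNReal.toReal_add (coulomb_lt_top hu).ne (coulomb_lt_top hv).ne, ENNReal.toReal_mul,
    ← hartreeEnergy_eq, ← hartreeEnergy_eq, ← hartreeEnergy_eq] at h1
  exact h1

/-- Positive definiteness applied to `p^{1/4} u` and `q^{1/4} v`, since the form is quadratic in the
densities. -/
theorem two_mul_sqrt_mul_hartreeEnergy_le {u v : L2} (hu : u ∈ HHalf) (hv : v ∈ HHalf) {p q : ℝ}
    (hp : 0 ≤ p) (hq : 0 ≤ q) :
    2 * (Real.sqrt (p * q) * hartreeEnergy u v) ≤
      p * hartreeEnergy u u + q * hartreeEnergy v v := by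
  have h := two_mul_hartreeEnergy_le (HHalf_smul hu (Real.sqrt (Real.sqrt p)))
    (HHalf_smul hv (Real.sqrt (Real.sqrt q)))
  simp only [hartreeEnergy_smul, Real.sq_sqrt (Real.sqrt_nonneg _), Real.mul_self_sqrt hp,
    Real.mul_self_sqrt hq] at h
  rw [Real.sqrt_mul hp]
  linarith

/-- All the inequalities are strict and continuous in `θ`, so they persist for `θ` slightly below 1.
-/
theorem exists_coercivity_factor {A a₁ a₂ β : ℝ} (h₁ : a₁ < A) (h₂ : a₂ < A)
    (hβ : β < Real.sqrt ((A - a₁) * (A - a₂))) :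
    ∃ θ : ℝ, 0 < θ ∧ θ < 1 ∧ a₁ < θ * A ∧ a₂ < θ * A ∧
      β < Real.sqrt ((θ * A - a₁) * (θ * A - a₂)) := by
  have hc : ∀ b : ℝ, b < A → ∀ᶠ θ in nhds (1 : ℝ), b < θ * A := fun b hb =>
    (ContinuousAt.tendsto (f := fun θ : ℝ => θ * A) (by fun_prop)).eventually_const_lt
      (by simpa using hb)
  have hs : ∀ᶠ θ in nhds (1 : ℝ), β < Real.sqrt ((θ * A - a₁) * (θ * A - a₂)) :=
    (ContinuousAt.tendsto (f := fun θ : ℝ => Real.sqrt ((θ * A - a₁) * (θ * A - a₂)))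
      (by fun_prop)).eventually_const_lt (by simpa using hβ)
  have h := (((eventually_gt_nhds (zero_lt_one' ℝ)).and (hc a₁ h₁)).and ((hc a₂ h₂).and hs))
  obtain ⟨θ, ⟨⟨h0, h3⟩, h4, h5⟩, h6⟩ :=
    ((h.filter_mono nhdsWithin_le_nhds).and (self_mem_nhdsWithin (s := Set.Iio (1 : ℝ)))).exists
  exact ⟨θ, h0, h6, h3, h4, h5⟩

/-- A fraction `θ` of the kinetic energy pays for the attraction: the sharp inequality gives
`θ‖Q‖²/2` of each self energy, and what exceeds `aᵢ/2` controls the coupling by positive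
definiteness. The fraction `1 - θ` remains. As `D ≥ 0`, only an upper bound on `β` matters. -/
theorem IsGroundState.exists_coercive {Q : L2} (hQ : IsGroundState Q) {m : ℝ} (hm : 0 ≤ m)
    (V₁ V₂ : R3 → ℝ) {a₁ a₂ β : ℝ} (h₁ : a₁ < ‖Q‖ ^ 2) (h₂ : a₂ < ‖Q‖ ^ 2)
    (hβ : β < Real.sqrt ((‖Q‖ ^ 2 - a₁) * (‖Q‖ ^ 2 - a₂))) :
    ∃ δ : ℝ, 0 < δ ∧ ∀ u ∈ constraintSet V₁ V₂,
      δ * (kinetic m u.1 + kinetic m u.2) + ((∫ x, V₁ x * u.1 x ^ 2) + ∫ x, V₂ x * u.2 x ^ 2) ≤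
        energy m V₁ V₂ a₁ a₂ β u := by
  obtain ⟨θ, hθ0, hθ1, h3, h4, h5⟩ := exists_coercivity_factor h₁ h₂ hβ
  obtain ⟨-, -, -, hsharp⟩ := hQ.sharp
  refine ⟨1 - θ, by linarith, fun u hu => ?_⟩
  obtain ⟨⟨hu₁, -⟩, ⟨hu₂, -⟩, hn₁, hn₂⟩ := hu
  have hD := two_mul_sqrt_mul_hartreeEnergy_le hu₁ hu₂ (sub_nonneg.2 h3.le) (sub_nonneg.2 h4.le)
  have hb := mul_le_mul_of_nonneg_right h5.le (hartreeEnergy_nonneg u.1 u.2)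
  have hT : ∀ w ∈ HHalf, ∫ x, w x ^ 2 = 1 →
      θ * ‖Q‖ ^ 2 / 2 * hartreeEnergy w w ≤ θ * kinetic m w := by
    intro w hw hw1
    have h6 := hsharp w hw
    rw [integral_sq_eq] at hw1
    rw [hw1] at h6
    have h7 := mul_le_mul_of_nonneg_left (kinetic_zero_le hw hm) hθ0.le
    have h8 := mul_le_mul_of_nonneg_left h6 hθ0.le
    linarith
  have hT₁ := hT _ hu₁ hn₁
  have hT₂ := hT _ hu₂ hn₂
  simp only [energy]
  linarith

/-! ### Compactness of trapped sequences -/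

theorem mem_HHalf_of_finiteForm {m : ℝ} (hm : 0 < m) {u : L2}
    (hu : FiniteForm (fun ξ => Real.sqrt ((2 * Real.pi * ‖ξ‖) ^ 2 + m ^ 2)) u) : u ∈ HHalf := by
  have hF := measurable_fourierL2 u
  refine Integrable.mono' (Integrable.const_mul hu (m⁻¹ + 1))
    (Measurable.aestronglyMeasurable (by fun_prop)) (Eventually.of_forall fun ξ => ?_)
  have hpi := Real.pi_pos
  have h1 := le_sqrt_weight m ξ
  have h2 : m ≤ Real.sqrt ((2 * Real.pi * ‖ξ‖) ^ 2 + m ^ 2) :=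
    Real.le_sqrt_of_sq_le (le_add_of_nonneg_left (sq_nonneg _))
  rw [Real.norm_of_nonneg (by positivity), ← mul_assoc]
  refine mul_le_mul_of_nonneg_right ?_ (by positivity)
  have h3 : 1 ≤ m⁻¹ * Real.sqrt ((2 * Real.pi * ‖ξ‖) ^ 2 + m ^ 2) := by
    rw [inv_mul_eq_div, le_div_iff₀ hm, one_mul]
    exact h2
  linarith

/-- Chebyshev's inequality: outside a large ball the potential exceeds `k`, so the mass there is at
most `B/k`. Using `|B| + 1` keeps `k` positive for any `B`. -/
theorem IsTrapping.exists_tight {V : R3 → ℝ} (hV : IsTrapping V) {B : ℝ} {δ : ℝ≥0∞} (hδ : 0 < δ) :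
    ∃ R > 0, ∀ u ∈ trapSpace V, ∫ x, V x * u x ^ 2 ≤ B →
      ∫⁻ x in (Metric.ball (0 : R3) R)ᶜ, density u x ≤ δ := by
  obtain ⟨r, hr, hrδ⟩ : ∃ r : ℝ, 0 < r ∧ ENNReal.ofReal r ≤ δ := by
    obtain ⟨r, hr0, hr⟩ := ENNReal.lt_iff_exists_nnreal_btwn.1 hδ
    exact ⟨r, by exact_mod_cast hr0, by rw [ENNReal.ofReal_coe_nnreal]; exact hr.le⟩
  set k := (|B| + 1) / r with hk
  have hk0 : 0 < k := by positivity
  obtain ⟨R₀, hR₀⟩ := Metric.closedBall_compl_subset_of_mem_cocompact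
    (hV.tendsto.eventually_ge_atTop k) 0
  refine ⟨max R₀ 0 + 1, by positivity, fun u hu hB => ?_⟩
  have hVk : ∀ x ∈ (Metric.ball (0 : R3) (max R₀ 0 + 1))ᶜ, k ≤ V x := by
    intro x hx
    refine hR₀ ?_
    rw [Set.mem_compl_iff, Metric.mem_ball, not_lt] at hx
    rw [Set.mem_compl_iff, Metric.mem_closedBall, not_le]
    linarith [le_max_left R₀ 0]
  have hpos : ∀ x, 0 ≤ k⁻¹ * (V x * u x ^ 2) := fun x => by
    have := hV.nonneg x
    positivity
  calc ∫⁻ x in (Metric.ball (0 : R3) (max R₀ 0 + 1))ᶜ, density u x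
      ≤ ∫⁻ x in (Metric.ball (0 : R3) (max R₀ 0 + 1))ᶜ, ENNReal.ofReal (k⁻¹ * (V x * u x ^ 2)) := by
        refine setLIntegral_mono' measurableSet_ball.compl fun x hx => ?_
        rw [density_eq_ofReal]
        refine ENNReal.ofReal_le_ofReal ?_
        rw [← mul_assoc]
        refine le_mul_of_one_le_left (sq_nonneg _) ?_
        rw [inv_mul_eq_div, le_div_iff₀ hk0, one_mul]
        exact hVk x hx
    _ ≤ ∫⁻ x, ENNReal.ofReal (k⁻¹ * (V x * u x ^ 2)) := setLIntegral_le_lintegral _ _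
    _ = ENNReal.ofReal (k⁻¹ * ∫ x, V x * u x ^ 2) := by
        rw [← integral_const_mul, ofReal_integral_eq_lintegral_ofReal (hu.2.const_mul _)
          (Eventually.of_forall hpos)]
    _ ≤ ENNReal.ofReal r := by
        refine ENNReal.ofReal_le_ofReal ?_
        rw [inv_mul_eq_div, div_le_iff₀ hk0, hk, mul_div_cancel₀ _ hr.ne']
        linarith [le_abs_self B]
    _ ≤ δ := hrδ

theorem tendsto_zero_of_tight {w : ℕ → L2} {C B : ℝ} (hw : WeaklyNull w C B)
    (htight : ∀ δ : ℝ≥0∞, 0 < δ → ∃ R : ℝ, ∀ n,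
      ∫⁻ x in (Metric.ball (0 : R3) R)ᶜ, density (w n) x ≤ δ) :
    Tendsto w atTop (nhds 0) := by
  have h : Tendsto (fun n => ∫⁻ x, density (w n) x) atTop (nhds 0) := by
    rw [ENNReal.tendsto_nhds_zero]
    intro ε hε
    have hε2 := ENNReal.half_pos hε.ne'
    obtain ⟨R, hR⟩ := htight _ hε2
    filter_upwards [(tendsto_setLIntegral_density hw.tendsto_inner hw.norm_le hw.gagliardo_le
      R).eventually_le_const hε2] with n hn
    rw [← lintegral_add_compl _ (measurableSet_ball (x := (0 : R3)) (ε := R)),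
      ← ENNReal.add_halves ε]
    exact add_le_add hn (hR n)
  simp only [lintegral_density] at h
  have h1 := (ENNReal.tendsto_toReal ENNReal.zero_ne_top).comp h
  have h2 := h1.sqrt
  rw [tendsto_zero_iff_norm_tendsto_zero]
  refine (h2.congr fun n => ?_).trans (by simp)
  rw [Function.comp_apply, ENNReal.toReal_ofReal (by positivity), Real.sqrt_sq (norm_nonneg _)]

/-- Sequences of bounded energy in a trapping potential have subsequences converging strongly in
`L²` and almost everywhere, along which the kinetic energy is lower semicontinuous. -/
theorem IsTrapping.exists_limit {V : R3 → ℝ} (hV : IsTrapping V) {m : ℝ} (hm : 0 < m) {v : ℕ → L2}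
    (hv : ∀ n, v n ∈ trapSpace V) {C B B' : ℝ} (hC : ∀ n, ‖v n‖ ≤ C)
    (hB : ∀ n, kinetic m (v n) ≤ B) (hB' : ∀ n, ∫ x, V x * v n x ^ 2 ≤ B') :
    ∃ u ∈ HHalf, ∃ φ : ℕ → ℕ, StrictMono φ ∧ Tendsto (v ∘ φ) atTop (nhds u) ∧
      (∀ᵐ x, Tendsto (fun n => v (φ n) x) atTop (nhds (u x))) ∧
      ∀ ε > 0, ∀ᶠ n in atTop, kinetic m u ≤ kinetic m (v (φ n)) + ε := by
  have hpi := Real.pi_pos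
  set σ : R3 → ℝ := fun ξ => Real.sqrt ((2 * Real.pi * ‖ξ‖) ^ 2 + m ^ 2) with hσ
  have hσm : Measurable σ := by simp only [hσ]; fun_prop
  have hσc : ∀ ξ, m ≤ σ ξ := fun ξ =>
    Real.le_sqrt_of_sq_le (le_add_of_nonneg_left (sq_nonneg _))
  obtain ⟨u, φ, hφ, hufin, hweak, hsplit⟩ := exists_weak_limit_weightedForm hσm hm hσc hC
    (fun n => integrable_kinetic (hv n).1 hm.le) hB
  have hu := mem_HHalf_of_finiteForm hm hufin
  have hwH : ∀ n, v (φ n) - u ∈ HHalf := fun n => HHalf_sub (hv (φ n)).1 hu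
  -- The splitting bounds the difference of the two forms from below, hence the kinetic energy of
  -- the remainders from above by `B - b`.
  obtain ⟨b, hb⟩ := hsplit.bddBelow_range
  have hK := kineticConst_pos
  have hw : WeaklyNull (fun n => v (φ n) - u) (C + ‖u‖) ((B - b) / kineticConst) := by
    refine ⟨fun g => ?_, fun n => (norm_sub_le _ _).trans (add_le_add (hC _) le_rfl), fun n => ?_⟩
    · have h := (hweak g).sub_const (inner ℝ g u)
      rw [sub_self] at h
      exact h.congr fun n => (inner_sub_right _ _ _).symm
    · rw [gagliardo_eq_ofReal (hwH n)]
      refine ENNReal.ofReal_le_ofReal ?_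
      gcongr
      refine (kinetic_zero_le (hwH n) hm.le).trans ?_
      have h1 : b ≤ kinetic m (v (φ n)) - kinetic m (v (φ n) - u) := hb (Set.mem_range_self n)
      linarith [hB (φ n)]
  have hstrong : Tendsto (fun n => v (φ n) - u) atTop (nhds 0) := by
    refine tendsto_zero_of_tight hw fun δ hδ => ?_
    -- The factors 2 come from `(v - u)² ≤ 2v² + 2u²`: the tail of the sequence is controlled by the
    -- trap, that of the limit by integrability.
    obtain ⟨η, hη, hηδ⟩ : ∃ η : ℝ≥0∞, 0 < η ∧ 2 * η + 2 * η = δ := by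
      refine ⟨δ / 2 / 2, ENNReal.half_pos (ENNReal.half_pos hδ.ne').ne', ?_⟩
      rw [ENNReal.mul_div_cancel two_ne_zero ENNReal.ofNat_ne_top, ENNReal.add_halves]
    obtain ⟨R₁, hR₁, h1⟩ := hV.exists_tight (B := B') hη
    obtain ⟨R₂, hR₂, h2⟩ := exists_lintegral_compl_ball_le
      (measurable_density (measurable_coeFn u))
      (by rw [lintegral_density]; exact ENNReal.ofReal_ne_top) hη
    refine ⟨max R₁ R₂, fun n => ?_⟩
    have hpt : ∀ᵐ x, density (v (φ n) - u : L2) x ≤ 2 * density (v (φ n)) x + 2 * density u x := by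
      filter_upwards [Lp.coeFn_sub (v (φ n)) u] with x hx
      have h3 := density_le_two_mul (v (φ n) - u : L2) (v (φ n)) x
      have h4 : ‖(v (φ n) - u : L2) x - v (φ n) x‖ₑ ^ 2 = density u x := by
        rw [hx, Pi.sub_apply, sub_sub_cancel_left, enorm_neg]
        rfl
      rwa [h4] at h3
    have hmono : ∀ {R : ℝ} (f : R3 → ℝ≥0∞), R ≤ max R₁ R₂ →
        ∫⁻ x in (Metric.ball (0 : R3) (max R₁ R₂))ᶜ, f x ≤
          ∫⁻ x in (Metric.ball (0 : R3) R)ᶜ, f x := fun f hR =>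
      lintegral_mono_set (Set.compl_subset_compl.2 (Metric.ball_subset_ball hR))
    refine (lintegral_mono_ae (ae_restrict_of_ae hpt)).trans ?_
    have hvm := measurable_density (measurable_coeFn (v (φ n)))
    rw [lintegral_add_left (by fun_prop), lintegral_const_mul' _ _ ENNReal.ofNat_ne_top,
      lintegral_const_mul' _ _ ENNReal.ofNat_ne_top, ← hηδ]
    gcongr
    · exact (hmono _ (le_max_left _ _)).trans (h1 _ (hv _) (hB' _))
    · exact (hmono _ (le_max_right _ _)).trans h2
  have hlim : Tendsto (v ∘ φ) atTop (nhds u) := by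
    have h := hstrong.add_const u
    simpa [Function.comp_def] using h
  obtain ⟨ψ, hψ, hae⟩ := (tendstoInMeasure_of_tendsto_Lp hlim).exists_seq_tendsto_ae
  refine ⟨u, hu, φ ∘ ψ, hφ.comp hψ, hlim.comp hψ.tendsto_atTop, hae, fun ε hε => ?_⟩
  filter_upwards [(hsplit.comp hψ.tendsto_atTop).eventually_const_lt
    (sub_lt_self (weightedForm σ u) hε)] with n hn
  have h1 : 0 ≤ weightedForm σ (v (φ (ψ n)) - u) :=
    weightedForm_nonneg (fun ξ => hm.le.trans (hσc ξ)) _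
  have h2 : weightedForm σ u - ε <
    weightedForm σ (v (φ (ψ n))) - weightedForm σ (v (φ (ψ n)) - u) := hn
  have h3 : weightedForm σ u ≤ weightedForm σ (v (φ (ψ n))) + ε := by linarith
  exact h3

/-- Lower semicontinuity of the potential energy under almost everywhere convergence. -/
theorem IsTrapping.integrable_limit {V : R3 → ℝ} (hV : IsTrapping V) {v : ℕ → L2} {u : L2}
    (hv : ∀ n, Integrable fun x => V x * v n x ^ 2) {B : ℝ} (hB : ∀ n, ∫ x, V x * v n x ^ 2 ≤ B)
    (hae : ∀ᵐ x, Tendsto (fun n => v n x) atTop (nhds (u x))) :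
    (Integrable fun x => V x * u x ^ 2) ∧
      ∀ ε > 0, ∀ᶠ n in atTop, ∫ x, V x * u x ^ 2 ≤ (∫ x, V x * v n x ^ 2) + ε := by
  have hpos : ∀ (w : L2) x, 0 ≤ V x * w x ^ 2 := fun w x => mul_nonneg (hV.nonneg x) (sq_nonneg _)
  have hmeas : ∀ w : L2, AEStronglyMeasurable (fun x => V x * w x ^ 2) volume := fun w =>
    hV.aestronglyMeasurable.mul ((measurable_coeFn w).pow_const 2).aestronglyMeasurable
  have hI : ∀ n, ∫⁻ x, ENNReal.ofReal (V x * v n x ^ 2) =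
      ENNReal.ofReal (∫ x, V x * v n x ^ 2) := fun n =>
    (ofReal_integral_eq_lintegral_ofReal (hv n) (Eventually.of_forall (hpos (v n)))).symm
  have hfatou : ∫⁻ x, ENNReal.ofReal (V x * u x ^ 2) ≤
      liminf (fun n => ENNReal.ofReal (∫ x, V x * v n x ^ 2)) atTop := by
    have h1 := lintegral_liminf_le' (μ := (volume : Measure R3)) (u := atTop)
      (f := fun n x => ENNReal.ofReal (V x * v n x ^ 2))
      fun n => (hmeas (v n)).aemeasurable.ennreal_ofReal
    simp only [hI] at h1
    refine le_trans (lintegral_mono_ae ?_) h1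
    filter_upwards [hae] with x hx
    exact (ENNReal.tendsto_ofReal ((hx.pow 2).const_mul (V x))).liminf_eq.ge
  have hint : Integrable fun x => V x * u x ^ 2 := by
    refine ⟨hmeas u, ?_⟩
    rw [hasFiniteIntegral_iff_ofReal (Eventually.of_forall (hpos u))]
    refine hfatou.trans_lt (lt_of_le_of_lt (liminf_le_of_frequently_le' ?_)
      (ENNReal.ofReal_lt_top (r := B)))
    exact Frequently.of_forall fun n => ENNReal.ofReal_le_ofReal (hB n)
  refine ⟨hint, fun ε hε => ?_⟩
  rw [← ofReal_integral_eq_lintegral_ofReal hint (Eventually.of_forall (hpos u))] at hfatou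
  -- Passing to `ENNReal.ofReal` preserves the strict inequality only below a positive value; when
  -- the limit has zero potential energy the claim is immediate.
  rcases (integral_nonneg (μ := volume) (f := fun x => V x * u x ^ 2) (hpos u)).eq_or_lt with h0 | h0
  · refine Eventually.of_forall fun n => ?_
    have := integral_nonneg (μ := volume) (f := fun x => V x * v n x ^ 2) (hpos (v n))
    rw [← h0]
    exact add_nonneg this hε.le
  · have h1 : ENNReal.ofReal ((∫ x, V x * u x ^ 2) - ε) < ENNReal.ofReal (∫ x, V x * u x ^ 2) :=
      (ENNReal.ofReal_lt_ofReal_iff h0).2 (sub_lt_self _ hε)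
    filter_upwards [eventually_lt_of_lt_liminf (h1.trans_le hfatou)] with n hn
    have h2 := (ENNReal.ofReal_lt_ofReal_iff'.1 hn).1
    linarith

/-! ### Existence of minimizers -/

/-- The direct method: coercivity bounds a minimizing sequence, the traps give strong `L²` limits
and so preserve the constraints, the interaction terms converge, and the kinetic and potential terms
are lower semicontinuous. -/
theorem exists_isMinimizer {m : ℝ} (hm : 0 < m) {V₁ V₂ : R3 → ℝ} (hV₁ : IsTrapping V₁)
    (hV₂ : IsTrapping V₂) {Q : L2} (hQ : IsGroundState Q) {a₁ a₂ β : ℝ} (h₁ : a₁ < ‖Q‖ ^ 2)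
    (h₂ : a₂ < ‖Q‖ ^ 2) (hβ : β < Real.sqrt ((‖Q‖ ^ 2 - a₁) * (‖Q‖ ^ 2 - a₂))) :
    ∃ u, IsMinimizer m V₁ V₂ a₁ a₂ β u := by
  obtain ⟨δ, hδ, hcoer⟩ := hQ.exists_coercive hm.le V₁ V₂ h₁ h₂ hβ
  set S := energy m V₁ V₂ a₁ a₂ β '' constraintSet V₁ V₂ with hS
  -- Any compactly supported normalized function is admissible; the choice `κ = ‖Q‖²/2 + 1` only
  -- serves to obtain one.
  have hne : S.Nonempty := by
    obtain ⟨φ, hφ, hφ1, hsupp, -⟩ := hQ.exists_test (lt_add_one (‖Q‖ ^ 2 / 2))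
    obtain ⟨_, hB₁⟩ := hV₁.dilate_bounds hm.le hφ hφ1 hsupp
    obtain ⟨_, hB₂⟩ := hV₂.dilate_bounds hm.le hφ hφ1 hsupp
    exact ⟨_, (dilate φ one_pos, dilate φ one_pos), ⟨(hB₁ 1 one_pos le_rfl).1,
      (hB₂ 1 one_pos le_rfl).1, integral_dilate_sq hφ1 one_pos, integral_dilate_sq hφ1 one_pos⟩,
      rfl⟩
  have hT0 : ∀ w : L2, 0 ≤ kinetic m w := kinetic_nonneg m
  have hI0 : ∀ {V : R3 → ℝ}, IsTrapping V → ∀ w : L2, 0 ≤ ∫ x, V x * w x ^ 2 := fun hV w =>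
    integral_nonneg fun x => mul_nonneg (hV.nonneg x) (sq_nonneg _)
  have hbdd : BddBelow S := by
    refine ⟨0, ?_⟩
    rintro _ ⟨u, hu, rfl⟩
    refine le_trans ?_ (hcoer u hu)
    have := hT0 u.1
    have := hT0 u.2
    have := hI0 hV₁ u.1
    have := hI0 hV₂ u.2
    positivity
  obtain ⟨e, -, he, heS⟩ := exists_seq_tendsto_sInf hne hbdd
  choose v hv hve using heS
  obtain ⟨B, hB⟩ := he.bddAbove_range
  have hEB : ∀ n, energy m V₁ V₂ a₁ a₂ β (v n) ≤ B := fun n => by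
    rw [hve]; exact hB (Set.mem_range_self n)
  have hTB : ∀ n, kinetic m (v n).1 ≤ B / δ ∧ kinetic m (v n).2 ≤ B / δ := by
    intro n
    have h := (hcoer _ (hv n)).trans (hEB n)
    have := mul_nonneg hδ.le (hT0 (v n).1)
    have := mul_nonneg hδ.le (hT0 (v n).2)
    have := hI0 hV₁ (v n).1
    have := hI0 hV₂ (v n).2
    rw [le_div_iff₀ hδ, le_div_iff₀ hδ]
    constructor <;> linarith
  have hVB : ∀ n, ∫ x, V₁ x * (v n).1 x ^ 2 ≤ B ∧ ∫ x, V₂ x * (v n).2 x ^ 2 ≤ B := by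
    intro n
    have h := (hcoer _ (hv n)).trans (hEB n)
    have := mul_nonneg hδ.le (hT0 (v n).1)
    have := mul_nonneg hδ.le (hT0 (v n).2)
    have := hI0 hV₁ (v n).1
    have := hI0 hV₂ (v n).2
    constructor <;> linarith
  have hnorm : ∀ w : L2, ∫ x, w x ^ 2 = 1 → ‖w‖ = 1 := by
    intro w hw
    rw [integral_sq_eq] at hw
    exact (pow_eq_one_iff_of_nonneg (norm_nonneg w) two_ne_zero).1 hw
  have hn₁ : ∀ n, ‖(v n).1‖ = 1 := fun n => hnorm _ (hv n).2.2.1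
  have hn₂ : ∀ n, ‖(v n).2‖ = 1 := fun n => hnorm _ (hv n).2.2.2
  obtain ⟨u₁, hu₁, φ, hφ, hlim₁, hae₁, hlsc₁⟩ := hV₁.exists_limit hm (fun n => (hv n).1)
    (fun n => (hn₁ n).le) (fun n => (hTB n).1) (fun n => (hVB n).1)
  -- The second component is extracted along the first subsequence, so that both components converge
  -- along `φ ∘ ψ`.
  obtain ⟨u₂, hu₂, ψ, hψ, hlim₂, hae₂, hlsc₂⟩ := hV₂.exists_limit hm
    (v := fun n => (v (φ n)).2) (fun n => (hv _).2.1)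
    (fun n => (hn₂ _).le) (fun n => (hTB _).2) (fun n => (hVB _).2)
  obtain ⟨hint₁, hpot₁⟩ := hV₁.integrable_limit (v := fun n => (v (φ n)).1)
    (fun n => (hv _).1.2) (fun n => (hVB _).1) hae₁
  obtain ⟨hint₂, hpot₂⟩ := hV₂.integrable_limit (v := fun n => (v (φ (ψ n))).2)
    (fun n => (hv _).2.1.2) (fun n => (hVB _).2) hae₂
  have hψt := hψ.tendsto_atTop
  have hl₁ : Tendsto (fun n => (v (φ (ψ n))).1) atTop (nhds u₁) := hlim₁.comp hψt
  have hl₂ : Tendsto (fun n => (v (φ (ψ n))).2) atTop (nhds u₂) := hlim₂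
  have hH₁ : ∀ n, (v n).1 ∈ HHalf := fun n => (hv n).1.1
  have hH₂ : ∀ n, (v n).2 ∈ HHalf := fun n => (hv n).2.1.1
  have hk₁ : ∀ n, kinetic 0 (v n).1 ≤ B / δ := fun n =>
    (kinetic_zero_le (hH₁ n) hm.le).trans (hTB n).1
  have hk₂ : ∀ n, kinetic 0 (v n).2 ≤ B / δ := fun n =>
    (kinetic_zero_le (hH₂ n) hm.le).trans (hTB n).2
  have hunit : ∀ {w : ℕ → L2} {z : L2}, Tendsto w atTop (nhds z) → (∀ n, ‖w n‖ = 1) →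
      ∫ x, z x ^ 2 = 1 := by
    intro w z hw h1
    have h := hw.norm
    simp only [h1] at h
    rw [integral_sq_eq, ← tendsto_nhds_unique tendsto_const_nhds h, one_pow]
  have hmem : (u₁, u₂) ∈ constraintSet V₁ V₂ := ⟨⟨hu₁, hint₁⟩, ⟨hu₂, hint₂⟩,
    hunit hl₁ fun n => hn₁ _, hunit hl₂ fun n => hn₂ _⟩
  have hD := (((tendsto_hartreeEnergy hl₁ hl₁ hu₁ (fun n => hH₁ _) fun n => hk₁ _).const_mul
    (a₁ / 2)).add ((tendsto_hartreeEnergy hl₂ hl₂ hu₂ (fun n => hH₂ _) fun n => hk₂ _).const_mul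
    (a₂ / 2))).add ((tendsto_hartreeEnergy hl₁ hl₂ hu₁ (fun n => hH₂ _) fun n => hk₂ _).const_mul β)
  have hE : Tendsto (fun n => energy m V₁ V₂ a₁ a₂ β (v (φ (ψ n)))) atTop (nhds (sInf S)) := by
    simp only [hve]
    exact he.comp (hφ.tendsto_atTop.comp hψt)
  have hle : energy m V₁ V₂ a₁ a₂ β (u₁, u₂) ≤ sInf S := by
    refine le_of_forall_pos_le_add fun ε hε => ?_
    have hε4 : 0 < ε / 4 := by positivity
    -- The comparison sequence is the energy plus `ε` plus the interaction of the sequence minus its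
    -- limit. The interactions cancel, leaving two kinetic and two potential inequalities, each with
    -- error `ε/4`.
    refine ge_of_tendsto ((hE.add_const ε).add ((hD.sub_const _).trans (by rw [sub_self])) |>.trans
      (by rw [add_zero])) ?_
    filter_upwards [hψt.eventually (hlsc₁ _ hε4), hlsc₂ _ hε4, hψt.eventually (hpot₁ _ hε4),
      hpot₂ _ hε4] with n g1 g2 g3 g4
    simp only [energy]
    linarith
  refine ⟨(u₁, u₂), hmem, le_antisymm (le_iInf₂ fun w hw => ?_) (iInf₂_le _ hmem)⟩
  exact_mod_cast hle.trans (csInf_le hbdd ⟨w, hw, rfl⟩)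

end Hartree

end

/-! ### The existence and nonexistence theorem -/

theorem theorem1p1 (m : ℝ) (hm : 0 < m) (V₁ V₂ : Hartree.R3 → ℝ)
    (hV₁ : Hartree.IsTrapping V₁) (hV₂ : Hartree.IsTrapping V₂)
    (Q : Hartree.L2) (hQ : Hartree.IsGroundState Q)
    (hQpos : Hartree.IsPositive Q) (hQrad : Hartree.IsRadial Q)
    (aStar : ℝ) (haStar : aStar = ‖Q‖ ^ 2) :
    (∀ a₁ a₂ β : ℝ, a₁ ∈ Set.Ioo 0 aStar → a₂ ∈ Set.Ioo 0 aStar →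
      β < Real.sqrt ((aStar - a₁) * (aStar - a₂)) →
      ∃ u : Hartree.L2 × Hartree.L2, Hartree.IsMinimizer m V₁ V₂ a₁ a₂ β u) ∧
    (∀ a₁ a₂ β : ℝ,
      (aStar < a₁ ∨ aStar < a₂ ∨ (aStar - a₁) / 2 + (aStar - a₂) / 2 < β) →
      ¬ ∃ u : Hartree.L2 × Hartree.L2, Hartree.IsMinimizer m V₁ V₂ a₁ a₂ β u) := by
  subst haStar
  refine ⟨fun a₁ a₂ β h₁ h₂ hβ => ?_, fun a₁ a₂ β h =>
    Hartree.not_exists_isMinimizer hm.le hV₁ hV₂ hQ h⟩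
  exact Hartree.exists_isMinimizer hm hV₁ hV₂ hQ h₁.2 h₂.2 hβ
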